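/- Let $\mathbb{K}$ be a field of characteristic zero, $G$ an abelian group (written additively) and $\varepsilon:G\times G\to\mathbb{K}^\times$ an antisymmetric bicharacter, i.e. $\varepsilon(g,h)\varepsilon(h,g)=1$, $\varepsilon(g,h+k)=\varepsilon(g,h)\varepsilon(g,k)$, $\varepsilon(g+h,k)=\varepsilon(g,k)\varepsilon(h,k)$. Let $L=\bigoplus_{g\in G}L_g$ be a $G$-graded $\varepsilon$-Lie algebra (color Lie algebra): a graded vector space over $\mathbb{K}$ (of any dimension) with a bilinear bracket such that $[L_g,L_h]\subseteq L_{g+h}$ and, for homogeneous $a,b,c$ of degrees $|a|,|b|,|c|$, $$[a,b]=-\varepsilon(|a|,|b|)[b,a],\qquad \varepsilon(|c|,|a|)[a,[b,c]]+\varepsilon(|a|,|b|)[b,[c,a]]+\varepsilon(|b|,|c|)[c,[a,b]]=0 .$$ Let $U(L)$ be its universal enveloping algebra, the quotient of the tensor algebra $T(L)$ by the two-sided ideal generated by all $a\otimes b-\varepsilon(|a|,|b|)\,b\otimes a-[a,b]$ with $a,b$ homogeneous, let $\wedge_\varepsilon L$ be the quotient of $T(L)$ by the two-sided ideal generated by all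 $a\otimes b+\varepsilon(|a|,|b|)\,b\otimes a$ with $a,b$ homogeneous, let $\wedge^n_\varepsilon L$ be its component of tensor degree $n$, and write $\langle x_1,\dots,x_n\rangle=x_1\wedge\cdots\wedge x_n$. All of these carry the $G$-gradings induced by that of $L$. Put $C_n=U(L)\otimes_{\mathbb{K}}\wedge^n_\varepsilon L$, with $U(L)$ acting by left multiplication on the first factor and with $|u\otimes v|=|u|+|v|$. Let $\mathbb{K}$ be the trivial $U(L)$-module, on which $L$ acts by zero, concentrated in degree $0\in G$, and let $\epsilon:C_0\to\mathbb{K}$ be the augmentation $u\otimes c\mapsto c\,\epsilon_U(u)$, where $\epsilon_U:U(L)\to\mathbb{K}$ is the algebra homomorphism that vanishes on the image of $L$. Then there are unique $U(L)$-linear maps $d_n:C_n\to C_{n-1}$ $(n\ge 1)$ such that, for all $u\in U(L)$ and all homogeneous $x_1,\dots,x_n\in L$, $$d_n(u\otimes\langle x_1,\dots,x_n\rangle)=\sum_{i=1}^n(-1)^{i+1}\varepsilon_i\,ux_i\otimes\langle x_1,\dots,\widehat{x_i},\dots,x_n\rangle+\sum_{1\le i<j\le n}(-1)^{i+j}\varepsilon_i\varepsilon_j\,\varepsilon(|x_j|,|x_i|)\,u\otimes\langle[x_i,x_j],x_1,\dots,\widehat{x_i},\dots,\widehat{x_j},\dots,x_n\rangle,$$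 where $\varepsilon_i=\prod_{h=1}^{i-1}\varepsilon(|x_h|,|x_i|)$, and the sequence $$\cdots\to C_n\xrightarrow{d_n}C_{n-1}\to\cdots\to C_1\xrightarrow{d_1}C_0\xrightarrow{\epsilon}\mathbb{K}\to0$$ is a $G$-graded free $U(L)$-resolution of $\mathbb{K}$: $U(L)$ is a $G$-graded algebra, $\mathbb{K}$ and all $C_n$ are $G$-graded $U(L)$-modules, each $C_n$ has a $U(L)$-basis of homogeneous elements, all maps are $U(L)$-linear and preserve the $G$-degree, and the sequence is exact. -/

import Mathlib

open scoped TensorProduct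

/-- An antisymmetric bicharacter `ε : G × G → Kˣ` of an (additively written) abelian group. -/
structure SkewBicharacter (G : Type*) (K : Type*) [AddCommGroup G] [Field K] where
  toFun : G → G → Kˣ
  mul_swap : ∀ g h, toFun g h * toFun h g = 1
  map_add_right : ∀ g h k, toFun g (h + k) = toFun g h * toFun g k
  map_add_left : ∀ g h k, toFun (g + h) k = toFun g k * toFun h k

instance {G K : Type*} [AddCommGroup G] [Field K] :
    CoeFun (SkewBicharacter G K) (fun _ => G → G → Kˣ) :=
  ⟨SkewBicharacter.toFun⟩

/-- A `G`-graded `ε`-Lie algebra structure (color Lie algebra) on the vector space `L`. -/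
structure ColorLieAlgebra {G K : Type*} [AddCommGroup G] [DecidableEq G] [Field K]
    (ε : SkewBicharacter G K) (L : Type*) [AddCommGroup L] [Module K L] where
  /-- the homogeneous components -/
  gr : G → Submodule K L
  isInternal : DirectSum.IsInternal gr
  bracket : L →ₗ[K] L →ₗ[K] L
  bracket_mem : ∀ {g h : G} {a b : L}, a ∈ gr g → b ∈ gr h → bracket a b ∈ gr (g + h)
  bracket_skew : ∀ {g h : G} {a b : L}, a ∈ gr g → b ∈ gr h →
    bracket a b = -((ε g h : K) • bracket b a)
  jacobi : ∀ {g h k : G} {a b c : L}, a ∈ gr g → b ∈ gr h → c ∈ gr k →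
    (ε k g : K) • bracket a (bracket b c) + (ε g h : K) • bracket b (bracket c a)
      + (ε h k : K) • bracket c (bracket a b) = 0

/-! ### Graded modules and graded free resolutions -/

/-- `A = ⨁ g, 𝒜 g` is a `G`-graded algebra. -/
structure IsGradedAlg {G K A : Type*} [AddCommGroup G] [DecidableEq G] [Field K]
    [Ring A] [Algebra K A] (𝒜 : G → Submodule K A) : Prop where
  isInternal : DirectSum.IsInternal 𝒜
  gradedMonoid : SetLike.GradedMonoid 𝒜

/-- `M = ⨁ g, ℳ g` is a graded left module over the graded algebra `(A, 𝒜)`. -/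
structure IsGradedMod {G K A M : Type*} [AddCommGroup G] [DecidableEq G] [Field K]
    [Ring A] [Algebra K A] [AddCommGroup M] [Module K M] [Module A M] [IsScalarTower K A M]
    (𝒜 : G → Submodule K A) (ℳ : G → Submodule K M) : Prop where
  isInternal : DirectSum.IsInternal ℳ
  gradedSMul : SetLike.GradedSMul 𝒜 ℳ

/-- A graded `A`-module is graded free if it has an `A`-basis of homogeneous elements. -/
def IsGradedFree {G K M : Type*} (A : Type*) [Field K] [Ring A]
    [AddCommGroup M] [Module K M] [Module A M] (ℳ : G → Submodule K M) : Prop :=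
  ∃ S : Set M, LinearIndepOn A id S ∧ Submodule.span A S = ⊤ ∧
    ∀ s ∈ S, SetLike.IsHomogeneousElem ℳ s

/-- `⋯ → C 2 → C 1 → C 0 → M → 0`, with differentials `d n : C (n + 1) → C n` and augmentation
`η : C 0 → M`, is a resolution of the graded module `M` by graded free modules over the graded
algebra `(A, 𝒜)`, all maps being `A`-linear and of degree zero. -/
structure IsGradedFreeResolution {G K A M : Type*} [AddCommGroup G] [DecidableEq G] [Field K]
    [Ring A] [Algebra K A] [AddCommGroup M] [Module K M] [Module A M] [IsScalarTower K A M]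
    {C : ℕ → Type*} [∀ n, AddCommGroup (C n)] [∀ n, Module K (C n)] [∀ n, Module A (C n)]
    [∀ n, IsScalarTower K A (C n)]
    (𝒜 : G → Submodule K A) (ℳ : G → Submodule K M) (𝒞 : ∀ n, G → Submodule K (C n))
    (d : ∀ n, C (n + 1) →ₗ[A] C n) (η : C 0 →ₗ[A] M) : Prop where
  gradedAlg : IsGradedAlg 𝒜
  gradedMod : IsGradedMod 𝒜 ℳ
  gradedMod_complex : ∀ n, IsGradedMod 𝒜 (𝒞 n)
  gradedFree : ∀ n, IsGradedFree A (𝒞 n)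
  d_mem : ∀ n g, ∀ c ∈ 𝒞 (n + 1) g, d n c ∈ 𝒞 n g
  η_mem : ∀ g, ∀ c ∈ 𝒞 0 g, η c ∈ ℳ g
  exact_d : ∀ n, Function.Exact (d (n + 1)) (d n)
  exact_η : Function.Exact (d 0) η
  surjective_η : Function.Surjective η

namespace ColorLieAlgebra

variable {G K L : Type*} [AddCommGroup G] [DecidableEq G] [Field K]
  {ε : SkewBicharacter G K} [AddCommGroup L] [Module K L]

/-! ### The universal enveloping algebra -/

/-- The relations `a ⊗ b = ε(|a|, |b|) b ⊗ a + [a, b]` for homogeneous `a`, `b`. -/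
inductive EnvRel (𝔤 : ColorLieAlgebra ε L) : TensorAlgebra K L → TensorAlgebra K L → Prop
  | rel {g h : G} {a b : L} (ha : a ∈ 𝔤.gr g) (hb : b ∈ 𝔤.gr h) :
      EnvRel 𝔤 (TensorAlgebra.ι K a * TensorAlgebra.ι K b)
        ((ε g h : K) • (TensorAlgebra.ι K b * TensorAlgebra.ι K a)
          + TensorAlgebra.ι K (𝔤.bracket a b))

/-- The universal enveloping algebra `U(L)`. -/
def Env (𝔤 : ColorLieAlgebra ε L) : Type _ := RingQuot 𝔤.EnvRel

noncomputable instance (𝔤 : ColorLieAlgebra ε L) : Ring 𝔤.Env :=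
  inferInstanceAs (Ring (RingQuot 𝔤.EnvRel))

noncomputable instance (𝔤 : ColorLieAlgebra ε L) : Algebra K 𝔤.Env :=
  inferInstanceAs (Algebra K (RingQuot 𝔤.EnvRel))

/-- The canonical map `L → U(L)`. -/
noncomputable def envι (𝔤 : ColorLieAlgebra ε L) : L →ₗ[K] 𝔤.Env :=
  (RingQuot.mkAlgHom K 𝔤.EnvRel).toLinearMap ∘ₗ TensorAlgebra.ι K

/-- The degree `g` component of `U(L)`: the span of the products `x₁ ⋯ xₙ` of homogeneous elements
of `L` with `|x₁| + ⋯ + |xₙ| = g`. -/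
noncomputable def envGr (𝔤 : ColorLieAlgebra ε L) (g : G) : Submodule K 𝔤.Env :=
  Submodule.span K {y | ∃ (n : ℕ) (x : Fin n → L) (γ : Fin n → G),
    (∀ i, x i ∈ 𝔤.gr (γ i)) ∧ ∑ i, γ i = g ∧ y = (List.ofFn fun i => 𝔤.envι (x i)).prod}

/-- The counit `U(L) → K`: the algebra homomorphism that vanishes on `L`. -/
noncomputable def counit (𝔤 : ColorLieAlgebra ε L) : 𝔤.Env →ₐ[K] K :=
  RingQuot.liftAlgHom K (s := 𝔤.EnvRel) ⟨TensorAlgebra.lift K (0 : L →ₗ[K] K), by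
    rintro _ _ ⟨_, _⟩
    simp⟩

/-! ### The ε-exterior algebra -/

/-- The relations `a ⊗ b = - ε(|a|, |b|) b ⊗ a` for homogeneous `a`, `b`. -/
inductive ExtRel (𝔤 : ColorLieAlgebra ε L) : TensorAlgebra K L → TensorAlgebra K L → Prop
  | rel {g h : G} {a b : L} (ha : a ∈ 𝔤.gr g) (hb : b ∈ 𝔤.gr h) :
      ExtRel 𝔤 (TensorAlgebra.ι K a * TensorAlgebra.ι K b)
        (-((ε g h : K) • (TensorAlgebra.ι K b * TensorAlgebra.ι K a)))

/-- The `ε`-exterior algebra of the graded space underlying `L`. -/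
def Ext (𝔤 : ColorLieAlgebra ε L) : Type _ := RingQuot 𝔤.ExtRel

noncomputable instance (𝔤 : ColorLieAlgebra ε L) : Ring 𝔤.Ext :=
  inferInstanceAs (Ring (RingQuot 𝔤.ExtRel))

noncomputable instance (𝔤 : ColorLieAlgebra ε L) : Algebra K 𝔤.Ext :=
  inferInstanceAs (Algebra K (RingQuot 𝔤.ExtRel))

/-- The canonical map from `L` to its `ε`-exterior algebra. -/
noncomputable def extι (𝔤 : ColorLieAlgebra ε L) : L →ₗ[K] 𝔤.Ext :=
  (RingQuot.mkAlgHom K 𝔤.ExtRel).toLinearMap ∘ₗ TensorAlgebra.ι K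

/-- The algebra homomorphism from the `ε`-exterior algebra to `K` that vanishes on `L`. -/
noncomputable def extCounit (𝔤 : ColorLieAlgebra ε L) : 𝔤.Ext →ₐ[K] K :=
  RingQuot.liftAlgHom K (s := 𝔤.ExtRel) ⟨TensorAlgebra.lift K (0 : L →ₗ[K] K), by
    rintro _ _ ⟨_, _⟩
    simp⟩

/-- The `n`-th `ε`-exterior power, the component of degree `n` of the `ε`-exterior algebra. -/
noncomputable def extPow (𝔤 : ColorLieAlgebra ε L) (n : ℕ) : Submodule K 𝔤.Ext :=
  LinearMap.range 𝔤.extι ^ n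

theorem prod_mem_extPow (𝔤 : ColorLieAlgebra ε L) {n : ℕ} (x : Fin n → L) :
    (List.ofFn fun i => 𝔤.extι (x i)).prod ∈ 𝔤.extPow n := by
  unfold extPow
  induction n with
  | zero => simpa using ⟨1, map_one _⟩
  | succ n ih =>
    rw [List.ofFn_succ, List.prod_cons, pow_succ']
    exact Submodule.mul_mem_mul ⟨_, rfl⟩ (ih fun i => x i.succ)

/-- The element `⟨x₁, …, xₙ⟩ = x₁ ∧ ⋯ ∧ xₙ`. -/
noncomputable def wedge (𝔤 : ColorLieAlgebra ε L) {n : ℕ} (x : Fin n → L) : 𝔤.extPow n :=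
  ⟨(List.ofFn fun i => 𝔤.extι (x i)).prod, 𝔤.prod_mem_extPow x⟩

/-- The degree `g` component of the `n`-th `ε`-exterior power: the span of the `x₁ ∧ ⋯ ∧ xₙ` with
`xᵢ` homogeneous and `|x₁| + ⋯ + |xₙ| = g`. -/
noncomputable def extPowGr (𝔤 : ColorLieAlgebra ε L) (n : ℕ) (g : G) :
    Submodule K (𝔤.extPow n) :=
  Submodule.span K {y | ∃ (x : Fin n → L) (γ : Fin n → G),
    (∀ i, x i ∈ 𝔤.gr (γ i)) ∧ ∑ i, γ i = g ∧ y = 𝔤.wedge x}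

/-! ### The color Koszul complex -/

/-- `C n = U(L) ⊗ ⋀ⁿ L`, a left `U(L)`-module through the first factor. -/
abbrev Koszul (𝔤 : ColorLieAlgebra ε L) (n : ℕ) : Type _ := 𝔤.Env ⊗[K] 𝔤.extPow n

/-- The degree `g` component of `C n`: the span of the `u ⊗ v` with `|u| + |v| = g`. -/
noncomputable def koszulGr (𝔤 : ColorLieAlgebra ε L) (n : ℕ) (g : G) :
    Submodule K (𝔤.Koszul n) :=
  Submodule.span K {y | ∃ (h k : G), h + k = g ∧ ∃ u ∈ 𝔤.envGr h, ∃ v ∈ 𝔤.extPowGr n k,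
    y = u ⊗ₜ[K] v}

/-- The trivial `U(L)`-module `K`, on which `U(L)` acts through the counit. -/
def Triv (_𝔤 : ColorLieAlgebra ε L) : Type _ := K

noncomputable instance (𝔤 : ColorLieAlgebra ε L) : AddCommGroup 𝔤.Triv :=
  inferInstanceAs (AddCommGroup K)

noncomputable instance (𝔤 : ColorLieAlgebra ε L) : Module K 𝔤.Triv :=
  inferInstanceAs (Module K K)

noncomputable instance (𝔤 : ColorLieAlgebra ε L) : Module 𝔤.Env 𝔤.Triv :=
  Module.compHom K (𝔤.counit : 𝔤.Env →+* K)

theorem triv_smul_def (𝔤 : ColorLieAlgebra ε L) (u : 𝔤.Env) (t : 𝔤.Triv) :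
    u • t = 𝔤.counit u • t := rfl

instance (𝔤 : ColorLieAlgebra ε L) : IsScalarTower K 𝔤.Env 𝔤.Triv :=
  ⟨fun c u t => by simp only [triv_smul_def, map_smul, smul_assoc]⟩

/-- The grading of the trivial module, concentrated in the degree of the neutral element. -/
noncomputable def trivGr (𝔤 : ColorLieAlgebra ε L) (g : G) : Submodule K 𝔤.Triv :=
  if g = 0 then ⊤ else ⊥

/-- The augmentation `C 0 = U(L) ⊗ ⋀⁰ L → K`, `u ⊗ c1 ↦ c • counit u`. -/
noncomputable def augmentation (𝔤 : ColorLieAlgebra ε L) : 𝔤.Koszul 0 →ₗ[𝔤.Env] 𝔤.Triv :=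
  let f : 𝔤.Koszul 0 →ₗ[K] K := LinearMap.mul' K K ∘ₗ
    TensorProduct.map 𝔤.counit.toLinearMap (𝔤.extCounit.toLinearMap ∘ₗ (𝔤.extPow 0).subtype)
  { toFun := f
    map_add' := f.map_add
    map_smul' := fun u c => by
      change f (u • c) = 𝔤.counit u * f c
      induction c using TensorProduct.induction_on with
      | zero => simp
      | tmul a b => simp [f, TensorProduct.smul_tmul', mul_assoc]
      | add a b ha hb => rw [smul_add, map_add, map_add, ha, hb, mul_add] }

/-- The factor `εᵢ = ∏_{h < i} ε(|x_h|, |xᵢ|)` of a tuple of degrees. -/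
def sgnFactor (ε : SkewBicharacter G K) {n : ℕ} (γ : Fin n → G) (i : Fin n) : K :=
  ∏ h ∈ Finset.univ.filter (fun h => h < i), (ε (γ h) (γ i) : K)

/-- The part of `d (u ⊗ ⟨x₁, …, xₙ₊₁⟩)` that involves no brackets,
`∑ᵢ (-1)ⁱ⁺¹ εᵢ u xᵢ ⊗ ⟨x₁, …, x̂ᵢ, …, xₙ₊₁⟩`. The indices in Lean start at `0`. -/
noncomputable def mulPart (𝔤 : ColorLieAlgebra ε L) {n : ℕ} (γ : Fin (n + 1) → G) (u : 𝔤.Env)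
    (x : Fin (n + 1) → L) : 𝔤.Koszul n :=
  ∑ i : Fin (n + 1), ((-1 : K) ^ (i : ℕ) * sgnFactor ε γ i) •
    ((u * 𝔤.envι (x i)) ⊗ₜ[K] 𝔤.wedge (fun k => x (i.succAbove k)))

/-- The part of `d (u ⊗ ⟨x₁, …, xₙ₊₁⟩)` that involves brackets,
`∑_{i < j} (-1)ⁱ⁺ʲ εᵢ εⱼ ε(|xⱼ|, |xᵢ|) u ⊗ ⟨[xᵢ, xⱼ], x₁, …, x̂ᵢ, …, x̂ⱼ, …, xₙ₊₁⟩`.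
For `i < j`, the map `k ↦ j.succAbove (i.succAbove k)` enumerates the indices other than `i`, `j`. -/
noncomputable def bracketPart (𝔤 : ColorLieAlgebra ε L) : {n : ℕ} → (γ : Fin (n + 1) → G) →
    (u : 𝔤.Env) → (x : Fin (n + 1) → L) → 𝔤.Koszul n
  | 0, _, _, _ => 0
  | n + 1, γ, u, x =>
    ∑ j : Fin (n + 2), ∑ i : Fin (n + 1),
      if i.castSucc < j then
        ((-1 : K) ^ ((i : ℕ) + (j : ℕ)) * sgnFactor ε γ i.castSucc * sgnFactor ε γ j
            * (ε (γ j) (γ i.castSucc) : K)) •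
          (u ⊗ₜ[K] 𝔤.wedge (Fin.cons (𝔤.bracket (x i.castSucc) (x j))
            (fun k : Fin n => x (j.succAbove (i.succAbove k))) : Fin (n + 1) → L))
      else 0

/-- `d` is the family of color Chevalley–Eilenberg differentials: it is given by the explicit formula
on all `u ⊗ ⟨x₁, …, xₙ₊₁⟩` with homogeneous `xᵢ`. -/
def IsDifferential (𝔤 : ColorLieAlgebra ε L)
    (d : ∀ n, 𝔤.Koszul (n + 1) →ₗ[𝔤.Env] 𝔤.Koszul n) : Prop :=
  ∀ (n : ℕ) (u : 𝔤.Env) (x : Fin (n + 1) → L) (γ : Fin (n + 1) → G),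
    (∀ i, x i ∈ 𝔤.gr (γ i)) →
      d n (u ⊗ₜ[K] 𝔤.wedge x) = 𝔤.mulPart γ u x + 𝔤.bracketPart γ u x

end ColorLieAlgebra

/-! The argument runs on all of `U(L) ⊗ ⋀ L` at once and is cut into exterior degrees only at the
end. For homogeneous `x` let `e_x` be exterior multiplication by `x` (`envWedge`) and `θ_x` the
operator `u ⊗ w ↦ ε(|x|,|u|) (ux ⊗ w - u ⊗ ad x w)` (`envLie`). The differential `D` (`envD`) is the
`U(L)`-linear map with `D (1 ⊗ 1) = 0` and Cartan's formula `D e_x + e_x D = θ_x`. The commutation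
rules of `θ` with `e` and `θ` give `D θ_x = θ_x D`, whence `D² = 0`. Unwinding the recursion letter
by letter gives the explicit formula (`envDelta_extProd`), and uniqueness holds because the elements
in the formula span.

Exactness comes from a Koszul-type homotopy `H` that turns one coefficient letter into an exterior
letter. It is defined on `T(L) ⊗ ⋀ L` only and does not descend to `U(L)`, so `D` is also lifted to
a map `D'` over `T(L)` (`tensorD`). On words of length `m` and exterior degree `n`, `D H + H D'` is
`m + n` times the projection to `U(L) ⊗ ⋀ L`, modulo shorter words (`laplacian_word_tmul`). If `z`
is a cycle of filtration `m` with lift `t`, then `D' t` projects to zero, and `H (D' t)` turns out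
to have filtration below `m` (`homotopy_mem_of_proj_eq_zero`). So `z` minus the boundary of `(m +
n)⁻¹ H t` is a cycle of smaller filtration, and induction on `m` applies (`exists_envD_eq`). The
weight `m + n` is invertible in characteristic zero unless `m = n = 0`, where the augmentation takes
over.

The bound on `H (D' t)` needs a Poincaré-Birkhoff-Witt theorem in the form: an element of length at
most `m` in the kernel of `T(L) → U(L)` is a combination of relators of length at most `m`
(`mem_relLE_of_toEnv_eq_zero`). On such relators `H` loses an additional letter (`homotopy_rel`).
The theorem is proved by averaging: rewriting neighbouring letters of words of length `N + 1`
defines an action of the symmetric group modulo relators of length at most `N`, the braid relation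
being the Jacobi identity. The average kills the relators of length `N + 1` and fixes all shorter
words (`relLE_succ_inf_tensorLE`).

The gradings are direct sums because they are detected by coactions into group algebras
(`isInternal_of_coaction`). -/

namespace SkewBicharacter

variable {G K : Type*} [AddCommGroup G] [Field K] (ε : SkewBicharacter G K)

/-! ### Bicharacter identities in the field. -/

theorem coe_mul_swap (g h : G) : (ε g h : K) * (ε h g : K) = 1 := by
  rw [← Units.val_mul, ε.mul_swap, Units.val_one]

theorem coe_add_right (g h k : G) : (ε g (h + k) : K) = (ε g h : K) * (ε g k : K) := by
  rw [ε.map_add_right, Units.val_mul]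

theorem coe_add_left (g h k : G) : (ε (g + h) k : K) = (ε g k : K) * (ε h k : K) := by
  rw [ε.map_add_left, Units.val_mul]

end SkewBicharacter

namespace ColorLieAlgebra

variable {G K L : Type*} [AddCommGroup G] [DecidableEq G] [Field K]
  {ε : SkewBicharacter G K} [AddCommGroup L] [Module K L] (𝔤 : ColorLieAlgebra ε L)

/-! ### Homogeneous bases -/

/-- The index type of a basis of `L` consisting of homogeneous elements. -/
abbrev HIndex : Type _ := Σ g, Module.Basis.ofVectorSpaceIndex K (𝔤.gr g)

/-- A basis of `L` consisting of homogeneous elements. -/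
noncomputable def hBasis : Module.Basis 𝔤.HIndex K L :=
  𝔤.isInternal.collectedBasis fun g => Module.Basis.ofVectorSpace K (𝔤.gr g)

theorem hBasis_mem (i : 𝔤.HIndex) : 𝔤.hBasis i ∈ 𝔤.gr i.1 :=
  𝔤.isInternal.collectedBasis_mem _ i

theorem gr_eq_span (g : G) :
    𝔤.gr g = Submodule.span K (𝔤.hBasis '' {i | i.1 = g}) := by
  apply le_antisymm
  · have h := congrArg (Submodule.map (𝔤.gr g).subtype)
      (Module.Basis.ofVectorSpace K (𝔤.gr g)).span_eq
    rw [Submodule.map_span, Submodule.map_subtype_top] at h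
    rw [← h]
    apply Submodule.span_mono
    rintro _ ⟨_, ⟨i, rfl⟩, rfl⟩
    refine ⟨⟨g, i⟩, rfl, ?_⟩
    simp only [hBasis, DirectSum.IsInternal.collectedBasis_coe, Submodule.subtype_apply]
  · rw [Submodule.span_le]
    rintro _ ⟨i, rfl, rfl⟩
    exact 𝔤.hBasis_mem i

/-- To prove a linear property of homogeneous elements, it suffices to consider the basis. -/
theorem gr_induction {g : G} {S : Submodule K L}
    (hS : ∀ i : 𝔤.HIndex, i.1 = g → 𝔤.hBasis i ∈ S) {a : L} (ha : a ∈ 𝔤.gr g) : a ∈ S := by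
  rw [gr_eq_span] at ha
  refine Submodule.span_le.2 ?_ ha
  rintro _ ⟨i, hi, rfl⟩
  exact hS i hi

/-- Two linear maps agree on homogeneous elements if they agree on the basis. -/
theorem gr_ext {X : Type*} [AddCommMonoid X] [Module K X] {f f' : L →ₗ[K] X} {g : G}
    (h : ∀ i : 𝔤.HIndex, i.1 = g → f (𝔤.hBasis i) = f' (𝔤.hBasis i)) {a : L}
    (ha : a ∈ 𝔤.gr g) : f a = f' a :=
  𝔤.gr_induction (S := LinearMap.eqLocus f f') h ha

theorem iSup_gr : ⨆ g, 𝔤.gr g = ⊤ := 𝔤.isInternal.submodule_iSup_eq_top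

/-- The linear map that agrees with `F g` on the component of degree `g`. -/
noncomputable def glue {X : Type*} [AddCommMonoid X] [Module K X] (F : G → L →ₗ[K] X) :
    L →ₗ[K] X :=
  𝔤.hBasis.constr K fun i => F i.1 (𝔤.hBasis i)

theorem glue_apply {X : Type*} [AddCommMonoid X] [Module K X] (F : G → L →ₗ[K] X) {g : G} {a : L}
    (ha : a ∈ 𝔤.gr g) : 𝔤.glue F a = F g a :=
  𝔤.gr_ext (fun i hi => by rw [glue, Module.Basis.constr_basis, hi]) ha

/-- The map that multiplies elements of degree `h` by `ε(g, h)`. -/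
noncomputable def twist (g : G) : L →ₗ[K] L :=
  𝔤.glue fun h => (ε g h : K) • LinearMap.id

theorem twist_apply (g : G) {h : G} {a : L} (ha : a ∈ 𝔤.gr h) :
    𝔤.twist g a = (ε g h : K) • a := by
  rw [twist, glue_apply _ _ ha]; rfl

/-- The Jacobi identity, in the form that `[x, ·]` is a derivation. -/
theorem leibniz {g h k : G} {a b c : L} (ha : a ∈ 𝔤.gr g) (hb : b ∈ 𝔤.gr h) (hc : c ∈ 𝔤.gr k) :
    𝔤.bracket (𝔤.bracket a b) c =
      𝔤.bracket a (𝔤.bracket b c) - (ε g h : K) • 𝔤.bracket b (𝔤.bracket a c) := by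
  have h1 := 𝔤.jacobi ha hb hc
  rw [𝔤.bracket_skew hc ha, 𝔤.bracket_skew hc (𝔤.bracket_mem ha hb), ε.coe_add_right,
    map_neg, map_smul] at h1
  have h2 : (ε g k : K) * (ε k g : K) = 1 := ε.coe_mul_swap g k
  have h3 : (ε h k : K) * (ε k h : K) = 1 := ε.coe_mul_swap h k
  linear_combination (norm := module) (-(ε g k : K)) • h1 +
    h2 • (𝔤.bracket a (𝔤.bracket b c) - (ε g h : K) • 𝔤.bracket b (𝔤.bracket a c)
      - 𝔤.bracket (𝔤.bracket a b) c) -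
    ((ε k g : K) * (ε g k : K)) • h3 • 𝔤.bracket (𝔤.bracket a b) c

/-! ### Universal properties and induction principles -/

/-- Stability under homogeneous letters makes `S` a left ideal, and it contains `1`. All later
inductions therefore only have to add one homogeneous letter on the left. -/
theorem tensor_span_induction {S : Submodule K (TensorAlgebra K L)} (h1 : 1 ∈ S)
    (hmul : ∀ (g : G), ∀ a ∈ 𝔤.gr g, ∀ t ∈ S, TensorAlgebra.ι K a * t ∈ S) : S = ⊤ := by
  have hι : ∀ (a : L), ∀ t ∈ S, TensorAlgebra.ι K a * t ∈ S := by
    intro a t ht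
    have : a ∈ ⨆ g, 𝔤.gr g := by rw [iSup_gr]; trivial
    induction this using Submodule.iSup_induction' with
    | mem g a ha => exact hmul g a ha t ht
    | zero => simp
    | add a b _ _ ha hb => rw [map_add, add_mul]; exact S.add_mem ha hb
  have key : ∀ s : TensorAlgebra K L, ∀ t ∈ S, s * t ∈ S := by
    intro s
    induction s using TensorAlgebra.induction with
    | algebraMap r => intro t ht; rw [← Algebra.smul_def]; exact S.smul_mem r ht
    | ι x => exact hι x
    | mul a b ha hb => intro t ht; rw [mul_assoc]; exact ha _ (hb _ ht)
    | add a b ha hb => intro t ht; rw [add_mul]; exact S.add_mem (ha _ ht) (hb _ ht)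
  exact eq_top_iff.2 fun s _ => by simpa using key s 1 h1

/-- The canonical homomorphism `T(L) → U(L)`. -/
noncomputable def toEnv : TensorAlgebra K L →ₐ[K] 𝔤.Env := RingQuot.mkAlgHom K 𝔤.EnvRel

/-- The canonical homomorphism from `T(L)` to the `ε`-exterior algebra. -/
noncomputable def toExt : TensorAlgebra K L →ₐ[K] 𝔤.Ext := RingQuot.mkAlgHom K 𝔤.ExtRel

@[simp] theorem toEnv_ι (a : L) : 𝔤.toEnv (TensorAlgebra.ι K a) = 𝔤.envι a := rfl

@[simp] theorem toExt_ι (a : L) : 𝔤.toExt (TensorAlgebra.ι K a) = 𝔤.extι a := rfl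

theorem toEnv_surjective : Function.Surjective 𝔤.toEnv := RingQuot.mkAlgHom_surjective K _

theorem toExt_surjective : Function.Surjective 𝔤.toExt := RingQuot.mkAlgHom_surjective K _

theorem envι_mul {g h : G} {a b : L} (ha : a ∈ 𝔤.gr g) (hb : b ∈ 𝔤.gr h) :
    𝔤.envι a * 𝔤.envι b = (ε g h : K) • (𝔤.envι b * 𝔤.envι a) + 𝔤.envι (𝔤.bracket a b) := by
  have := RingQuot.mkAlgHom_rel K (EnvRel.rel (𝔤 := 𝔤) ha hb)
  rw [map_add, map_smul, map_mul, map_mul] at this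
  exact this

theorem extι_mul {g h : G} {a b : L} (ha : a ∈ 𝔤.gr g) (hb : b ∈ 𝔤.gr h) :
    𝔤.extι a * 𝔤.extι b = -((ε g h : K) • (𝔤.extι b * 𝔤.extι a)) := by
  have := RingQuot.mkAlgHom_rel K (ExtRel.rel (𝔤 := 𝔤) ha hb)
  rw [map_neg, map_smul, map_mul, map_mul] at this
  exact this

/-- The universal property of `U(L)`. -/
noncomputable def envLift {A : Type*} [Ring A] [Algebra K A] (f : L →ₗ[K] A)
    (hf : ∀ (g h : G) (a b : L), a ∈ 𝔤.gr g → b ∈ 𝔤.gr h →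
      f a * f b = (ε g h : K) • (f b * f a) + f (𝔤.bracket a b)) : 𝔤.Env →ₐ[K] A :=
  RingQuot.liftAlgHom K (s := 𝔤.EnvRel) ⟨TensorAlgebra.lift K f, by
    rintro _ _ ⟨ha, hb⟩
    simpa using hf _ _ _ _ ha hb⟩

theorem envLift_toEnv {A : Type*} [Ring A] [Algebra K A] (f : L →ₗ[K] A) (hf)
    (t : TensorAlgebra K L) : 𝔤.envLift f hf (𝔤.toEnv t) = TensorAlgebra.lift K f t :=
  RingQuot.liftAlgHom_mkAlgHom_apply K _ _ _

@[simp] theorem envLift_envι {A : Type*} [Ring A] [Algebra K A] (f : L →ₗ[K] A) (hf) (a : L) :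
    𝔤.envLift f hf (𝔤.envι a) = f a := by
  rw [← toEnv_ι, envLift_toEnv, TensorAlgebra.lift_ι_apply]

/-- The universal property of the `ε`-exterior algebra. -/
noncomputable def extLift {A : Type*} [Ring A] [Algebra K A] (f : L →ₗ[K] A)
    (hf : ∀ (g h : G) (a b : L), a ∈ 𝔤.gr g → b ∈ 𝔤.gr h →
      f a * f b = -((ε g h : K) • (f b * f a))) : 𝔤.Ext →ₐ[K] A :=
  RingQuot.liftAlgHom K (s := 𝔤.ExtRel) ⟨TensorAlgebra.lift K f, by
    rintro _ _ ⟨ha, hb⟩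
    simpa using hf _ _ _ _ ha hb⟩

theorem extLift_toExt {A : Type*} [Ring A] [Algebra K A] (f : L →ₗ[K] A) (hf)
    (t : TensorAlgebra K L) : 𝔤.extLift f hf (𝔤.toExt t) = TensorAlgebra.lift K f t :=
  RingQuot.liftAlgHom_mkAlgHom_apply K _ _ _

@[simp] theorem extLift_extι {A : Type*} [Ring A] [Algebra K A] (f : L →ₗ[K] A) (hf) (a : L) :
    𝔤.extLift f hf (𝔤.extι a) = f a := by
  rw [← toExt_ι, extLift_toExt, TensorAlgebra.lift_ι_apply]

theorem tensor_induction {P : TensorAlgebra K L → Prop} (h1 : P 1)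
    (hadd : ∀ s t, P s → P t → P (s + t)) (hsmul : ∀ (c : K) t, P t → P (c • t))
    (hmul : ∀ (g : G), ∀ a ∈ 𝔤.gr g, ∀ t, P t → P (TensorAlgebra.ι K a * t)) (t) : P t := by
  let S : Submodule K (TensorAlgebra K L) :=
    { carrier := {t | P t}
      add_mem' := fun ha hb => hadd _ _ ha hb
      zero_mem' := by simpa using hsmul 0 1 h1
      smul_mem' := fun c t ht => hsmul c t ht }
  have : S = ⊤ := 𝔤.tensor_span_induction h1 hmul
  exact (this ▸ Submodule.mem_top : t ∈ S)

theorem env_induction {P : 𝔤.Env → Prop} (h1 : P 1)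
    (hadd : ∀ s t, P s → P t → P (s + t)) (hsmul : ∀ (c : K) t, P t → P (c • t))
    (hmul : ∀ (g : G), ∀ a ∈ 𝔤.gr g, ∀ t, P t → P (𝔤.envι a * t)) (u) : P u := by
  obtain ⟨t, rfl⟩ := 𝔤.toEnv_surjective u
  refine 𝔤.tensor_induction (P := fun t => P (𝔤.toEnv t)) ?_ ?_ ?_ ?_ t
  · simpa using h1
  · intro s t hs ht; rw [map_add]; exact hadd _ _ hs ht
  · intro c t ht; rw [map_smul]; exact hsmul _ _ ht
  · intro g a ha t ht; rw [map_mul]; exact hmul g a ha _ ht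

theorem ext_induction {P : 𝔤.Ext → Prop} (h1 : P 1)
    (hadd : ∀ s t, P s → P t → P (s + t)) (hsmul : ∀ (c : K) t, P t → P (c • t))
    (hmul : ∀ (g : G), ∀ a ∈ 𝔤.gr g, ∀ t, P t → P (𝔤.extι a * t)) (u) : P u := by
  obtain ⟨t, rfl⟩ := 𝔤.toExt_surjective u
  refine 𝔤.tensor_induction (P := fun t => P (𝔤.toExt t)) ?_ ?_ ?_ ?_ t
  · simpa using h1
  · intro s t hs ht; rw [map_add]; exact hadd _ _ hs ht
  · intro c t ht; rw [map_smul]; exact hsmul _ _ ht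
  · intro g a ha t ht; rw [map_mul]; exact hmul g a ha _ ht

/-- The automorphism of `T(L)` that multiplies elements of degree `h` by `ε(g, h)`. -/
noncomputable def tensorTwist (g : G) : TensorAlgebra K L →ₐ[K] TensorAlgebra K L :=
  TensorAlgebra.lift K (TensorAlgebra.ι K ∘ₗ 𝔤.twist g)

theorem tensorTwist_ι (g : G) {h : G} {a : L} (ha : a ∈ 𝔤.gr h) :
    𝔤.tensorTwist g (TensorAlgebra.ι K a) = (ε g h : K) • TensorAlgebra.ι K a := by
  simp [tensorTwist, 𝔤.twist_apply g ha]

/-- The automorphism of `U(L)` that multiplies elements of degree `h` by `ε(g, h)`. -/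
noncomputable def envTwist (g : G) : 𝔤.Env →ₐ[K] 𝔤.Env :=
  𝔤.envLift (𝔤.envι ∘ₗ 𝔤.twist g) fun h k a b ha hb => by
    simp only [LinearMap.comp_apply, 𝔤.twist_apply g ha, 𝔤.twist_apply g hb, map_smul,
      𝔤.twist_apply g (𝔤.bracket_mem ha hb), ε.coe_add_right, smul_mul_smul_comm,
      𝔤.envι_mul ha hb, smul_add, smul_smul]
    module

theorem envTwist_envι (g : G) {h : G} {a : L} (ha : a ∈ 𝔤.gr h) :
    𝔤.envTwist g (𝔤.envι a) = (ε g h : K) • 𝔤.envι a := by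
  simp [envTwist, 𝔤.twist_apply g ha]

theorem toEnv_tensorTwist (g : G) (t : TensorAlgebra K L) :
    𝔤.toEnv (𝔤.tensorTwist g t) = 𝔤.envTwist g (𝔤.toEnv t) := by
  induction t using 𝔤.tensor_induction
  case h1 => simp
  case hadd s t hs ht => simp [hs, ht]
  case hsmul c t ht => simp [ht]
  case hmul h a ha t ht =>
    simp [ht, tensorTwist_ι _ _ ha, envTwist_envι _ _ ha]

theorem tensorTwist_comm (g h : G) (t : TensorAlgebra K L) :
    𝔤.tensorTwist g (𝔤.tensorTwist h t) = 𝔤.tensorTwist h (𝔤.tensorTwist g t) := by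
  induction t using 𝔤.tensor_induction
  case h1 => simp
  case hadd s t hs ht => simp [hs, ht]
  case hsmul c t ht => simp [ht]
  case hmul k a ha t ht =>
    simp [ht, tensorTwist_ι _ _ ha, smul_smul, mul_comm]

theorem tensorTwist_add (g h : G) (t : TensorAlgebra K L) :
    𝔤.tensorTwist (g + h) t = 𝔤.tensorTwist g (𝔤.tensorTwist h t) := by
  induction t using 𝔤.tensor_induction
  case h1 => simp
  case hadd s t hs ht => simp [hs, ht]
  case hsmul c t ht => simp [ht]
  case hmul k a ha t ht =>
    simp [ht, tensorTwist_ι _ _ ha, smul_smul, mul_comm, ε.coe_add_left]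

theorem envTwist_comm (g h : G) (u : 𝔤.Env) :
    𝔤.envTwist g (𝔤.envTwist h u) = 𝔤.envTwist h (𝔤.envTwist g u) := by
  obtain ⟨t, rfl⟩ := 𝔤.toEnv_surjective u
  simp only [← toEnv_tensorTwist, tensorTwist_comm 𝔤 g h]

theorem envTwist_add (g h : G) (u : 𝔤.Env) :
    𝔤.envTwist (g + h) u = 𝔤.envTwist g (𝔤.envTwist h u) := by
  obtain ⟨t, rfl⟩ := 𝔤.toEnv_surjective u
  simp only [← toEnv_tensorTwist, tensorTwist_add]

/-! ### The adjoint action on the exterior algebra -/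

/-- The action of letters on pairs `(ad x w, w)`. -/
noncomputable def adStep (g : G) (x : L) : L →ₗ[K] Module.End K (𝔤.Ext × 𝔤.Ext) where
  toFun y := LinearMap.prod
    (LinearMap.mulLeft K (𝔤.extι (𝔤.bracket x y)) ∘ₗ LinearMap.snd K _ _ +
      LinearMap.mulLeft K (𝔤.extι (𝔤.twist g y)) ∘ₗ LinearMap.fst K _ _)
    (LinearMap.mulLeft K (𝔤.extι y) ∘ₗ LinearMap.snd K _ _)
  map_add' y z := by ext <;> simp [add_mul]
  map_smul' c y := by ext <;> simp

theorem adStep_apply (g : G) (x y : L) (p : 𝔤.Ext × 𝔤.Ext) :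
    𝔤.adStep g x y p = (𝔤.extι (𝔤.bracket x y) * p.2 + 𝔤.extι (𝔤.twist g y) * p.1,
      𝔤.extι y * p.2) := rfl

/-- The recursion `ad x (y ∧ w) = [x, y] ∧ w + ε(|x|,|y|) y ∧ ad x w` involves both `w` and `ad x
w`, so a letter acts on pairs. Once these actions satisfy the exterior relations, the universal
property makes the recursion well defined, with start value `(0, 1)`. The differential and the
homotopy are built by the same device. -/
theorem adStep_skew {k : G} {x : L} (hx : x ∈ 𝔤.gr k) (g h : G) (a b : L) (ha : a ∈ 𝔤.gr g)
    (hb : b ∈ 𝔤.gr h) : 𝔤.adStep k x a * 𝔤.adStep k x b =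
      -((ε g h : K) • (𝔤.adStep k x b * 𝔤.adStep k x a)) := by
  apply LinearMap.ext
  rintro ⟨v, w⟩
  have h1 := 𝔤.extι_mul ha hb
  have h2 := 𝔤.extι_mul (𝔤.bracket_mem hx ha) hb
  have h3 := 𝔤.extι_mul ha (𝔤.bracket_mem hx hb)
  have h4 := ε.coe_mul_swap k h
  have h5 := ε.coe_mul_swap k g
  rw [ε.coe_add_left] at h2
  rw [ε.coe_add_right] at h3
  simp only [Module.End.mul_apply, adStep_apply, LinearMap.neg_apply, LinearMap.smul_apply,
    𝔤.twist_apply k ha, 𝔤.twist_apply k hb, map_smul, Prod.smul_mk, Prod.neg_mk, Prod.mk.injEq,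
    mul_add, smul_mul_assoc, mul_smul_comm, ← mul_assoc, h1, h2, h3, neg_mul, smul_neg, smul_add,
    smul_smul, neg_add]
  refine ⟨?_, trivial⟩
  linear_combination (norm := module)
    (-(ε g h : K)) • h5 • (𝔤.extι (𝔤.bracket x b) * 𝔤.extι a * w)

/-- The action of a homogeneous element of `L` on the exterior algebra. -/
noncomputable def adHom {g : G} {x : L} (hx : x ∈ 𝔤.gr g) : 𝔤.Ext →ₗ[K] 𝔤.Ext where
  toFun w := (𝔤.extLift (𝔤.adStep g x) (𝔤.adStep_skew hx) w (0, 1)).1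
  map_add' v w := by simp
  map_smul' c w := by simp

theorem adHom_one {g : G} {x : L} (hx : x ∈ 𝔤.gr g) : 𝔤.adHom hx 1 = 0 := by
  simp [adHom]

theorem adStep_snd {g : G} {x : L} (hx : x ∈ 𝔤.gr g) (w : 𝔤.Ext) :
    (𝔤.extLift (𝔤.adStep g x) (𝔤.adStep_skew hx) w (0, 1)).2 = w := by
  induction w using 𝔤.ext_induction
  case h1 => simp
  case hadd s t hs ht => simp [hs, ht]
  case hsmul c t ht => simp [ht]
  case hmul h a ha t ht => simp [adStep_apply, ht]

theorem adHom_mul {g : G} {x : L} (hx : x ∈ 𝔤.gr g) (y : L) (w : 𝔤.Ext) :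
    𝔤.adHom hx (𝔤.extι y * w) =
      𝔤.extι (𝔤.bracket x y) * w + 𝔤.extι (𝔤.twist g y) * 𝔤.adHom hx w := by
  simp [adHom, adStep_apply, 𝔤.adStep_snd hx]

/-- The adjoint action of `L` on its exterior algebra. -/
noncomputable def ad : L →ₗ[K] Module.End K 𝔤.Ext :=
  -- `adHom` is available one homogeneous letter at a time; extending from a homogeneous basis makes
  -- it linear in the letter, and `ad_mul` recovers the recursion for all homogeneous letters.
  𝔤.hBasis.constr K fun i => 𝔤.adHom (𝔤.hBasis_mem i)

@[simp] theorem ad_one (x : L) : 𝔤.ad x 1 = 0 := by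
  have : LinearMap.applyₗ (1 : 𝔤.Ext) ∘ₗ 𝔤.ad = 0 := 𝔤.hBasis.ext fun i => by
    simp [ad, adHom_one]
  exact LinearMap.congr_fun this x

theorem ad_mul {g : G} {x : L} (hx : x ∈ 𝔤.gr g) (y : L) (w : 𝔤.Ext) :
    𝔤.ad x (𝔤.extι y * w) =
      𝔤.extι (𝔤.bracket x y) * w + 𝔤.extι (𝔤.twist g y) * 𝔤.ad x w := by
  have := 𝔤.gr_ext (g := g) (f := LinearMap.applyₗ (𝔤.extι y * w) ∘ₗ 𝔤.ad)
    (f' := (LinearMap.mul K 𝔤.Ext).flip w ∘ₗ 𝔤.extι ∘ₗ 𝔤.bracket.flip y +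
      LinearMap.mulLeft K (𝔤.extι (𝔤.twist g y)) ∘ₗ LinearMap.applyₗ w ∘ₗ 𝔤.ad)
    (fun i hi => by subst hi; simp [ad, adHom_mul]) hx
  simpa using this

/-- Both sides obey the same twisted product rule, and on letters they agree by `leibniz`, that is,
by the Jacobi identity. -/
theorem ad_bracket {g h : G} {x y : L} (hx : x ∈ 𝔤.gr g) (hy : y ∈ 𝔤.gr h) (w : 𝔤.Ext) :
    𝔤.ad (𝔤.bracket x y) w = 𝔤.ad x (𝔤.ad y w) - (ε g h : K) • 𝔤.ad y (𝔤.ad x w) := by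
  induction w using 𝔤.ext_induction
  case h1 => simp
  case hadd s t hs ht => simp only [map_add, hs, ht, smul_add]; abel
  case hsmul c t ht => simp only [map_smul, ht, smul_sub, smul_comm c]
  case hmul k z hz t ht =>
    have h4 := ε.coe_mul_swap g h
    simp only [𝔤.ad_mul (𝔤.bracket_mem hx hy), 𝔤.ad_mul hx, 𝔤.ad_mul hy, 𝔤.twist_apply _ hz,
      map_add, map_smul, smul_mul_assoc, 𝔤.leibniz hx hy hz, map_sub, sub_mul, ht,
      𝔤.twist_apply _ (𝔤.bracket_mem hx hz), 𝔤.twist_apply _ (𝔤.bracket_mem hy hz),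
      ε.coe_add_left, ε.coe_add_right, mul_sub, mul_smul_comm]
    linear_combination (norm := module)
      (ε h k : K) • h4 • (𝔤.extι (𝔤.bracket x z) * 𝔤.ad y t)

/-! ### Operators on `A ⊗ ⋀ L` -/

/-- For a family `τ` of endomorphisms of `A`, the operators `a ⊗ w ↦ τ|x|(a) ⊗ x ∧ w`. -/
noncomputable def wedgeOp {A : Type*} [Ring A] [Algebra K A] (τ : G → A →ₐ[K] A) :
    L →ₗ[K] Module.End K (A ⊗[K] 𝔤.Ext) :=
  𝔤.glue fun g => TensorProduct.mapBilinear (RingHom.id K) A 𝔤.Ext A 𝔤.Ext (τ g).toLinearMap ∘ₗ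
    LinearMap.mul K 𝔤.Ext ∘ₗ 𝔤.extι

theorem wedgeOp_tmul {A : Type*} [Ring A] [Algebra K A] (τ : G → A →ₐ[K] A) {g : G} {x : L}
    (hx : x ∈ 𝔤.gr g) (a : A) (w : 𝔤.Ext) :
    𝔤.wedgeOp τ x (a ⊗ₜ w) = τ g a ⊗ₜ (𝔤.extι x * w) := by
  simp [wedgeOp, 𝔤.glue_apply _ hx]

theorem wedgeOp_smul {A : Type*} [Ring A] [Algebra K A] (τ : G → A →ₐ[K] A) {g : G} {x : L}
    (hx : x ∈ 𝔤.gr g) (a : A) (c : A ⊗[K] 𝔤.Ext) :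
    𝔤.wedgeOp τ x (a • c) = τ g a • 𝔤.wedgeOp τ x c := by
  induction c using TensorProduct.induction_on with
  | zero => simp
  | tmul b w => simp [TensorProduct.smul_tmul', 𝔤.wedgeOp_tmul _ hx]
  | add c d hc hd => simp [smul_add, hc, hd]

theorem wedgeOp_skew {A : Type*} [Ring A] [Algebra K A] (τ : G → A →ₐ[K] A)
    (hτ : ∀ g h a, τ g (τ h a) = τ h (τ g a)) {g h : G} {x y : L}
    (hx : x ∈ 𝔤.gr g) (hy : y ∈ 𝔤.gr h) (c : A ⊗[K] 𝔤.Ext) :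
    𝔤.wedgeOp τ x (𝔤.wedgeOp τ y c) = -((ε g h : K) • 𝔤.wedgeOp τ y (𝔤.wedgeOp τ x c)) := by
  induction c using TensorProduct.induction_on with
  | zero => simp
  | tmul b w =>
    simp only [𝔤.wedgeOp_tmul _ hx, 𝔤.wedgeOp_tmul _ hy, ← mul_assoc, 𝔤.extι_mul hx hy, hτ g h,
      neg_mul, smul_mul_assoc, TensorProduct.tmul_neg, TensorProduct.tmul_smul]
  | add c d hc hd => simp only [map_add, smul_add, hc, hd, neg_add]

/-- The operators `t ⊗ w ↦ ε(|x|, |t|) t ⊗ x ∧ w` on `T(L) ⊗ ⋀ L`. -/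
noncomputable def tensorWedge : L →ₗ[K] Module.End K (TensorAlgebra K L ⊗[K] 𝔤.Ext) :=
  𝔤.wedgeOp 𝔤.tensorTwist

/-- The operators `u ⊗ w ↦ ε(|x|, |u|) u ⊗ x ∧ w` on `U(L) ⊗ ⋀ L`. -/
noncomputable def envWedge : L →ₗ[K] Module.End K (𝔤.Env ⊗[K] 𝔤.Ext) :=
  𝔤.wedgeOp 𝔤.envTwist

/-- The action of letters on pairs `(δ w, w)`, where `δ` is the lift of the differential. -/
noncomputable def diffStep :
    L →ₗ[K] Module.End K ((TensorAlgebra K L ⊗[K] 𝔤.Ext) × 𝔤.Ext) where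
  toFun x := LinearMap.prod
    ((TensorProduct.mk K _ _ (TensorAlgebra.ι K x) - TensorProduct.mk K _ _ 1 ∘ₗ 𝔤.ad x) ∘ₗ
        LinearMap.snd K _ _ - 𝔤.tensorWedge x ∘ₗ LinearMap.fst K _ _)
    (LinearMap.mulLeft K (𝔤.extι x) ∘ₗ LinearMap.snd K _ _)
  map_add' x y := by
    apply LinearMap.ext
    rintro ⟨c, w⟩
    simp [add_mul, TensorProduct.tmul_add]
    abel
  map_smul' r x := by
    apply LinearMap.ext
    rintro ⟨c, w⟩
    simp [TensorProduct.smul_tmul', smul_sub]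

theorem diffStep_apply (x : L) (p : (TensorAlgebra K L ⊗[K] 𝔤.Ext) × 𝔤.Ext) :
    𝔤.diffStep x p = (TensorAlgebra.ι K x ⊗ₜ p.2 - 1 ⊗ₜ 𝔤.ad x p.2 - 𝔤.tensorWedge x p.1,
      𝔤.extι x * p.2) := rfl

/-- This makes the recursion `δ (x ∧ w) = x ⊗ w - 1 ⊗ ad x w - e_x (δ w)` consistent. The exterior
relations and the skew symmetry of the bracket suffice, so the coefficients may stay in `T(L)`,
where the homotopy lives. -/
theorem diffStep_skew (g h : G) (a b : L) (ha : a ∈ 𝔤.gr g)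
    (hb : b ∈ 𝔤.gr h) : 𝔤.diffStep a * 𝔤.diffStep b =
      -((ε g h : K) • (𝔤.diffStep b * 𝔤.diffStep a)) := by
  apply LinearMap.ext
  rintro ⟨c, w⟩
  have h1 := 𝔤.extι_mul ha hb
  have h4 := ε.coe_mul_swap g h
  have h5 := 𝔤.wedgeOp_skew _ 𝔤.tensorTwist_comm ha hb c
  have h6 := 𝔤.bracket_skew hb ha
  have ta := 𝔤.wedgeOp_tmul 𝔤.tensorTwist ha
  have tb := 𝔤.wedgeOp_tmul 𝔤.tensorTwist hb
  simp only [Module.End.mul_apply, diffStep_apply, LinearMap.neg_apply, LinearMap.smul_apply,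
    Prod.smul_mk, Prod.neg_mk, Prod.mk.injEq, tensorWedge, map_sub, ta, tb, 𝔤.ad_mul ha,
    𝔤.ad_mul hb, 𝔤.tensorTwist_ι _ ha, 𝔤.tensorTwist_ι _ hb, 𝔤.twist_apply _ ha,
    𝔤.twist_apply _ hb, map_one, h5, h6, TensorProduct.tmul_add, map_neg, map_smul,
    neg_mul, smul_mul_assoc, TensorProduct.tmul_neg, TensorProduct.tmul_smul,
    ← TensorProduct.smul_tmul', TensorProduct.tmul_smul]
  constructor
  · linear_combination (norm := module)
      (-h4) • (TensorAlgebra.ι K a ⊗ₜ[K] (𝔤.extι b * w) +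
        1 ⊗ₜ[K] (𝔤.extι a * 𝔤.ad b w) - 1 ⊗ₜ[K] (𝔤.extι (𝔤.bracket a b) * w))
  · rw [← mul_assoc, h1, neg_mul, smul_mul_assoc, mul_assoc]

/-- The lift `⋀ L → T(L) ⊗ ⋀ L` of the differential on the elements `1 ⊗ w`. -/
noncomputable def tensorDelta : 𝔤.Ext →ₗ[K] TensorAlgebra K L ⊗[K] 𝔤.Ext where
  toFun w := (𝔤.extLift (A := Module.End K ((TensorAlgebra K L ⊗[K] 𝔤.Ext) × 𝔤.Ext)) 𝔤.diffStep
      𝔤.diffStep_skew w (0, 1)).1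
  map_add' v w := by simp
  map_smul' c w := by simp

@[simp] theorem tensorDelta_one : 𝔤.tensorDelta 1 = 0 := by
  simp [tensorDelta]

theorem diffStep_snd (w : 𝔤.Ext) :
    (𝔤.extLift (A := Module.End K ((TensorAlgebra K L ⊗[K] 𝔤.Ext) × 𝔤.Ext)) 𝔤.diffStep
      𝔤.diffStep_skew w (0, 1)).2 = w := by
  induction w using 𝔤.ext_induction
  case h1 => simp
  case hadd s t hs ht => simp [hs, ht]
  case hsmul c t ht => simp [ht]
  case hmul h a ha t ht => simp [diffStep_apply, ht]

theorem tensorDelta_mul (x : L) (w : 𝔤.Ext) :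
    𝔤.tensorDelta (𝔤.extι x * w) = TensorAlgebra.ι K x ⊗ₜ w - 1 ⊗ₜ 𝔤.ad x w -
      𝔤.tensorWedge x (𝔤.tensorDelta w) := by
  simp [tensorDelta, diffStep_apply, diffStep_snd]

/-! ### The differential on `U(L) ⊗ ⋀ L` -/

theorem envWedge_tmul {g : G} {x : L} (hx : x ∈ 𝔤.gr g) (u : 𝔤.Env) (w : 𝔤.Ext) :
    𝔤.envWedge x (u ⊗ₜ w) = 𝔤.envTwist g u ⊗ₜ (𝔤.extι x * w) :=
  𝔤.wedgeOp_tmul _ hx u w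

theorem envWedge_smul {g : G} {x : L} (hx : x ∈ 𝔤.gr g) (u : 𝔤.Env) (c : 𝔤.Env ⊗[K] 𝔤.Ext) :
    𝔤.envWedge x (u • c) = 𝔤.envTwist g u • 𝔤.envWedge x c :=
  𝔤.wedgeOp_smul _ hx u c

theorem envWedge_skew {g h : G} {x y : L} (hx : x ∈ 𝔤.gr g) (hy : y ∈ 𝔤.gr h)
    (c : 𝔤.Env ⊗[K] 𝔤.Ext) :
    𝔤.envWedge x (𝔤.envWedge y c) = -((ε g h : K) • 𝔤.envWedge y (𝔤.envWedge x c)) :=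
  𝔤.wedgeOp_skew _ 𝔤.envTwist_comm hx hy c

theorem tensorWedge_tmul {g : G} {x : L} (hx : x ∈ 𝔤.gr g) (t : TensorAlgebra K L) (w : 𝔤.Ext) :
    𝔤.tensorWedge x (t ⊗ₜ w) = 𝔤.tensorTwist g t ⊗ₜ (𝔤.extι x * w) :=
  𝔤.wedgeOp_tmul _ hx t w

/-- The projection `T(L) ⊗ ⋀ L → U(L) ⊗ ⋀ L`. -/
noncomputable def proj : TensorAlgebra K L ⊗[K] 𝔤.Ext →ₗ[K] 𝔤.Env ⊗[K] 𝔤.Ext :=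
  LinearMap.rTensor 𝔤.Ext 𝔤.toEnv.toLinearMap

@[simp] theorem proj_tmul (t : TensorAlgebra K L) (w : 𝔤.Ext) :
    𝔤.proj (t ⊗ₜ w) = 𝔤.toEnv t ⊗ₜ w := rfl

theorem proj_smul (t : TensorAlgebra K L) (c : TensorAlgebra K L ⊗[K] 𝔤.Ext) :
    𝔤.proj (t • c) = 𝔤.toEnv t • 𝔤.proj c := by
  induction c using TensorProduct.induction_on with
  | zero => simp
  | tmul b w => simp [TensorProduct.smul_tmul']
  | add c d hc hd => simp [smul_add, hc, hd]

theorem proj_tensorWedge {g : G} {x : L} (hx : x ∈ 𝔤.gr g)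
    (c : TensorAlgebra K L ⊗[K] 𝔤.Ext) :
    𝔤.proj (𝔤.tensorWedge x c) = 𝔤.envWedge x (𝔤.proj c) := by
  induction c using TensorProduct.induction_on with
  | zero => simp
  | tmul b w => simp [𝔤.tensorWedge_tmul hx, 𝔤.envWedge_tmul hx, toEnv_tensorTwist]
  | add c d hc hd => simp [hc, hd]

/-- The differential on the elements `1 ⊗ w`. -/
noncomputable def envDelta : 𝔤.Ext →ₗ[K] 𝔤.Env ⊗[K] 𝔤.Ext := 𝔤.proj ∘ₗ 𝔤.tensorDelta

@[simp] theorem envDelta_one : 𝔤.envDelta 1 = 0 := by simp [envDelta]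

theorem envDelta_mul {g : G} {x : L} (hx : x ∈ 𝔤.gr g) (w : 𝔤.Ext) :
    𝔤.envDelta (𝔤.extι x * w) =
      𝔤.envι x ⊗ₜ w - 1 ⊗ₜ 𝔤.ad x w - 𝔤.envWedge x (𝔤.envDelta w) := by
  simp [envDelta, tensorDelta_mul, 𝔤.proj_tensorWedge hx]

/-- The `A`-linear extension `A ⊗ V → M` of a linear map `V → M`. -/
noncomputable def extendScalars {A V M : Type*} [Ring A] [Algebra K A] [AddCommGroup V]
    [Module K V] [AddCommGroup M] [Module K M] [Module A M] [IsScalarTower K A M]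
    (f : V →ₗ[K] M) : A ⊗[K] V →ₗ[A] M :=
  TensorProduct.AlgebraTensorModule.lift
    { toFun := fun a => Algebra.lsmul K K M a ∘ₗ f
      map_add' := fun a b => by ext; simp
      map_smul' := fun a b => by ext; simp }

/-- The differential on `U(L) ⊗ ⋀ L`. -/
noncomputable def envD : 𝔤.Env ⊗[K] 𝔤.Ext →ₗ[𝔤.Env] 𝔤.Env ⊗[K] 𝔤.Ext :=
  extendScalars 𝔤.envDelta

/-- The lift of the differential to `T(L) ⊗ ⋀ L`. -/
noncomputable def tensorD :
    TensorAlgebra K L ⊗[K] 𝔤.Ext →ₗ[TensorAlgebra K L] TensorAlgebra K L ⊗[K] 𝔤.Ext :=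
  extendScalars 𝔤.tensorDelta

@[simp] theorem envD_tmul (u : 𝔤.Env) (w : 𝔤.Ext) : 𝔤.envD (u ⊗ₜ w) = u • 𝔤.envDelta w := rfl

@[simp] theorem tensorD_tmul (t : TensorAlgebra K L) (w : 𝔤.Ext) :
    𝔤.tensorD (t ⊗ₜ w) = t • 𝔤.tensorDelta w := rfl

theorem envD_smul' (k : K) (c : 𝔤.Env ⊗[K] 𝔤.Ext) : 𝔤.envD (k • c) = k • 𝔤.envD c :=
  (𝔤.envD.restrictScalars K).map_smul k c

theorem proj_tensorD (c : TensorAlgebra K L ⊗[K] 𝔤.Ext) :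
    𝔤.proj (𝔤.tensorD c) = 𝔤.envD (𝔤.proj c) := by
  induction c using TensorProduct.induction_on with
  | zero => simp
  | tmul b w => simp [proj_smul, envDelta]
  | add c d hc hd => simp [hc, hd]

/-- The operators `u ⊗ w ↦ ε(|x|, |u|) (u x ⊗ w - u ⊗ ad x w)` on `U(L) ⊗ ⋀ L`. -/
noncomputable def envLie : L →ₗ[K] Module.End K (𝔤.Env ⊗[K] 𝔤.Ext) :=
  𝔤.glue fun g =>
    (TensorProduct.mapBilinear (RingHom.id K) 𝔤.Env 𝔤.Ext 𝔤.Env 𝔤.Ext).flip LinearMap.id ∘ₗ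
      LinearMap.lcomp K 𝔤.Env (𝔤.envTwist g).toLinearMap ∘ₗ
        (LinearMap.mul K 𝔤.Env).flip ∘ₗ 𝔤.envι -
    TensorProduct.mapBilinear (RingHom.id K) 𝔤.Env 𝔤.Ext 𝔤.Env 𝔤.Ext
      (𝔤.envTwist g).toLinearMap ∘ₗ 𝔤.ad

theorem envLie_tmul {g : G} {x : L} (hx : x ∈ 𝔤.gr g) (u : 𝔤.Env) (w : 𝔤.Ext) :
    𝔤.envLie x (u ⊗ₜ w) =
      (𝔤.envTwist g u * 𝔤.envι x) ⊗ₜ w - 𝔤.envTwist g u ⊗ₜ 𝔤.ad x w := by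
  simp [envLie, 𝔤.glue_apply _ hx]

theorem envLie_smul {g : G} {x : L} (hx : x ∈ 𝔤.gr g) (u : 𝔤.Env) (c : 𝔤.Env ⊗[K] 𝔤.Ext) :
    𝔤.envLie x (u • c) = 𝔤.envTwist g u • 𝔤.envLie x c := by
  induction c using TensorProduct.induction_on with
  | zero => simp
  | tmul b w => simp [TensorProduct.smul_tmul', 𝔤.envLie_tmul hx, smul_sub, mul_assoc]
  | add c d hc hd => simp [smul_add, hc, hd]

/-- Cartan's formula, with `envLie` as Lie derivative; it is the recursion for `envDelta` extended
to all coefficients. -/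
theorem envD_envWedge {g : G} {x : L} (hx : x ∈ 𝔤.gr g) (c : 𝔤.Env ⊗[K] 𝔤.Ext) :
    𝔤.envD (𝔤.envWedge x c) = 𝔤.envLie x c - 𝔤.envWedge x (𝔤.envD c) := by
  induction c using TensorProduct.induction_on with
  | zero => simp
  | tmul u w =>
    simp [𝔤.envWedge_tmul hx, 𝔤.envLie_tmul hx, 𝔤.envDelta_mul hx, 𝔤.envWedge_smul hx, smul_sub,
      TensorProduct.smul_tmul']
  | add c d hc hd => simp only [map_add, hc, hd]; abel

theorem envLie_envWedge {g h : G} {x y : L} (hx : x ∈ 𝔤.gr g) (hy : y ∈ 𝔤.gr h)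
    (c : 𝔤.Env ⊗[K] 𝔤.Ext) :
    𝔤.envLie x (𝔤.envWedge y c) =
      (ε g h : K) • 𝔤.envWedge y (𝔤.envLie x c) - 𝔤.envWedge (𝔤.bracket x y) c := by
  induction c using TensorProduct.induction_on with
  | zero => simp
  | tmul u w =>
    have h4 := ε.coe_mul_swap g h
    simp only [𝔤.envWedge_tmul hy, 𝔤.envWedge_tmul (𝔤.bracket_mem hx hy),
      𝔤.envLie_tmul hx, 𝔤.ad_mul hx, 𝔤.twist_apply _ hy, map_sub, map_mul, map_smul,
      𝔤.envTwist_envι _ hx, envTwist_add, 𝔤.envTwist_comm h g, smul_mul_assoc, mul_smul_comm,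
      TensorProduct.tmul_smul, TensorProduct.tmul_add, ← TensorProduct.smul_tmul']
    linear_combination (norm := module)
      (-h4) • ((𝔤.envTwist g (𝔤.envTwist h u) * 𝔤.envι x) ⊗ₜ[K] (𝔤.extι y * w))
  | add c d hc hd => simp only [map_add, smul_add, hc, hd]; abel

/-- The coefficient part is right multiplication, governed by the relations of `U(L)`; the exterior
part is `ad_bracket`. Right multiplication reverses products, hence the minus sign at the bracket
term. -/
theorem envLie_envLie {g h : G} {x y : L} (hx : x ∈ 𝔤.gr g) (hy : y ∈ 𝔤.gr h)
    (c : 𝔤.Env ⊗[K] 𝔤.Ext) :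
    𝔤.envLie x (𝔤.envLie y c) =
      (ε g h : K) • 𝔤.envLie y (𝔤.envLie x c) - 𝔤.envLie (𝔤.bracket x y) c := by
  induction c using TensorProduct.induction_on with
  | zero => simp
  | tmul u w =>
    have h4 := ε.coe_mul_swap g h
    simp only [𝔤.envLie_tmul hx, 𝔤.envLie_tmul hy, 𝔤.envLie_tmul (𝔤.bracket_mem hx hy), map_sub,
      𝔤.ad_bracket hx hy, map_mul, 𝔤.envTwist_envι _ hx, 𝔤.envTwist_envι _ hy,
      envTwist_add, 𝔤.envTwist_comm h g, smul_mul_assoc, mul_smul_comm, mul_assoc,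
      𝔤.envι_mul hx hy, mul_add, TensorProduct.add_tmul,
      TensorProduct.tmul_smul, TensorProduct.tmul_sub, ← TensorProduct.smul_tmul']
    linear_combination (norm := module)
      h4 • ((𝔤.envTwist g (𝔤.envTwist h u) * 𝔤.envι x) ⊗ₜ[K] 𝔤.ad y w) -
      (ε g h : K) • h4 • ((𝔤.envTwist g (𝔤.envTwist h u) * (𝔤.envι y * 𝔤.envι x)) ⊗ₜ[K] w) -
      h4 • ((𝔤.envTwist g (𝔤.envTwist h u) * (𝔤.envι (𝔤.bracket x y))) ⊗ₜ[K] w)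
  | add c d hc hd => simp only [map_add, smul_add, hc, hd]; abel

/-- With `1 ⊗ y ∧ t = e_y (1 ⊗ t)`, Cartan's formula and the commutation rules of `θ` with `e` and
`θ` reduce the claim for `y ∧ t` to that for `t`; the bracket terms cancel. -/
theorem envD_envLie_one_tmul {g : G} {x : L} (hx : x ∈ 𝔤.gr g) (w : 𝔤.Ext) :
    𝔤.envD (𝔤.envLie x (1 ⊗ₜ w)) = 𝔤.envLie x (𝔤.envD (1 ⊗ₜ w)) := by
  induction w using 𝔤.ext_induction generalizing g x
  case h1 => simp [𝔤.envLie_tmul hx]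
  case hadd s t hs ht => simp only [TensorProduct.tmul_add, map_add, hs hx, ht hx]
  case hsmul c t ht => simp only [TensorProduct.tmul_smul, map_smul, envD_smul', ht hx]
  case hmul h y hy t ht =>
    have h1 : (1 : 𝔤.Env) ⊗ₜ[K] (𝔤.extι y * t) = 𝔤.envWedge y (1 ⊗ₜ t) := by
      rw [𝔤.envWedge_tmul hy, map_one]
    rw [h1, 𝔤.envLie_envWedge hx hy, map_sub, envD_smul', 𝔤.envD_envWedge hy,
      𝔤.envD_envWedge hy, 𝔤.envD_envWedge (𝔤.bracket_mem hx hy), ht hx, map_sub,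
      𝔤.envLie_envWedge hx hy, 𝔤.envLie_envLie hx hy]
    module

theorem envD_envLie {g : G} {x : L} (hx : x ∈ 𝔤.gr g) (c : 𝔤.Env ⊗[K] 𝔤.Ext) :
    𝔤.envD (𝔤.envLie x c) = 𝔤.envLie x (𝔤.envD c) := by
  induction c using TensorProduct.induction_on with
  | zero => simp
  | tmul u w =>
    have : u ⊗ₜ[K] w = u • ((1 : 𝔤.Env) ⊗ₜ[K] w) := by simp [TensorProduct.smul_tmul']
    rw [this, 𝔤.envLie_smul hx, map_smul, map_smul, 𝔤.envLie_smul hx, 𝔤.envD_envLie_one_tmul hx]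
  | add c d hc hd => simp only [map_add, hc, hd]

/-- From `D e_y = θ_y - e_y D` and `D θ_y = θ_y D` one gets `D² e_y = e_y D²`, so `D² = 0` passes
from `t` to `y ∧ t`. -/
theorem envD_envDelta (w : 𝔤.Ext) : 𝔤.envD (𝔤.envDelta w) = 0 := by
  induction w using 𝔤.ext_induction
  case h1 => simp
  case hadd s t hs ht => simp only [map_add, hs, ht, add_zero]
  case hsmul c t ht => simp only [map_smul, envD_smul', ht, smul_zero]
  case hmul h y hy t ht =>
    have h1 : ∀ v, 𝔤.envDelta v = 𝔤.envD ((1 : 𝔤.Env) ⊗ₜ[K] v) := fun v => by simp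
    have h2 : (1 : 𝔤.Env) ⊗ₜ[K] (𝔤.extι y * t) = 𝔤.envWedge y (1 ⊗ₜ t) := by
      rw [𝔤.envWedge_tmul hy, map_one]
    rw [h1] at ht
    rw [h1, h2, 𝔤.envD_envWedge hy, map_sub, 𝔤.envD_envWedge hy, 𝔤.envD_envLie hy, ht]
    simp

theorem envD_envD (c : 𝔤.Env ⊗[K] 𝔤.Ext) : 𝔤.envD (𝔤.envD c) = 0 := by
  induction c using TensorProduct.induction_on with
  | zero => simp
  | tmul u w => rw [envD_tmul, map_smul, envD_envDelta, smul_zero]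
  | add c d hc hd => simp only [map_add, hc, hd, add_zero]

/-! ### The homotopy -/

/-- The action of letters on pairs `(H (t ⊗ w), t ⊗ w)`, where `H` is the homotopy. -/
noncomputable def homotopyStep :
    L →ₗ[K] Module.End K ((𝔤.Env ⊗[K] 𝔤.Ext) × (𝔤.Env ⊗[K] 𝔤.Ext)) where
  toFun x := LinearMap.prod
    (Algebra.lsmul K K _ (𝔤.envι x) ∘ₗ LinearMap.fst K _ _ +
      𝔤.envWedge x ∘ₗ LinearMap.snd K _ _)
    (Algebra.lsmul K K _ (𝔤.envι x) ∘ₗ LinearMap.snd K _ _)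
  map_add' x y := by
    apply LinearMap.ext
    rintro ⟨c, w⟩
    simp
    abel
  map_smul' r x := by
    apply LinearMap.ext
    rintro ⟨c, w⟩
    simp [smul_add]

theorem homotopyStep_apply (x : L) (p : (𝔤.Env ⊗[K] 𝔤.Ext) × (𝔤.Env ⊗[K] 𝔤.Ext)) :
    𝔤.homotopyStep x p = (𝔤.envι x • p.1 + 𝔤.envWedge x p.2, 𝔤.envι x • p.2) := rfl

/-- The homotopy
`H (x₁ ⋯ xₘ ⊗ w) = ∑ᵢ ε(|xᵢ|, |xᵢ₊₁| + ⋯ + |xₘ|) x₁ ⋯ x̂ᵢ ⋯ xₘ ⊗ xᵢ ∧ w`. -/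
noncomputable def homotopy : TensorAlgebra K L ⊗[K] 𝔤.Ext →ₗ[K] 𝔤.Env ⊗[K] 𝔤.Ext :=
  TensorProduct.lift <| LinearMap.mk₂ K
    (fun t w => (TensorAlgebra.lift K 𝔤.homotopyStep t (0, 1 ⊗ₜ w)).1)
    (fun s t w => by simp) (fun r t w => by simp)
    (fun t v w => by
      rw [← Prod.fst_add, ← map_add, Prod.mk_add_mk, add_zero, TensorProduct.tmul_add])
    (fun r t w => by
      rw [← Prod.smul_fst, ← map_smul, Prod.smul_mk, smul_zero, TensorProduct.tmul_smul])

theorem homotopy_tmul (t : TensorAlgebra K L) (w : 𝔤.Ext) : 𝔤.homotopy (t ⊗ₜ w) =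
    (TensorAlgebra.lift K 𝔤.homotopyStep t (0, 1 ⊗ₜ w)).1 := rfl

@[simp] theorem homotopy_one_tmul (w : 𝔤.Ext) : 𝔤.homotopy (1 ⊗ₜ w) = 0 := by
  simp [homotopy_tmul]

theorem homotopyStep_snd (t : TensorAlgebra K L) (w : 𝔤.Ext) :
    (TensorAlgebra.lift K 𝔤.homotopyStep t (0, 1 ⊗ₜ w)).2 = 𝔤.toEnv t ⊗ₜ w := by
  induction t using 𝔤.tensor_induction
  case h1 => simp
  case hadd s t hs ht => simp [hs, ht, TensorProduct.add_tmul]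
  case hsmul c t ht => simp [ht, TensorProduct.smul_tmul']
  case hmul h a ha t ht => simp [homotopyStep_apply, ht, TensorProduct.smul_tmul']

/-- The product rule for `H`: the leading letter either stays a coefficient or becomes the exterior
letter. -/
theorem homotopy_ι_smul (x : L) (c : TensorAlgebra K L ⊗[K] 𝔤.Ext) :
    𝔤.homotopy (TensorAlgebra.ι K x • c) =
      𝔤.envι x • 𝔤.homotopy c + 𝔤.envWedge x (𝔤.proj c) := by
  induction c using TensorProduct.induction_on with
  | zero => simp
  | tmul t w =>
    simp [homotopy_tmul, TensorProduct.smul_tmul', homotopyStep_apply, homotopyStep_snd]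
  | add c d hc hd => simp only [map_add, smul_add, hc, hd]; abel

theorem ι_mul_tmul (x : L) (t : TensorAlgebra K L) (w : 𝔤.Ext) :
    (TensorAlgebra.ι K x * t) ⊗ₜ[K] w = TensorAlgebra.ι K x • (t ⊗ₜ[K] w) := by
  simp [TensorProduct.smul_tmul']

theorem homotopy_ι_mul_tmul (x : L) (t : TensorAlgebra K L) (w : 𝔤.Ext) :
    𝔤.homotopy ((TensorAlgebra.ι K x * t) ⊗ₜ w) =
      𝔤.envι x • 𝔤.homotopy (t ⊗ₜ w) + 𝔤.envWedge x (𝔤.toEnv t ⊗ₜ w) := by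
  rw [ι_mul_tmul, homotopy_ι_smul, proj_tmul]

theorem homotopy_tensorWedge {g : G} {x : L} (hx : x ∈ 𝔤.gr g)
    (c : TensorAlgebra K L ⊗[K] 𝔤.Ext) :
    𝔤.homotopy (𝔤.tensorWedge x c) = -𝔤.envWedge x (𝔤.homotopy c) := by
  induction c using TensorProduct.induction_on with
  | zero => simp
  | tmul t w =>
    induction t using 𝔤.tensor_induction
    case h1 => simp [𝔤.tensorWedge_tmul hx]
    case hadd s t hs ht => simp only [TensorProduct.add_tmul, map_add, hs, ht]; abel
    case hsmul c t ht => simp only [← TensorProduct.smul_tmul', map_smul, ht, smul_neg]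
    case hmul h a ha t ht =>
      rw [𝔤.tensorWedge_tmul hx] at ht
      rw [homotopy_ι_mul_tmul, 𝔤.tensorWedge_tmul hx, map_mul, 𝔤.tensorTwist_ι _ ha,
        smul_mul_assoc, ← TensorProduct.smul_tmul', map_smul, homotopy_ι_mul_tmul, ht, map_add,
        𝔤.envWedge_smul hx, 𝔤.envTwist_envι _ ha, 𝔤.envWedge_skew hx ha, 𝔤.envWedge_tmul hx,
        toEnv_tensorTwist, smul_assoc, smul_neg, smul_add, neg_add, neg_neg, smul_neg]
  | add c d hc hd => simp only [map_add, hc, hd]; abel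

/-- The operator `D H + H D`. -/
noncomputable def laplacian : TensorAlgebra K L ⊗[K] 𝔤.Ext →ₗ[K] 𝔤.Env ⊗[K] 𝔤.Ext :=
  𝔤.envD.restrictScalars K ∘ₗ 𝔤.homotopy + 𝔤.homotopy ∘ₗ 𝔤.tensorD.restrictScalars K

theorem laplacian_apply (c : TensorAlgebra K L ⊗[K] 𝔤.Ext) :
    𝔤.laplacian c = 𝔤.envD (𝔤.homotopy c) + 𝔤.homotopy (𝔤.tensorD c) := rfl

/-- Since `H` vanishes on `1 ⊗ ⋀ L`, only `H D'` contributes: the term `x ⊗ w` returns `1 ⊗ x ∧ w`,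
the `ad` term dies, and `H` anticommutes with exterior multiplication. -/
theorem laplacian_one_tmul_mul {g : G} {x : L} (hx : x ∈ 𝔤.gr g) (w : 𝔤.Ext) :
    𝔤.laplacian (1 ⊗ₜ (𝔤.extι x * w)) =
      1 ⊗ₜ (𝔤.extι x * w) + 𝔤.envWedge x (𝔤.laplacian (1 ⊗ₜ w)) := by
  have h1 : TensorAlgebra.ι K x ⊗ₜ[K] w = (TensorAlgebra.ι K x * 1) ⊗ₜ[K] w := by rw [mul_one]
  simp only [laplacian_apply, homotopy_one_tmul, map_zero, zero_add, tensorD_tmul, one_smul,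
    tensorDelta_mul, map_sub, h1, homotopy_ι_mul_tmul, smul_zero, map_one, 𝔤.envWedge_tmul hx,
    𝔤.homotopy_tensorWedge hx, sub_zero, sub_neg_eq_add]

/-- Moving the letter out of `D H + H D'` leaves `D e_x + e_x D`, which is `θ_x` by Cartan's
formula. -/
theorem laplacian_ι_smul {g : G} {x : L} (hx : x ∈ 𝔤.gr g)
    (c : TensorAlgebra K L ⊗[K] 𝔤.Ext) :
    𝔤.laplacian (TensorAlgebra.ι K x • c) = 𝔤.envι x • 𝔤.laplacian c + 𝔤.envLie x (𝔤.proj c) := by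
  simp only [laplacian_apply, homotopy_ι_smul, map_smul, map_add, 𝔤.envD_envWedge hx,
    proj_tensorD, smul_add]
  abel

theorem tensor_sub_smul {M : Type*} [AddCommGroup M] [Module K M] (s t : TensorAlgebra K L)
    (c : TensorAlgebra K L ⊗[K] M) : (s - t) • c = s • c - t • c := by
  rw [eq_sub_iff_add_eq, ← add_smul, sub_add_cancel]

/-- The homotopy on the defining relations of `U(L)`. -/
theorem homotopy_rel {g h : G} {x y : L} (hx : x ∈ 𝔤.gr g) (hy : y ∈ 𝔤.gr h)
    (c : TensorAlgebra K L ⊗[K] 𝔤.Ext) :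
    𝔤.homotopy ((TensorAlgebra.ι K x * TensorAlgebra.ι K y -
      (ε g h : K) • (TensorAlgebra.ι K y * TensorAlgebra.ι K x) -
        TensorAlgebra.ι K (𝔤.bracket x y)) • c) =
      -𝔤.envWedge (𝔤.bracket x y) (𝔤.proj c) := by
  have h1 : 𝔤.envι x • 𝔤.envι y • 𝔤.homotopy c =
      (ε g h : K) • 𝔤.envι y • 𝔤.envι x • 𝔤.homotopy c +
        𝔤.envι (𝔤.bracket x y) • 𝔤.homotopy c := by
    rw [← mul_smul, 𝔤.envι_mul hx hy, add_smul, smul_assoc, mul_smul]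
  have h4 := ε.coe_mul_swap g h
  simp only [tensor_sub_smul, mul_smul, smul_assoc, map_sub, map_smul, homotopy_ι_smul, proj_smul,
    toEnv_ι, 𝔤.envWedge_smul hx, 𝔤.envWedge_smul hy, 𝔤.envTwist_envι _ hx, 𝔤.envTwist_envι _ hy,
    smul_add, h1]
  generalize 𝔤.envι x • 𝔤.envWedge y (𝔤.proj c) = v
  generalize 𝔤.envι x • 𝔤.homotopy c = v'
  generalize 𝔤.envι y • v' = v''
  generalize 𝔤.envι (𝔤.bracket x y) • 𝔤.homotopy c = v'''
  generalize 𝔤.envι y • 𝔤.envWedge x (𝔤.proj c) = v''''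
  -- The contributions of `e_x` and `e_y` cancel by `ε(|x|,|y|) ε(|y|,|x|) = 1`. Only the bracket
  -- becomes an exterior letter, so the coefficients lose both letters of the relator.
  linear_combination (norm := module) (-h4) • v

end ColorLieAlgebra

/-! ### Averaging over braid relations -/

section Average

variable {R : Type*} [Monoid R]

/-- The product `s (m - 1) * s (m - 2) * ⋯` with `r` factors. -/
def descProd (s : ℕ → R) (m : ℕ) : ℕ → R
  | 0 => 1
  | r + 1 => descProd s m r * s (m - 1 - r)

theorem descProd_commute {s : ℕ → R} {N : ℕ}
    (hcomm : ∀ j k, j + 1 < k → k + 1 < N → s j * s k = s k * s j) {m : ℕ} (hm : m + 1 ≤ N)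
    {k r : ℕ} (h : r + k + 1 < m) : descProd s m r * s k = s k * descProd s m r := by
  induction r with
  | zero => simp [descProd]
  | succ r ih =>
    rw [descProd, mul_assoc, ← hcomm k (m - 1 - r) (by omega) (by omega), ← mul_assoc,
      ih (by omega), mul_assoc]

/-- The generator `s (k + 1)` commutes leftwards past the factors of index below `k`, the braid
relation at `s (k + 1) * s k` turns it into `s k`, and this commutes past the remaining factors, of
index above `k + 1`. -/
theorem descProd_shift {s : ℕ → R} {N : ℕ}
    (hbraid : ∀ k, k + 2 < N → s k * s (k + 1) * s k = s (k + 1) * s k * s (k + 1))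
    (hcomm : ∀ j k, j + 1 < k → k + 1 < N → s j * s k = s k * s j) {m : ℕ} (hm : m + 1 ≤ N)
    {k : ℕ} (hk : k + 1 < m) {r : ℕ} (hr : r ≤ m) (h : m < r + (k + 1)) :
    descProd s m r * s (k + 1) = s k * descProd s m r := by
  induction r with
  | zero => omega
  | succ r ih =>
    rcases (show m = r + (k + 1) ∨ m < r + (k + 1) by omega) with h' | h'
    · obtain ⟨q, rfl⟩ : ∃ q, r = q + 1 := ⟨r - 1, by omega⟩
      have e1 : m - 1 - (q + 1) = k := by omega
      have e2 : m - 1 - q = k + 1 := by omega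
      rw [descProd, descProd, e1, e2]
      calc descProd s m q * s (k + 1) * s k * s (k + 1)
          = descProd s m q * (s (k + 1) * s k * s (k + 1)) := by simp only [mul_assoc]
        _ = (descProd s m q * s k) * s (k + 1) * s k := by
          rw [← hbraid k (by omega)]; simp only [mul_assoc]
        _ = _ := by
          rw [descProd_commute hcomm hm (by omega)]; simp only [mul_assoc]
    · rw [descProd, mul_assoc, hcomm (m - 1 - r) (k + 1) (by omega) (by omega), ← mul_assoc,
        ih (by omega) h', mul_assoc]

/-- Involutions that satisfy the braid relations of the symmetric group have an averaging operator
which is invariant under all of them. -/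
theorem exists_average {K V : Type*} [Field K] [CharZero K] [AddCommGroup V] [Module K V]
    (s : ℕ → Module.End K V) (N : ℕ) (hsq : ∀ k, k + 1 < N → s k * s k = 1)
    (hbraid : ∀ k, k + 2 < N → s k * s (k + 1) * s k = s (k + 1) * s k * s (k + 1))
    (hcomm : ∀ j k, j + 1 < k → k + 1 < N → s j * s k = s k * s j) :
    ∃ A : Module.End K V, (∀ k, k + 1 < N → A * s k = A) ∧
      ∀ v, (∀ k, s k v = v) → A v = v := by
  suffices H : ∀ m ≤ N, ∃ A : Module.End K V, (∀ k, k + 1 < m → A * s k = A) ∧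
      ∀ v, (∀ k, s k v = v) → A v = v from H N le_rfl
  intro m
  induction m with
  | zero => exact fun _ => ⟨1, by simp, by simp⟩
  | succ m ih =>
    intro hm
    obtain ⟨A, hA, hfix⟩ := ih (by omega)
    -- The `m + 1` products `descProd s m r` model representatives of the right cosets of the
    -- symmetric group on `m` letters in that on `m + 1` letters.
    refine ⟨((m : K) + 1)⁻¹ • ∑ r ∈ Finset.range (m + 1), A * descProd s m r, ?_, ?_⟩
    · intro k hk
      rw [smul_mul_assoc, Finset.sum_mul]
      congr 1
      have e1 : m - 1 - (m - 1 - k) = k := by omega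
      -- Right multiplication by `s k` interchanges the cosets `r = m - 1 - k` and `r = m - k`. In
      -- the other cosets it moves to the left as a generator that `A` absorbs.
      refine Finset.sum_equiv (Equiv.swap (m - 1 - k) (m - 1 - k + 1)) ?_ ?_
      · intro r
        rw [Equiv.swap_apply_def]
        simp only [Finset.mem_range]
        split_ifs <;> omega
      · intro r hr
        rw [Finset.mem_range] at hr
        rw [Equiv.swap_apply_def]
        split_ifs with h1 h2
        · subst h1
          rw [descProd, e1, mul_assoc]
        · subst h2
          rw [descProd, e1, mul_assoc, mul_assoc, hsq k (by omega), mul_one]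
        · rcases (show r + k + 1 < m ∨ m < r + k by omega) with h | h
          · rw [mul_assoc, descProd_commute hcomm hm h, ← mul_assoc, hA k (by omega)]
          · obtain ⟨q, rfl⟩ : ∃ q, k = q + 1 := ⟨k - 1, by omega⟩
            rw [mul_assoc, descProd_shift hbraid hcomm hm (by omega) (by omega) h, ← mul_assoc,
              hA q (by omega)]
    · intro v hv
      have hd : ∀ r, descProd s m r v = v := by
        intro r
        induction r with
        | zero => simp [descProd]
        | succ r ih => rw [descProd, Module.End.mul_apply, hv, ih]
      have h0 : (m : K) + 1 ≠ 0 := by exact_mod_cast Nat.succ_ne_zero m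
      simp only [LinearMap.smul_apply, LinearMap.sum_apply, Module.End.mul_apply, hd, hfix v hv,
        Finset.sum_const, Finset.card_range]
      rw [← Nat.cast_smul_eq_nsmul K, smul_smul]
      push_cast
      rw [inv_mul_cancel₀ h0, one_smul]

end Average

namespace ColorLieAlgebra

variable {G K L : Type*} [AddCommGroup G] [DecidableEq G] [Field K]
  {ε : SkewBicharacter G K} [AddCommGroup L] [Module K L] (𝔤 : ColorLieAlgebra ε L)

/-! ### Words -/

/-- The product of the letters of a word in the tensor algebra. -/
noncomputable def word (l : List 𝔤.HIndex) : TensorAlgebra K L :=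
  (l.map fun i => TensorAlgebra.ι K (𝔤.hBasis i)).prod

@[simp] theorem word_nil : 𝔤.word [] = 1 := rfl

@[simp] theorem word_cons (i : 𝔤.HIndex) (l : List 𝔤.HIndex) :
    𝔤.word (i :: l) = TensorAlgebra.ι K (𝔤.hBasis i) * 𝔤.word l := by simp [word]

@[simp] theorem word_append (l l' : List 𝔤.HIndex) :
    𝔤.word (l ++ l') = 𝔤.word l * 𝔤.word l' := by simp [word]

/-- The basis of the tensor algebra that consists of the words. -/
noncomputable def wordBasis : Module.Basis (List 𝔤.HIndex) K (TensorAlgebra K L) :=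
  𝔤.hBasis.tensorAlgebra.reindex FreeMonoid.toList

@[simp] theorem wordBasis_apply (l : List 𝔤.HIndex) : 𝔤.wordBasis l = 𝔤.word l := by
  have h : ∀ m : FreeMonoid 𝔤.HIndex, 𝔤.hBasis.tensorAlgebra m =
      (TensorAlgebra.equivFreeAlgebra 𝔤.hBasis).symm (FreeMonoid.lift (FreeAlgebra.ι K) m) := by
    intro m
    rw [Module.Basis.tensorAlgebra, Module.Basis.map_apply]
    exact congrArg (TensorAlgebra.equivFreeAlgebra 𝔤.hBasis).symm (by
      simp [FreeAlgebra.basisFreeMonoid, FreeAlgebra.equivMonoidAlgebraFreeMonoid])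
  rw [wordBasis, Module.Basis.reindex_apply, h]
  induction l with
  | nil => exact map_one _
  | cons i l ih =>
    have h' : FreeMonoid.toList.symm (i :: l) = FreeMonoid.of i * FreeMonoid.toList.symm l := rfl
    rw [h', map_mul, map_mul, ih, word_cons]
    simp

/-- The span of the words of length at most `m`. -/
noncomputable def tensorLE (m : ℕ) : Submodule K (TensorAlgebra K L) :=
  Submodule.span K (𝔤.word '' {l | l.length ≤ m})

theorem word_mem_tensorLE {l : List 𝔤.HIndex} {m : ℕ} (h : l.length ≤ m) :
    𝔤.word l ∈ 𝔤.tensorLE m := Submodule.subset_span ⟨l, h, rfl⟩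

theorem tensorLE_mono {m n : ℕ} (h : m ≤ n) : 𝔤.tensorLE m ≤ 𝔤.tensorLE n :=
  Submodule.span_mono (Set.image_mono fun _ hl => le_trans hl h)

theorem one_mem_tensorLE (m : ℕ) : (1 : TensorAlgebra K L) ∈ 𝔤.tensorLE m :=
  𝔤.word_mem_tensorLE (l := []) (Nat.zero_le m)

theorem mul_mem_tensorLE {m n : ℕ} {s t : TensorAlgebra K L} (hs : s ∈ 𝔤.tensorLE m)
    (ht : t ∈ 𝔤.tensorLE n) : s * t ∈ 𝔤.tensorLE (m + n) := by
  have h := Submodule.mul_mem_mul hs ht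
  rw [tensorLE, tensorLE, Submodule.span_mul_span] at h
  refine Submodule.span_mono ?_ h
  rintro _ ⟨_, ⟨l, hl, rfl⟩, _, ⟨l', hl', rfl⟩, rfl⟩
  exact ⟨l ++ l', by simpa using Nat.add_le_add hl hl', by simp⟩

theorem ι_mem_tensorLE (x : L) : TensorAlgebra.ι K x ∈ 𝔤.tensorLE 1 := by
  have : (⊤ : Submodule K L) ≤ (𝔤.tensorLE 1).comap (TensorAlgebra.ι K) := by
    rw [← 𝔤.hBasis.span_eq, Submodule.span_le]
    rintro _ ⟨i, rfl⟩
    exact Submodule.subset_span ⟨[i], by simp, by simp⟩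
  exact this trivial

theorem exists_mem_tensorLE (t : TensorAlgebra K L) : ∃ m, t ∈ 𝔤.tensorLE m := by
  have ht := 𝔤.wordBasis.mem_span t
  induction ht using Submodule.span_induction with
  | mem x hx =>
    obtain ⟨l, rfl⟩ := hx
    exact ⟨l.length, by simpa using 𝔤.word_mem_tensorLE le_rfl⟩
  | zero => exact ⟨0, zero_mem _⟩
  | add x y _ _ hx hy =>
    obtain ⟨m, hm⟩ := hx
    obtain ⟨n, hn⟩ := hy
    exact ⟨max m n, add_mem (𝔤.tensorLE_mono (le_max_left _ _) hm)
      (𝔤.tensorLE_mono (le_max_right _ _) hn)⟩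
  | smul c x _ hx => exact hx.imp fun m hm => Submodule.smul_mem _ _ hm

/-! ### Relations of bounded length -/

/-- The defining relation of `U(L)` that belongs to elements `a`, `b` of degrees `g`, `h`. -/
noncomputable def relator (𝔤 : ColorLieAlgebra ε L) (g h : G) : L →ₗ[K] L →ₗ[K] TensorAlgebra K L :=
  LinearMap.mk₂ K (fun a b => TensorAlgebra.ι K a * TensorAlgebra.ι K b -
      (ε g h : K) • (TensorAlgebra.ι K b * TensorAlgebra.ι K a) -
        TensorAlgebra.ι K (𝔤.bracket a b))
    (fun a a' b => by simp only [map_add, add_mul, mul_add, smul_add, LinearMap.add_apply]; abel)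
    (fun c a b => by
      simp only [map_smul, smul_mul_assoc, mul_smul_comm, LinearMap.smul_apply]; module)
    (fun a b b' => by simp only [map_add, add_mul, mul_add, smul_add]; abel)
    (fun c a b => by simp only [map_smul, smul_mul_assoc, mul_smul_comm]; module)

theorem relator_apply (g h : G) (a b : L) : 𝔤.relator g h a b =
    TensorAlgebra.ι K a * TensorAlgebra.ι K b -
      (ε g h : K) • (TensorAlgebra.ι K b * TensorAlgebra.ι K a) -
        TensorAlgebra.ι K (𝔤.bracket a b) := rfl

/-- The span of the consequences of the defining relations of `U(L)` that involve only words of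
length at most `m`. -/
noncomputable def relLE (m : ℕ) : Submodule K (TensorAlgebra K L) :=
  Submodule.span K {t | ∃ (l : List 𝔤.HIndex) (i j : 𝔤.HIndex) (l' : List 𝔤.HIndex),
    l.length + l'.length + 2 ≤ m ∧
      t = 𝔤.word l * 𝔤.relator i.1 j.1 (𝔤.hBasis i) (𝔤.hBasis j) * 𝔤.word l'}

theorem relLE_mono {m n : ℕ} (h : m ≤ n) : 𝔤.relLE m ≤ 𝔤.relLE n := by
  apply Submodule.span_mono
  rintro _ ⟨l, i, j, l', hl, rfl⟩
  exact ⟨l, i, j, l', hl.trans h, rfl⟩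

/-- Brackets of basis elements are homogeneous but need not be basis elements, so the generators of
`relLE` alone are too few for the rewriting arguments. -/
theorem relator_mem_relLE {g h : G} {a b : L} (ha : a ∈ 𝔤.gr g) (hb : b ∈ 𝔤.gr h) {p q m : ℕ}
    {u v : TensorAlgebra K L} (hu : u ∈ 𝔤.tensorLE p) (hv : v ∈ 𝔤.tensorLE q)
    (hm : p + q + 2 ≤ m) : u * 𝔤.relator g h a b * v ∈ 𝔤.relLE m := by
  have key : ∀ x y : L, x ∈ 𝔤.gr g → y ∈ 𝔤.gr h → ∀ l l' : List 𝔤.HIndex,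
      l.length + l'.length + 2 ≤ m →
        𝔤.word l * 𝔤.relator g h x y * 𝔤.word l' ∈ 𝔤.relLE m := by
    intro x y hx hy l l' hl
    have h1 : ∀ j : 𝔤.HIndex, j.1 = h →
        𝔤.word l * 𝔤.relator g h x (𝔤.hBasis j) * 𝔤.word l' ∈ 𝔤.relLE m := by
      intro j hj
      refine 𝔤.gr_induction (S := (𝔤.relLE m).comap (LinearMap.mulRight K (𝔤.word l') ∘ₗ
        LinearMap.mulLeft K (𝔤.word l) ∘ₗ (𝔤.relator g h).flip (𝔤.hBasis j))) ?_ hx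
      intro i hi
      subst hi hj
      exact Submodule.subset_span ⟨l, i, j, l', hl, rfl⟩
    exact 𝔤.gr_induction (S := (𝔤.relLE m).comap (LinearMap.mulRight K (𝔤.word l') ∘ₗ
        LinearMap.mulLeft K (𝔤.word l) ∘ₗ 𝔤.relator g h x)) h1 hy
  have h2 : ∀ l : List 𝔤.HIndex, l.length ≤ p → 𝔤.word l * 𝔤.relator g h a b * v ∈ 𝔤.relLE m := by
    intro l hl
    refine (Submodule.span_le (p := (𝔤.relLE m).comap
      (LinearMap.mulLeft K (𝔤.word l * 𝔤.relator g h a b)))).2 ?_ hv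
    rintro _ ⟨l', hl', rfl⟩
    have hl'' : l'.length ≤ q := hl'
    exact key a b ha hb l l' (by omega)
  refine (Submodule.span_le (p := (𝔤.relLE m).comap
    (LinearMap.mulRight K v ∘ₗ LinearMap.mulRight K (𝔤.relator g h a b)))).2 ?_ hu
  rintro _ ⟨l, hl, rfl⟩
  exact h2 l hl

theorem relLE_le_tensorLE (m : ℕ) : 𝔤.relLE m ≤ 𝔤.tensorLE m := by
  rw [relLE, Submodule.span_le]
  rintro _ ⟨l, i, j, l', hl, rfl⟩
  have h2 : 𝔤.relator i.1 j.1 (𝔤.hBasis i) (𝔤.hBasis j) ∈ 𝔤.tensorLE 2 := by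
    have hij := fun x y => 𝔤.mul_mem_tensorLE (𝔤.ι_mem_tensorLE x) (𝔤.ι_mem_tensorLE y)
    exact sub_mem (sub_mem (hij _ _) (Submodule.smul_mem _ _ (hij _ _)))
      (𝔤.tensorLE_mono one_le_two (𝔤.ι_mem_tensorLE _))
  exact 𝔤.tensorLE_mono (by omega) (𝔤.mul_mem_tensorLE (𝔤.mul_mem_tensorLE
    (𝔤.word_mem_tensorLE (le_refl l.length)) h2) (𝔤.word_mem_tensorLE (le_refl l'.length)))

theorem toEnv_relator {g h : G} {a b : L} (ha : a ∈ 𝔤.gr g) (hb : b ∈ 𝔤.gr h) :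
    𝔤.toEnv (𝔤.relator g h a b) = 0 := by
  simp [relator_apply, 𝔤.envι_mul ha hb]

/-! ### Exchanging neighbouring letters -/

/-- The result of rewriting the letters with indices `k` and `k + 1` of a word by means of the
defining relations of `U(L)`. -/
noncomputable def swapAt : ℕ → List 𝔤.HIndex → TensorAlgebra K L
  | 0, i :: j :: l => (ε i.1 j.1 : K) • 𝔤.word (j :: i :: l) +
      TensorAlgebra.ι K (𝔤.bracket (𝔤.hBasis i) (𝔤.hBasis j)) * 𝔤.word l
  | k + 1, i :: l => TensorAlgebra.ι K (𝔤.hBasis i) * swapAt k l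
  | _, l => 𝔤.word l

theorem swapAt_append (l l' : List 𝔤.HIndex) (i j : 𝔤.HIndex) :
    𝔤.swapAt l.length (l ++ i :: j :: l') = (ε i.1 j.1 : K) • 𝔤.word (l ++ j :: i :: l') +
      𝔤.word l * TensorAlgebra.ι K (𝔤.bracket (𝔤.hBasis i) (𝔤.hBasis j)) * 𝔤.word l' := by
  induction l with
  | nil => simp [swapAt]
  | cons a l ih =>
    simp only [List.cons_append, List.length_cons, swapAt, ih, word_cons, mul_add, mul_smul_comm,
      mul_assoc]

/-- The operator on the tensor algebra that rewrites the letters with indices `k` and `k + 1` of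
the words of length `N`, and fixes all other words. -/
noncomputable def swapOp (N k : ℕ) : Module.End K (TensorAlgebra K L) :=
  𝔤.wordBasis.constr K fun l => if l.length = N then 𝔤.swapAt k l else 𝔤.word l

theorem swapOp_word (N k : ℕ) (l : List 𝔤.HIndex) :
    𝔤.swapOp N k (𝔤.word l) = if l.length = N then 𝔤.swapAt k l else 𝔤.word l := by
  rw [← wordBasis_apply, swapOp, Module.Basis.constr_basis, wordBasis_apply]

theorem swapOp_word_of_ne {N k : ℕ} {l : List 𝔤.HIndex} (h : l.length ≠ N) :
    𝔤.swapOp N k (𝔤.word l) = 𝔤.word l := by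
  rw [swapOp_word, if_neg h]

theorem swapOp_append {N : ℕ} (l l' : List 𝔤.HIndex) (i j : 𝔤.HIndex)
    (h : l.length + l'.length + 2 = N) :
    𝔤.swapOp N l.length (𝔤.word (l ++ i :: j :: l')) =
      (ε i.1 j.1 : K) • 𝔤.word (l ++ j :: i :: l') +
      𝔤.word l * TensorAlgebra.ι K (𝔤.bracket (𝔤.hBasis i) (𝔤.hBasis j)) * 𝔤.word l' := by
  rw [swapOp_word, if_pos (by simp; omega), swapAt_append]

theorem swapOp_of_mem {N k : ℕ} {t : TensorAlgebra K L} (ht : t ∈ 𝔤.tensorLE N) :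
    𝔤.swapOp (N + 1) k t = t := by
  refine (Submodule.span_le (p := LinearMap.eqLocus (𝔤.swapOp (N + 1) k) LinearMap.id)).2 ?_ ht
  rintro _ ⟨l, hl, rfl⟩
  have hl' : l.length ≤ N := hl
  exact 𝔤.swapOp_word_of_ne (by omega)

theorem word_ι_word_mem (l l' : List 𝔤.HIndex) (x : L) {N : ℕ} (h : l.length + l'.length + 1 ≤ N) :
    𝔤.word l * TensorAlgebra.ι K x * 𝔤.word l' ∈ 𝔤.tensorLE N :=
  𝔤.tensorLE_mono (by omega) (𝔤.mul_mem_tensorLE (𝔤.mul_mem_tensorLE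
    (𝔤.word_mem_tensorLE (le_refl l.length)) (𝔤.ι_mem_tensorLE x))
      (𝔤.word_mem_tensorLE (le_refl l'.length)))

/-- The second rewriting fixes the shorter bracket term of the first, and by skew symmetry its own
bracket term cancels it. This holds in `T(L)` itself, without passing to a quotient. -/
theorem swapOp_sq (N k : ℕ) (hk : k + 1 < N + 1) (t : TensorAlgebra K L) :
    𝔤.swapOp (N + 1) k (𝔤.swapOp (N + 1) k t) = t := by
  suffices H : 𝔤.swapOp (N + 1) k ∘ₗ 𝔤.swapOp (N + 1) k = LinearMap.id from
    LinearMap.congr_fun H t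
  refine 𝔤.wordBasis.ext fun w => ?_
  rw [LinearMap.comp_apply, wordBasis_apply, LinearMap.id_apply]
  by_cases hw : w.length = N + 1
  · obtain ⟨l, i, j, l', rfl, rfl⟩ : ∃ l i j l', w = l ++ i :: j :: l' ∧ l.length = k :=
      ⟨w.take k, w[k], w[k + 1], w.drop (k + 2), by simp, by simp; omega⟩
    have hlen : l.length + l'.length + 2 = N + 1 := by simp at hw; omega
    rw [𝔤.swapOp_append l l' i j hlen, map_add, map_smul, 𝔤.swapOp_append l l' j i hlen,
      𝔤.swapOp_of_mem (𝔤.word_ι_word_mem l l' _ (by omega)),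
      𝔤.bracket_skew (𝔤.hBasis_mem j) (𝔤.hBasis_mem i)]
    simp only [map_neg, map_smul, mul_neg, neg_mul, mul_smul_comm, smul_mul_assoc]
    linear_combination (norm := module) (ε.coe_mul_swap i.1 j.1) • (𝔤.word (l ++ i :: j :: l') -
      𝔤.word l * TensorAlgebra.ι K (𝔤.bracket (𝔤.hBasis i) (𝔤.hBasis j)) * 𝔤.word l')
  · rw [𝔤.swapOp_word_of_ne hw, 𝔤.swapOp_word_of_ne hw]

/-- The two ways of reversing `x y z` differ in words of length at most `N`. By the Jacobi identity
the difference is the relator of `([x, y], z)` minus that of `(x, [y, z])` plus `ε(|x|,|y|)` times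
that of `(y, [x, z])`; a bracket counts as one letter, so these have length `N`. -/
theorem swapOp_braid (N k : ℕ) (hk : k + 2 < N + 1) (t : TensorAlgebra K L) :
    𝔤.swapOp (N + 1) k (𝔤.swapOp (N + 1) (k + 1) (𝔤.swapOp (N + 1) k t)) -
      𝔤.swapOp (N + 1) (k + 1) (𝔤.swapOp (N + 1) k (𝔤.swapOp (N + 1) (k + 1) t)) ∈ 𝔤.relLE N := by
  suffices H : ⊤ ≤ (𝔤.relLE N).comap
      (𝔤.swapOp (N + 1) k ∘ₗ 𝔤.swapOp (N + 1) (k + 1) ∘ₗ 𝔤.swapOp (N + 1) k -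
        𝔤.swapOp (N + 1) (k + 1) ∘ₗ 𝔤.swapOp (N + 1) k ∘ₗ 𝔤.swapOp (N + 1) (k + 1)) from
    H (Submodule.mem_top : t ∈ ⊤)
  rw [← 𝔤.wordBasis.span_eq, Submodule.span_le]
  rintro _ ⟨w, rfl⟩
  rw [wordBasis_apply, SetLike.mem_coe, Submodule.mem_comap]
  simp only [LinearMap.sub_apply, LinearMap.comp_apply]
  by_cases hw : w.length = N + 1
  · obtain ⟨l, x, y, z, l', rfl, rfl⟩ : ∃ l x y z l',
        w = l ++ x :: y :: z :: l' ∧ l.length = k :=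
      ⟨w.take k, w[k], w[k + 1], w[k + 2], w.drop (k + 3), by simp, by simp; omega⟩
    have hlen : l.length + l'.length + 3 = N + 1 := by simp at hw; omega
    have hl : ∀ i j m : 𝔤.HIndex, 𝔤.swapOp (N + 1) l.length (𝔤.word (l ++ i :: j :: m :: l')) =
        (ε i.1 j.1 : K) • 𝔤.word (l ++ j :: i :: m :: l') + 𝔤.word l *
          (TensorAlgebra.ι K (𝔤.bracket (𝔤.hBasis i) (𝔤.hBasis j)) *
            TensorAlgebra.ι K (𝔤.hBasis m)) * 𝔤.word l' := fun i j m => by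
      rw [𝔤.swapOp_append l (m :: l') i j (by simp; omega), word_cons]
      simp only [mul_assoc]
    have hr : ∀ i j m : 𝔤.HIndex,
        𝔤.swapOp (N + 1) (l.length + 1) (𝔤.word (l ++ i :: j :: m :: l')) =
        (ε j.1 m.1 : K) • 𝔤.word (l ++ i :: m :: j :: l') + 𝔤.word l *
          (TensorAlgebra.ι K (𝔤.hBasis i) *
            TensorAlgebra.ι K (𝔤.bracket (𝔤.hBasis j) (𝔤.hBasis m))) * 𝔤.word l' := fun i j m => by
      have := 𝔤.swapOp_append (N := N + 1) (l ++ [i]) l' j m (by simp; omega)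
      simpa [mul_assoc] using this
    have hfix : ∀ (k : ℕ) (a b : L), 𝔤.swapOp (N + 1) k (𝔤.word l *
        (TensorAlgebra.ι K a * TensorAlgebra.ι K b) * 𝔤.word l') =
          𝔤.word l * (TensorAlgebra.ι K a * TensorAlgebra.ι K b) * 𝔤.word l' := fun k a b =>
      𝔤.swapOp_of_mem (𝔤.tensorLE_mono (by omega) (𝔤.mul_mem_tensorLE (𝔤.mul_mem_tensorLE
        (𝔤.word_mem_tensorLE (le_refl l.length))
          (𝔤.mul_mem_tensorLE (𝔤.ι_mem_tensorLE a) (𝔤.ι_mem_tensorLE b)))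
            (𝔤.word_mem_tensorLE (le_refl l'.length))))
    simp only [hl, hr, hfix, map_add, map_smul]
    have hx := 𝔤.hBasis_mem x
    have hy := 𝔤.hBasis_mem y
    have hz := 𝔤.hBasis_mem z
    have hrel := fun {g h : G} {a b : L} (ha : a ∈ 𝔤.gr g) (hb : b ∈ 𝔤.gr h) =>
      𝔤.relator_mem_relLE ha hb (𝔤.word_mem_tensorLE (le_refl l.length))
        (𝔤.word_mem_tensorLE (le_refl l'.length)) (show l.length + l'.length + 2 ≤ N by omega)
    have m1 := hrel (𝔤.bracket_mem hx hy) hz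
    have m2 := hrel hx (𝔤.bracket_mem hy hz)
    have m3 := Submodule.smul_mem _ (ε x.1 y.1 : K) (hrel hy (𝔤.bracket_mem hx hz))
    have m4 := add_mem (sub_mem m1 m2) m3
    have e1 := ε.coe_mul_swap x.1 y.1
    convert m4 using 1
    simp only [relator_apply, 𝔤.leibniz hx hy hz, map_sub, map_smul, ε.coe_add_left,
      ε.coe_add_right, mul_sub, sub_mul, mul_smul_comm, smul_mul_assoc]
    linear_combination (norm := module) ((ε y.1 z.1 : K) • e1) •
      (𝔤.word l * (TensorAlgebra.ι K (𝔤.bracket (𝔤.hBasis x) (𝔤.hBasis z)) *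
        TensorAlgebra.ι K (𝔤.hBasis y)) * 𝔤.word l')
  · simp [𝔤.swapOp_word_of_ne hw]

/-- Rewriting two disjoint pairs in either order differs only in whether the second pair has been
rewritten when the first has become a bracket. The discrepancy is a relator of each pair next to the
bracket of the other pair, of length `N`. -/
theorem swapOp_comm (N j k : ℕ) (hjk : j + 1 < k) (hk : k + 1 < N + 1) (t : TensorAlgebra K L) :
    𝔤.swapOp (N + 1) j (𝔤.swapOp (N + 1) k t) - 𝔤.swapOp (N + 1) k (𝔤.swapOp (N + 1) j t) ∈
      𝔤.relLE N := by
  suffices H : ⊤ ≤ (𝔤.relLE N).comap (𝔤.swapOp (N + 1) j ∘ₗ 𝔤.swapOp (N + 1) k -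
        𝔤.swapOp (N + 1) k ∘ₗ 𝔤.swapOp (N + 1) j) from H (Submodule.mem_top : t ∈ ⊤)
  rw [← 𝔤.wordBasis.span_eq, Submodule.span_le]
  rintro _ ⟨w, rfl⟩
  rw [wordBasis_apply, SetLike.mem_coe, Submodule.mem_comap]
  simp only [LinearMap.sub_apply, LinearMap.comp_apply]
  by_cases hw : w.length = N + 1
  · obtain ⟨l, x, y, l', z, u, l'', rfl, rfl, rfl⟩ : ∃ l x y l' z u l'',
        w = l ++ x :: y :: (l' ++ z :: u :: l'') ∧ l.length = j ∧
          l.length + 2 + l'.length = k := by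
      refine ⟨w.take j, w[j], w[j + 1], (w.drop (j + 2)).take (k - (j + 2)), w[k], w[k + 1],
        w.drop (k + 2), ?_, by simp; omega, by simp; omega⟩
      have e1 : w.drop (j + 2) = (w.drop (j + 2)).take (k - (j + 2)) ++
          (w[k] :: w[k + 1] :: w.drop (k + 2)) := by
        conv_lhs => rw [← List.take_append_drop (k - (j + 2)) (w.drop (j + 2))]
        rw [List.drop_drop, show j + 2 + (k - (j + 2)) = k by omega]
        simp
      rw [← e1]
      simp
    have hlen : l.length + l'.length + l''.length + 4 = N + 1 := by simp at hw; omega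
    have hl : ∀ i m p q : 𝔤.HIndex,
        𝔤.swapOp (N + 1) l.length (𝔤.word (l ++ i :: m :: (l' ++ p :: q :: l''))) =
        (ε i.1 m.1 : K) • 𝔤.word (l ++ m :: i :: (l' ++ p :: q :: l'')) + 𝔤.word l *
          TensorAlgebra.ι K (𝔤.bracket (𝔤.hBasis i) (𝔤.hBasis m)) * 𝔤.word l' *
            (TensorAlgebra.ι K (𝔤.hBasis p) * TensorAlgebra.ι K (𝔤.hBasis q)) * 𝔤.word l'' :=
        fun i m p q => by
      rw [𝔤.swapOp_append l (l' ++ p :: q :: l'') i m (by simp; omega)]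
      simp only [mul_assoc, word_cons, word_append]
    have hr : ∀ i m p q : 𝔤.HIndex, 𝔤.swapOp (N + 1) (l.length + 2 + l'.length)
          (𝔤.word (l ++ i :: m :: (l' ++ p :: q :: l''))) =
        (ε p.1 q.1 : K) • 𝔤.word (l ++ i :: m :: (l' ++ q :: p :: l'')) + 𝔤.word l *
          (TensorAlgebra.ι K (𝔤.hBasis i) * TensorAlgebra.ι K (𝔤.hBasis m)) * 𝔤.word l' *
            TensorAlgebra.ι K (𝔤.bracket (𝔤.hBasis p) (𝔤.hBasis q)) * 𝔤.word l'' :=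
        fun i m p q => by
      have := 𝔤.swapOp_append (N := N + 1) (l ++ i :: m :: l') l'' p q (by simp; omega)
      rw [show l.length + 2 + l'.length = (l ++ i :: m :: l').length by simp; omega]
      simpa [mul_assoc] using this
    have hfix : ∀ (k : ℕ) (a b c : L), 𝔤.swapOp (N + 1) k (𝔤.word l * TensorAlgebra.ι K a *
        𝔤.word l' * (TensorAlgebra.ι K b * TensorAlgebra.ι K c) * 𝔤.word l'') =
        𝔤.word l * TensorAlgebra.ι K a * 𝔤.word l' *
          (TensorAlgebra.ι K b * TensorAlgebra.ι K c) * 𝔤.word l'' := fun k a b c =>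
      𝔤.swapOp_of_mem (𝔤.tensorLE_mono (by omega) (𝔤.mul_mem_tensorLE (𝔤.mul_mem_tensorLE
        (𝔤.word_ι_word_mem l l' a le_rfl)
          (𝔤.mul_mem_tensorLE (𝔤.ι_mem_tensorLE b) (𝔤.ι_mem_tensorLE c)))
            (𝔤.word_mem_tensorLE (le_refl l''.length))))
    have hfix' : ∀ (k : ℕ) (a b c : L), 𝔤.swapOp (N + 1) k (𝔤.word l * (TensorAlgebra.ι K a *
        TensorAlgebra.ι K b) * 𝔤.word l' * TensorAlgebra.ι K c * 𝔤.word l'') =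
        𝔤.word l * (TensorAlgebra.ι K a * TensorAlgebra.ι K b) * 𝔤.word l' *
          TensorAlgebra.ι K c * 𝔤.word l'' := fun k a b c =>
      𝔤.swapOp_of_mem (𝔤.tensorLE_mono (by omega) (𝔤.mul_mem_tensorLE (𝔤.mul_mem_tensorLE
        (𝔤.mul_mem_tensorLE (𝔤.mul_mem_tensorLE (𝔤.word_mem_tensorLE (le_refl l.length))
          (𝔤.mul_mem_tensorLE (𝔤.ι_mem_tensorLE a) (𝔤.ι_mem_tensorLE b)))
            (𝔤.word_mem_tensorLE (le_refl l'.length))) (𝔤.ι_mem_tensorLE c))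
              (𝔤.word_mem_tensorLE (le_refl l''.length))))
    simp only [hl, hr, hfix, hfix', map_add, map_smul]
    have m1 := 𝔤.relator_mem_relLE (𝔤.hBasis_mem x) (𝔤.hBasis_mem y)
      (𝔤.word_mem_tensorLE (le_refl l.length))
      (𝔤.word_ι_word_mem l' l'' (𝔤.bracket (𝔤.hBasis z) (𝔤.hBasis u)) le_rfl)
      (show _ ≤ N by omega)
    have m2 := 𝔤.relator_mem_relLE (𝔤.hBasis_mem z) (𝔤.hBasis_mem u)
      (𝔤.word_ι_word_mem l l' (𝔤.bracket (𝔤.hBasis x) (𝔤.hBasis y)) le_rfl)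
      (𝔤.word_mem_tensorLE (le_refl l''.length)) (show _ ≤ N by omega)
    convert sub_mem m1 m2 using 1
    simp only [relator_apply, mul_sub, sub_mul, mul_smul_comm, smul_mul_assoc, mul_assoc,
      word_append, word_cons]
    module
  · simp [𝔤.swapOp_word_of_ne hw]

/-! ### The Poincaré-Birkhoff-Witt theorem -/

/-- The operator induced by `swapOp` modulo the shorter relations. -/
noncomputable def swapQuot (N k : ℕ) : Module.End K (TensorAlgebra K L ⧸ 𝔤.relLE N) :=
  (𝔤.relLE N).mapQ (𝔤.relLE N) (𝔤.swapOp (N + 1) k) fun t ht => by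
    rwa [Submodule.mem_comap, 𝔤.swapOp_of_mem (𝔤.relLE_le_tensorLE N ht)]

theorem swapQuot_mk (N k : ℕ) (t : TensorAlgebra K L) :
    𝔤.swapQuot N k ((𝔤.relLE N).mkQ t) = (𝔤.relLE N).mkQ (𝔤.swapOp (N + 1) k t) := rfl

/-- Modulo `relLE N`, a relator of full length is `w - s_k w` for a word `w` of length `N + 1`, so
the average `A` kills it, whereas `A` fixes everything in `tensorLE N`. An element of both kinds is
zero modulo `relLE N`. -/
theorem relLE_succ_inf_tensorLE [CharZero K] (N : ℕ) {t : TensorAlgebra K L}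
    (ht : t ∈ 𝔤.relLE (N + 1)) (ht' : t ∈ 𝔤.tensorLE N) : t ∈ 𝔤.relLE N := by
  obtain ⟨A, hA, hfix⟩ := exists_average (𝔤.swapQuot N) (N + 1)
    (fun k hk => Submodule.linearMap_qext _ <| LinearMap.ext fun t => by
      simp only [LinearMap.comp_apply, Module.End.mul_apply, swapQuot_mk, 𝔤.swapOp_sq N k hk]
      rfl)
    (fun k hk => Submodule.linearMap_qext _ <| LinearMap.ext fun t => by
      simp only [LinearMap.comp_apply, Module.End.mul_apply, swapQuot_mk]
      exact (Submodule.Quotient.eq _).2 (𝔤.swapOp_braid N k hk t))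
    (fun j k hjk hk => Submodule.linearMap_qext _ <| LinearMap.ext fun t => by
      simp only [LinearMap.comp_apply, Module.End.mul_apply, swapQuot_mk]
      exact (Submodule.Quotient.eq _).2 (𝔤.swapOp_comm N j k hjk hk t))
  have hlow : ∀ t ∈ 𝔤.tensorLE N, A ((𝔤.relLE N).mkQ t) = (𝔤.relLE N).mkQ t := fun t ht =>
    hfix _ fun k => by rw [swapQuot_mk, 𝔤.swapOp_of_mem ht]
  have hker : 𝔤.relLE (N + 1) ≤ LinearMap.ker (A ∘ₗ (𝔤.relLE N).mkQ) := by
    rw [relLE, Submodule.span_le]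
    rintro _ ⟨l, i, j, l', hl, rfl⟩
    rw [SetLike.mem_coe, LinearMap.mem_ker, LinearMap.comp_apply]
    rcases hl.lt_or_eq with h | h
    · have hmem : 𝔤.word l * 𝔤.relator i.1 j.1 (𝔤.hBasis i) (𝔤.hBasis j) * 𝔤.word l' ∈
          𝔤.relLE N := Submodule.subset_span ⟨l, i, j, l', by omega, rfl⟩
      rw [hlow _ (𝔤.relLE_le_tensorLE N hmem)]
      exact (Submodule.Quotient.mk_eq_zero _).2 hmem
    · have hw : 𝔤.word l * 𝔤.relator i.1 j.1 (𝔤.hBasis i) (𝔤.hBasis j) * 𝔤.word l' =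
          𝔤.word (l ++ i :: j :: l') -
            𝔤.swapOp (N + 1) l.length (𝔤.word (l ++ i :: j :: l')) := by
        rw [𝔤.swapOp_append l l' i j h]
        simp only [relator_apply, word_append, word_cons, mul_sub, sub_mul, mul_smul_comm,
          smul_mul_assoc, mul_assoc]
        abel
      rw [hw, map_sub, ← swapQuot_mk, map_sub, ← Module.End.mul_apply, hA _ (by omega), sub_self]
  have h0 : A ((𝔤.relLE N).mkQ t) = 0 := hker ht
  rw [hlow t ht'] at h0
  exact (Submodule.Quotient.mk_eq_zero _).1 h0

/-- The kernel of `T(L) → U(L)`. -/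
noncomputable def relTop : Submodule K (TensorAlgebra K L) := ⨆ m, 𝔤.relLE m

theorem mem_relTop {t : TensorAlgebra K L} : t ∈ 𝔤.relTop ↔ ∃ m, t ∈ 𝔤.relLE m :=
  Submodule.mem_iSup_of_directed _ (Monotone.directed_le fun _ _ => 𝔤.relLE_mono)

theorem ι_mul_mem_relTop (x : L) {t : TensorAlgebra K L} (ht : t ∈ 𝔤.relTop) :
    TensorAlgebra.ι K x * t ∈ 𝔤.relTop := by
  obtain ⟨m, hm⟩ := 𝔤.mem_relTop.1 ht
  refine 𝔤.mem_relTop.2 ⟨m + 1, ?_⟩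
  refine (Submodule.span_le (p := (𝔤.relLE (m + 1)).comap
    (LinearMap.mulLeft K (TensorAlgebra.ι K x)))).2 ?_ hm
  rintro _ ⟨l, i, j, l', hl, rfl⟩
  have := 𝔤.relator_mem_relLE (𝔤.hBasis_mem i) (𝔤.hBasis_mem j)
    (𝔤.mul_mem_tensorLE (𝔤.ι_mem_tensorLE x) (𝔤.word_mem_tensorLE (le_refl l.length)))
    (𝔤.word_mem_tensorLE (le_refl l'.length)) (show _ ≤ m + 1 by omega)
  simpa [mul_assoc] using this

/-- The action of `L` on the quotient of the tensor algebra by the relations. -/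
noncomputable def quotAct : L →ₗ[K] Module.End K (TensorAlgebra K L ⧸ 𝔤.relTop) where
  toFun x := 𝔤.relTop.mapQ 𝔤.relTop (LinearMap.mulLeft K (TensorAlgebra.ι K x))
    fun _ ht => 𝔤.ι_mul_mem_relTop x ht
  map_add' x y := by ext; simp [add_mul]; rfl
  map_smul' c x := by ext; simp; rfl

theorem quotAct_mk (x : L) (t : TensorAlgebra K L) :
    𝔤.quotAct x (𝔤.relTop.mkQ t) = 𝔤.relTop.mkQ (TensorAlgebra.ι K x * t) := rfl

/-- Left multiplication makes the quotient by `relTop` a `U(L)`-module in which the image of `t`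
sends the class of `1` to the class of `t`. -/
theorem mem_relTop_of_toEnv_eq_zero {t : TensorAlgebra K L} (ht : 𝔤.toEnv t = 0) :
    t ∈ 𝔤.relTop := by
  have hf : ∀ (g h : G) (a b : L), a ∈ 𝔤.gr g → b ∈ 𝔤.gr h →
      𝔤.quotAct a * 𝔤.quotAct b =
        (ε g h : K) • (𝔤.quotAct b * 𝔤.quotAct a) + 𝔤.quotAct (𝔤.bracket a b) := by
    intro g h a b ha hb
    refine Submodule.linearMap_qext _ (LinearMap.ext fun t => ?_)
    simp only [LinearMap.comp_apply, Module.End.mul_apply, LinearMap.add_apply,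
      LinearMap.smul_apply, quotAct_mk]
    rw [← map_smul, ← map_add]
    refine (Submodule.Quotient.eq _).2 ?_
    obtain ⟨q, hq⟩ := 𝔤.exists_mem_tensorLE t
    have := 𝔤.relator_mem_relLE ha hb (𝔤.one_mem_tensorLE 0) hq le_rfl
    refine 𝔤.mem_relTop.2 ⟨0 + q + 2, ?_⟩
    convert this using 1
    simp only [relator_apply, one_mul, sub_mul, smul_mul_assoc, mul_assoc]
    abel
  have key : ∀ t, 𝔤.envLift 𝔤.quotAct hf (𝔤.toEnv t) (𝔤.relTop.mkQ 1) = 𝔤.relTop.mkQ t := by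
    intro t
    induction t using 𝔤.tensor_induction
    case h1 => simp
    case hadd s t hs ht => simp only [map_add, LinearMap.add_apply, hs, ht]
    case hsmul c t ht => simp only [map_smul, LinearMap.smul_apply, ht]
    case hmul g a ha t ht =>
      rw [map_mul, map_mul, Module.End.mul_apply, ht, toEnv_ι, envLift_envι, quotAct_mk]
  have := key t
  rw [ht, map_zero, LinearMap.zero_apply] at this
  exact (Submodule.Quotient.mk_eq_zero _).1 this.symm

/-- The Poincaré-Birkhoff-Witt theorem: an element of length at most `m` of the tensor algebra that
vanishes in `U(L)` is a consequence of relations of length at most `m`. -/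
theorem mem_relLE_of_toEnv_eq_zero [CharZero K] {m : ℕ} {t : TensorAlgebra K L}
    (ht : t ∈ 𝔤.tensorLE m) (h0 : 𝔤.toEnv t = 0) : t ∈ 𝔤.relLE m := by
  obtain ⟨N, hN⟩ := 𝔤.mem_relTop.1 (𝔤.mem_relTop_of_toEnv_eq_zero h0)
  have key : ∀ k, t ∈ 𝔤.relLE (m + k) → t ∈ 𝔤.relLE m := by
    intro k
    induction k with
    | zero => exact id
    | succ k ih =>
      exact fun h => ih (𝔤.relLE_succ_inf_tensorLE _ h (𝔤.tensorLE_mono (by omega) ht))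
  exact key N (𝔤.relLE_mono (by omega) hN)

/-! ### Exterior powers -/

theorem extι_mul_mem (x : L) {n : ℕ} {w : 𝔤.Ext} (hw : w ∈ 𝔤.extPow n) :
    𝔤.extι x * w ∈ 𝔤.extPow (n + 1) := by
  rw [extPow, pow_succ']
  exact Submodule.mul_mem_mul ⟨x, rfl⟩ hw

/-- Induction on the exterior degree, with homogeneous letters. -/
theorem extPow_induction {P : (n : ℕ) → 𝔤.Ext → Prop} (h1 : P 0 1)
    (hadd : ∀ n v w, P n v → P n w → P n (v + w)) (hsmul : ∀ n (c : K) w, P n w → P n (c • w))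
    (hmul : ∀ (n : ℕ) (g : G), ∀ a ∈ 𝔤.gr g, ∀ w ∈ 𝔤.extPow n, P n w →
      P (n + 1) (𝔤.extι a * w)) {n : ℕ} {w : 𝔤.Ext} (hw : w ∈ 𝔤.extPow n) : P n w := by
  induction n generalizing w with
  | zero =>
    rw [extPow, pow_zero, Submodule.mem_one] at hw
    obtain ⟨c, rfl⟩ := hw
    rw [Algebra.algebraMap_eq_smul_one]
    exact hsmul _ _ _ h1
  | succ n ih =>
    rw [extPow, pow_succ'] at hw
    induction hw using Submodule.mul_induction_on' with
    | mem_mul_mem x hx v hv =>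
      obtain ⟨a, rfl⟩ := hx
      have : a ∈ ⨆ g, 𝔤.gr g := by rw [iSup_gr]; trivial
      induction this using Submodule.iSup_induction' with
      | mem g a ha => exact hmul n g a ha v hv (ih hv)
      | zero => rw [map_zero, zero_mul, ← zero_smul K (0 : 𝔤.Ext)]
                have h0 : P (n + 1) (𝔤.extι 0 * v) := hmul n 0 0 (zero_mem _) v hv (ih hv)
                simpa using h0
      | add a b _ _ ha hb => rw [map_add, add_mul]; exact hadd _ _ _ ha hb
    | add x _ y _ hx hy => exact hadd _ _ _ hx hy

theorem ad_mem_extPow {g : G} {x : L} (hx : x ∈ 𝔤.gr g) {n : ℕ} {w : 𝔤.Ext}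
    (hw : w ∈ 𝔤.extPow n) : 𝔤.ad x w ∈ 𝔤.extPow n := by
  refine 𝔤.extPow_induction (P := fun n w => 𝔤.ad x w ∈ 𝔤.extPow n) ?_ ?_ ?_ ?_ hw
  · simp
  · intro n v w hv hw
    rw [map_add]
    exact add_mem hv hw
  · intro n c w hw
    rw [map_smul]
    exact Submodule.smul_mem _ _ hw
  · intro n h y hy w hw ih
    rw [𝔤.ad_mul hx]
    exact add_mem (𝔤.extι_mul_mem _ hw) (𝔤.extι_mul_mem _ ih)

/-! ### Filtrations of `T(L) ⊗ ⋀ L` and `U(L) ⊗ ⋀ L` -/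

/-- The span of the `t ⊗ w` with a word `t` of length at most `m` and `w` of degree `n`. -/
noncomputable def tensorChainLE (m n : ℕ) : Submodule K (TensorAlgebra K L ⊗[K] 𝔤.Ext) :=
  Submodule.span K {c | ∃ l : List 𝔤.HIndex, l.length ≤ m ∧ ∃ w ∈ 𝔤.extPow n, c = 𝔤.word l ⊗ₜ w}

/-- The span of the `u ⊗ w` with a word `u` of length less than `m` and `w` of degree `n`. -/
noncomputable def chainLT (m n : ℕ) : Submodule K (𝔤.Env ⊗[K] 𝔤.Ext) :=
  Submodule.span K {c | ∃ l : List 𝔤.HIndex, l.length < m ∧ ∃ w ∈ 𝔤.extPow n,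
    c = 𝔤.toEnv (𝔤.word l) ⊗ₜ w}

theorem word_tmul_mem_tensorChainLE {m n : ℕ} {l : List 𝔤.HIndex} (hl : l.length ≤ m) {w : 𝔤.Ext}
    (hw : w ∈ 𝔤.extPow n) : 𝔤.word l ⊗ₜ w ∈ 𝔤.tensorChainLE m n :=
  Submodule.subset_span ⟨l, hl, w, hw, rfl⟩

theorem word_tmul_mem_chainLT {m n : ℕ} {l : List 𝔤.HIndex} (hl : l.length < m) {w : 𝔤.Ext}
    (hw : w ∈ 𝔤.extPow n) : 𝔤.toEnv (𝔤.word l) ⊗ₜ w ∈ 𝔤.chainLT m n :=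
  Submodule.subset_span ⟨l, hl, w, hw, rfl⟩

theorem chainLT_mono {m m' n : ℕ} (h : m ≤ m') : 𝔤.chainLT m n ≤ 𝔤.chainLT m' n := by
  apply Submodule.span_mono
  rintro _ ⟨l, hl, w, hw, rfl⟩
  exact ⟨l, hl.trans_le h, w, hw, rfl⟩

theorem tmul_mem_tensorChainLE {m n : ℕ} {t : TensorAlgebra K L} (ht : t ∈ 𝔤.tensorLE m)
    {w : 𝔤.Ext} (hw : w ∈ 𝔤.extPow n) : t ⊗ₜ w ∈ 𝔤.tensorChainLE m n := by
  refine (Submodule.span_le (p := (𝔤.tensorChainLE m n).comap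
    ((TensorProduct.mk K _ _).flip w))).2 ?_ ht
  rintro _ ⟨l, hl, rfl⟩
  exact 𝔤.word_tmul_mem_tensorChainLE hl hw

theorem proj_mem_chainLT {m n : ℕ} {c : TensorAlgebra K L ⊗[K] 𝔤.Ext}
    (hc : c ∈ 𝔤.tensorChainLE m n) : 𝔤.proj c ∈ 𝔤.chainLT (m + 1) n := by
  refine (Submodule.span_le (p := (𝔤.chainLT (m + 1) n).comap 𝔤.proj)).2 ?_ hc
  rintro _ ⟨l, hl, w, hw, rfl⟩
  exact 𝔤.word_tmul_mem_chainLT (Nat.lt_succ_of_le hl) hw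

theorem tmul_mem_chainLT {m n : ℕ} {t : TensorAlgebra K L} (ht : t ∈ 𝔤.tensorLE m)
    {w : 𝔤.Ext} (hw : w ∈ 𝔤.extPow n) : 𝔤.toEnv t ⊗ₜ w ∈ 𝔤.chainLT (m + 1) n :=
  𝔤.proj_mem_chainLT (𝔤.tmul_mem_tensorChainLE ht hw)

theorem exists_proj_eq {m n : ℕ} {z : 𝔤.Env ⊗[K] 𝔤.Ext} (hz : z ∈ 𝔤.chainLT (m + 1) n) :
    ∃ c ∈ 𝔤.tensorChainLE m n, 𝔤.proj c = z := by
  suffices H : 𝔤.chainLT (m + 1) n ≤ (𝔤.tensorChainLE m n).map 𝔤.proj from H hz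
  rw [chainLT, Submodule.span_le]
  rintro _ ⟨l, hl, w, hw, rfl⟩
  exact ⟨_, 𝔤.word_tmul_mem_tensorChainLE (Nat.le_of_lt_succ hl) hw, rfl⟩

theorem word_smul_mem_tensorChainLE {m n : ℕ} (l : List 𝔤.HIndex)
    {c : TensorAlgebra K L ⊗[K] 𝔤.Ext} (hc : c ∈ 𝔤.tensorChainLE m n) :
    𝔤.word l • c ∈ 𝔤.tensorChainLE (l.length + m) n := by
  refine (Submodule.span_le (p := (𝔤.tensorChainLE (l.length + m) n).comap
    (Algebra.lsmul K K (TensorAlgebra K L ⊗[K] 𝔤.Ext) (𝔤.word l)))).2 ?_ hc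
  rintro _ ⟨l', hl', w, hw, rfl⟩
  have := 𝔤.word_tmul_mem_tensorChainLE (m := l.length + m) (l := l ++ l') (by simpa using hl') hw
  simpa [TensorProduct.smul_tmul'] using this

theorem word_smul_mem_chainLT {m n : ℕ} (l : List 𝔤.HIndex) {c : 𝔤.Env ⊗[K] 𝔤.Ext}
    (hc : c ∈ 𝔤.chainLT m n) : 𝔤.toEnv (𝔤.word l) • c ∈ 𝔤.chainLT (l.length + m) n := by
  refine (Submodule.span_le (p := (𝔤.chainLT (l.length + m) n).comap
    (Algebra.lsmul K K (𝔤.Env ⊗[K] 𝔤.Ext) (𝔤.toEnv (𝔤.word l))))).2 ?_ hc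
  rintro _ ⟨l', hl', w, hw, rfl⟩
  have := 𝔤.word_tmul_mem_chainLT (m := l.length + m) (l := l ++ l') (by simpa using hl') hw
  simpa [TensorProduct.smul_tmul'] using this

theorem letter_smul_mem_chainLT {m n : ℕ} (i : 𝔤.HIndex) {c : 𝔤.Env ⊗[K] 𝔤.Ext}
    (hc : c ∈ 𝔤.chainLT m n) : 𝔤.envι (𝔤.hBasis i) • c ∈ 𝔤.chainLT (m + 1) n := by
  have := 𝔤.word_smul_mem_chainLT [i] hc
  simpa [add_comm] using this

theorem exists_tensorTwist_word (g : G) (l : List 𝔤.HIndex) :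
    ∃ c : K, 𝔤.tensorTwist g (𝔤.word l) = c • 𝔤.word l := by
  induction l with
  | nil => exact ⟨1, by simp⟩
  | cons i l ih =>
    obtain ⟨c, hc⟩ := ih
    exact ⟨(ε g i.1 : K) * c, by
      simp [hc, 𝔤.tensorTwist_ι g (𝔤.hBasis_mem i), smul_smul, mul_comm]⟩

theorem tensorWedge_mem {g : G} {x : L} (hx : x ∈ 𝔤.gr g) {m n : ℕ}
    {c : TensorAlgebra K L ⊗[K] 𝔤.Ext} (hc : c ∈ 𝔤.tensorChainLE m n) :
    𝔤.tensorWedge x c ∈ 𝔤.tensorChainLE m (n + 1) := by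
  refine (Submodule.span_le (p := (𝔤.tensorChainLE m (n + 1)).comap (𝔤.tensorWedge x))).2 ?_ hc
  rintro _ ⟨l, hl, w, hw, rfl⟩
  obtain ⟨k, hk⟩ := 𝔤.exists_tensorTwist_word g l
  rw [SetLike.mem_coe, Submodule.mem_comap, 𝔤.tensorWedge_tmul hx, hk, ← TensorProduct.smul_tmul']
  exact Submodule.smul_mem _ _ (𝔤.word_tmul_mem_tensorChainLE hl (𝔤.extι_mul_mem x hw))

theorem envWedge_mem {g : G} {x : L} (hx : x ∈ 𝔤.gr g) {m n : ℕ}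
    {c : 𝔤.Env ⊗[K] 𝔤.Ext} (hc : c ∈ 𝔤.chainLT m n) :
    𝔤.envWedge x c ∈ 𝔤.chainLT m (n + 1) := by
  refine (Submodule.span_le (p := (𝔤.chainLT m (n + 1)).comap (𝔤.envWedge x))).2 ?_ hc
  rintro _ ⟨l, hl, w, hw, rfl⟩
  obtain ⟨k, hk⟩ := 𝔤.exists_tensorTwist_word g l
  rw [SetLike.mem_coe, Submodule.mem_comap, 𝔤.envWedge_tmul hx, ← toEnv_tensorTwist, hk, map_smul,
    ← TensorProduct.smul_tmul']
  exact Submodule.smul_mem _ _ (𝔤.word_tmul_mem_chainLT hl (𝔤.extι_mul_mem x hw))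

/-- Commuting a letter past a word produces shorter words. -/
theorem exists_word_mul_envι {g : G} {x : L} (hx : x ∈ 𝔤.gr g) (l : List 𝔤.HIndex) :
    ∃ t ∈ 𝔤.tensorLE l.length, 𝔤.envTwist g (𝔤.toEnv (𝔤.word l)) * 𝔤.envι x =
      𝔤.envι x * 𝔤.toEnv (𝔤.word l) + 𝔤.toEnv t := by
  induction l with
  | nil => exact ⟨0, zero_mem _, by simp⟩
  | cons i l ih =>
    obtain ⟨t, ht, h⟩ := ih
    refine ⟨(ε g i.1 : K) • (TensorAlgebra.ι K (𝔤.hBasis i) * t) -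
      TensorAlgebra.ι K (𝔤.bracket x (𝔤.hBasis i)) * 𝔤.word l, ?_, ?_⟩
    · rw [List.length_cons, add_comm]
      exact sub_mem (Submodule.smul_mem _ _ (𝔤.mul_mem_tensorLE (𝔤.ι_mem_tensorLE _) ht))
        (𝔤.mul_mem_tensorLE (𝔤.ι_mem_tensorLE _) (𝔤.word_mem_tensorLE le_rfl))
    · rw [word_cons, map_mul, map_mul, mul_assoc, h, toEnv_ι,
        𝔤.envTwist_envι _ (𝔤.hBasis_mem i), ← mul_assoc (𝔤.envι x),
        𝔤.envι_mul hx (𝔤.hBasis_mem i)]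
      simp only [mul_add, add_mul, smul_mul_assoc, map_sub, map_smul, map_mul, toEnv_ι, mul_assoc]
      abel

/-- To leading order `θ_x` is left multiplication by `x`: the twist compensates the factor from
moving `x` to the front, and the `ad` term adds no letter to the coefficient. -/
theorem envLie_sub_mem (i : 𝔤.HIndex) (l : List 𝔤.HIndex) {n : ℕ}
    {w : 𝔤.Ext} (hw : w ∈ 𝔤.extPow n) :
    𝔤.envLie (𝔤.hBasis i) (𝔤.toEnv (𝔤.word l) ⊗ₜ w) - 𝔤.toEnv (𝔤.word (i :: l)) ⊗ₜ w ∈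
      𝔤.chainLT (l.length + 1) n := by
  have hx := 𝔤.hBasis_mem i
  obtain ⟨t, ht, h⟩ := 𝔤.exists_word_mul_envι hx l
  obtain ⟨k, hk⟩ := 𝔤.exists_tensorTwist_word i.1 l
  rw [𝔤.envLie_tmul hx, h, TensorProduct.add_tmul, word_cons, map_mul, toEnv_ι,
    ← toEnv_tensorTwist, hk, map_smul, ← TensorProduct.smul_tmul']
  have h1 := 𝔤.tmul_mem_chainLT ht hw
  have h2 := Submodule.smul_mem _ k
    (𝔤.word_tmul_mem_chainLT (Nat.lt_succ_self l.length) (𝔤.ad_mem_extPow hx hw))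
  convert sub_mem h1 h2 using 1
  abel

/-! ### The homotopy and the filtrations -/

theorem laplacian_one_tmul {n : ℕ} {w : 𝔤.Ext} (hw : w ∈ 𝔤.extPow n) :
    𝔤.laplacian (1 ⊗ₜ w) = (n : K) • ((1 : 𝔤.Env) ⊗ₜ[K] w) := by
  refine 𝔤.extPow_induction (P := fun n w =>
    𝔤.laplacian (1 ⊗ₜ w) = (n : K) • ((1 : 𝔤.Env) ⊗ₜ[K] w)) ?_ ?_ ?_ ?_ hw
  · simp [laplacian_apply]
  · intro n v w hv hw
    rw [TensorProduct.tmul_add, map_add, hv, hw, TensorProduct.tmul_add, smul_add]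
  · intro n c w hw
    rw [TensorProduct.tmul_smul, map_smul, hw, TensorProduct.tmul_smul, smul_comm]
  · intro n g x hx w hw ih
    rw [𝔤.laplacian_one_tmul_mul hx, ih, map_smul, 𝔤.envWedge_tmul hx, map_one]
    push_cast
    module

/-- To leading order `D H + H D'` counts letters: `laplacian_one_tmul` counts the exterior ones, and
each coefficient letter adds one more through the leading term of `θ`. -/
theorem laplacian_word_tmul (l : List 𝔤.HIndex) {n : ℕ} {w : 𝔤.Ext} (hw : w ∈ 𝔤.extPow n) :
    𝔤.laplacian (𝔤.word l ⊗ₜ w) - ((l.length + n : ℕ) : K) • (𝔤.toEnv (𝔤.word l) ⊗ₜ[K] w) ∈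
      𝔤.chainLT l.length n := by
  induction l with
  | nil => simp [𝔤.laplacian_one_tmul hw]
  | cons i l ih =>
    have h1 := 𝔤.letter_smul_mem_chainLT i ih
    have h2 := 𝔤.envLie_sub_mem i l hw
    rw [word_cons, ι_mul_tmul, 𝔤.laplacian_ι_smul (𝔤.hBasis_mem i), proj_tmul]
    have h3 : 𝔤.toEnv (𝔤.word (i :: l)) ⊗ₜ[K] w =
        𝔤.envι (𝔤.hBasis i) • (𝔤.toEnv (𝔤.word l) ⊗ₜ[K] w) := by
      simp [TensorProduct.smul_tmul']
    rw [← word_cons, h3]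
    rw [h3] at h2
    rw [List.length_cons]
    convert add_mem h1 h2 using 1
    rw [smul_sub, smul_comm _ ((l.length + n : ℕ) : K)]
    generalize 𝔤.envι (𝔤.hBasis i) • 𝔤.laplacian (𝔤.word l ⊗ₜ[K] w) = v
    generalize 𝔤.envι (𝔤.hBasis i) • (𝔤.toEnv (𝔤.word l) ⊗ₜ[K] w) = v'
    push_cast
    module

theorem laplacian_sub_mem {m n : ℕ} {c : TensorAlgebra K L ⊗[K] 𝔤.Ext}
    (hc : c ∈ 𝔤.tensorChainLE m n) :
    𝔤.laplacian c - ((m + n : ℕ) : K) • 𝔤.proj c ∈ 𝔤.chainLT m n := by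
  refine (Submodule.span_le (p := (𝔤.chainLT m n).comap
    (𝔤.laplacian - ((m + n : ℕ) : K) • 𝔤.proj))).2 ?_ hc
  rintro _ ⟨l, hl, w, hw, rfl⟩
  have h1 := 𝔤.chainLT_mono hl (𝔤.laplacian_word_tmul l hw)
  rw [SetLike.mem_coe, Submodule.mem_comap, LinearMap.sub_apply, LinearMap.smul_apply, proj_tmul]
  rcases hl.lt_or_eq with h | h
  -- A word shorter than `m` has another eigenvalue, but the correction lies in `chainLT m n`
  -- anyway.
  · have h2 := Submodule.smul_mem _ ((l.length : K) - m) (𝔤.word_tmul_mem_chainLT h hw)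
    convert add_mem h1 h2 using 1
    push_cast
    module
  · rwa [h] at h1

/-- In degree `n = 0` the difference `n - 1` is truncated to `0` and the first clause says too
little, hence the second clause. -/
theorem tensorDelta_mem {n : ℕ} {w : 𝔤.Ext} (hw : w ∈ 𝔤.extPow n) :
    𝔤.tensorDelta w ∈ 𝔤.tensorChainLE 1 (n - 1) ∧ (n = 0 → 𝔤.tensorDelta w = 0) := by
  refine 𝔤.extPow_induction (P := fun n w => 𝔤.tensorDelta w ∈ 𝔤.tensorChainLE 1 (n - 1) ∧
    (n = 0 → 𝔤.tensorDelta w = 0)) ?_ ?_ ?_ ?_ hw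
  · simp
  · intro n v w hv hw
    rw [map_add]
    exact ⟨add_mem hv.1 hw.1, fun h => by rw [hv.2 h, hw.2 h, add_zero]⟩
  · intro n c w hw
    rw [map_smul]
    exact ⟨Submodule.smul_mem _ _ hw.1, fun h => by rw [hw.2 h, smul_zero]⟩
  · intro n g x hx w hw ih
    refine ⟨?_, by simp⟩
    rw [tensorDelta_mul, Nat.add_sub_cancel]
    refine sub_mem (sub_mem (𝔤.tmul_mem_tensorChainLE (𝔤.ι_mem_tensorLE x) hw)
      (𝔤.tmul_mem_tensorChainLE (𝔤.one_mem_tensorLE 1) (𝔤.ad_mem_extPow hx hw))) ?_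
    rcases n with _ | n
    · rw [ih.2 rfl, map_zero]
      exact zero_mem _
    · exact 𝔤.tensorWedge_mem hx ih.1

theorem tensorD_mem {m n : ℕ} {c : TensorAlgebra K L ⊗[K] 𝔤.Ext}
    (hc : c ∈ 𝔤.tensorChainLE m (n + 1)) : 𝔤.tensorD c ∈ 𝔤.tensorChainLE (m + 1) n := by
  refine (Submodule.span_le (p := (𝔤.tensorChainLE (m + 1) n).comap
    (𝔤.tensorD.restrictScalars K))).2 ?_ hc
  rintro _ ⟨l, hl, w, hw, rfl⟩
  refine Submodule.span_mono ?_ (𝔤.word_smul_mem_tensorChainLE l (𝔤.tensorDelta_mem hw).1)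
  rintro _ ⟨l', hl', v, hv, rfl⟩
  exact ⟨l', hl'.trans (by omega), v, hv, rfl⟩

theorem tensorD_eq_zero {m : ℕ} {c : TensorAlgebra K L ⊗[K] 𝔤.Ext}
    (hc : c ∈ 𝔤.tensorChainLE m 0) : 𝔤.tensorD c = 0 := by
  refine (Submodule.span_le (p := LinearMap.ker (𝔤.tensorD.restrictScalars K))).2 ?_ hc
  rintro _ ⟨l, hl, w, hw, rfl⟩
  simp [(𝔤.tensorDelta_mem hw).2 rfl]

theorem homotopy_mem {m n : ℕ} {c : TensorAlgebra K L ⊗[K] 𝔤.Ext}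
    (hc : c ∈ 𝔤.tensorChainLE m n) : 𝔤.homotopy c ∈ 𝔤.chainLT m (n + 1) := by
  refine (Submodule.span_le (p := (𝔤.chainLT m (n + 1)).comap 𝔤.homotopy)).2 ?_ hc
  rintro _ ⟨l, hl, w, hw, rfl⟩
  refine 𝔤.chainLT_mono hl ?_
  clear hl
  induction l with
  | nil => simp
  | cons i l ih =>
    rw [word_cons, homotopy_ι_mul_tmul]
    exact add_mem (𝔤.letter_smul_mem_chainLT i ih)
      (𝔤.envWedge_mem (𝔤.hBasis_mem i) (𝔤.word_tmul_mem_chainLT (Nat.lt_succ_self _) hw))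

theorem homotopy_word_smul (l : List 𝔤.HIndex) {c : TensorAlgebra K L ⊗[K] 𝔤.Ext}
    (hc : 𝔤.proj c = 0) : 𝔤.homotopy (𝔤.word l • c) = 𝔤.toEnv (𝔤.word l) • 𝔤.homotopy c := by
  induction l with
  | nil => simp
  | cons i l ih =>
    rw [word_cons, mul_smul, homotopy_ι_smul, ih, proj_smul, hc, smul_zero, map_zero, add_zero,
      map_mul, mul_smul, toEnv_ι]

/-- Compared with `homotopy_mem`, one filtration step is gained. The left factor comes out of `H`
because the relator vanishes in `U(L)`, and `homotopy_rel` then removes two coefficient letters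
instead of one. -/
theorem homotopy_rel_mem {m n : ℕ} {r : TensorAlgebra K L} (hr : r ∈ 𝔤.relLE (m + 1)) {w : 𝔤.Ext}
    (hw : w ∈ 𝔤.extPow n) : 𝔤.homotopy (r ⊗ₜ w) ∈ 𝔤.chainLT m (n + 1) := by
  refine (Submodule.span_le (p := (𝔤.chainLT m (n + 1)).comap
    (𝔤.homotopy ∘ₗ (TensorProduct.mk K _ _).flip w))).2 ?_ hr
  rintro _ ⟨l, i, j, l', hl, rfl⟩
  have hi := 𝔤.hBasis_mem i
  have hj := 𝔤.hBasis_mem j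
  have h1 : (𝔤.word l * 𝔤.relator i.1 j.1 (𝔤.hBasis i) (𝔤.hBasis j) * 𝔤.word l') ⊗ₜ[K] w =
      𝔤.word l • 𝔤.relator i.1 j.1 (𝔤.hBasis i) (𝔤.hBasis j) • (𝔤.word l' ⊗ₜ[K] w) := by
    simp only [TensorProduct.smul_tmul', smul_eq_mul, mul_assoc]
  rw [SetLike.mem_coe, Submodule.mem_comap, LinearMap.comp_apply, LinearMap.flip_apply,
    TensorProduct.mk_apply, h1, homotopy_word_smul _ _ (by
      rw [proj_smul, 𝔤.toEnv_relator hi hj, zero_smul]), relator_apply, 𝔤.homotopy_rel hi hj]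
  refine 𝔤.chainLT_mono ?_ (𝔤.word_smul_mem_chainLT l (neg_mem (𝔤.envWedge_mem
    (𝔤.bracket_mem hi hj) (𝔤.word_tmul_mem_chainLT (Nat.lt_succ_self l'.length) hw))))
  omega

/-- This is where Poincaré-Birkhoff-Witt enters: coefficients that vanish in `U(L)` are combinations
of relators without any increase in length. -/
theorem homotopy_mem_of_proj_eq_zero [CharZero K] {m n : ℕ} {c : TensorAlgebra K L ⊗[K] 𝔤.Ext}
    (hc : c ∈ 𝔤.tensorChainLE (m + 1) n) (h0 : 𝔤.proj c = 0) :
    𝔤.homotopy c ∈ 𝔤.chainLT m (n + 1) := by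
  let P := 𝔤.tensorLE (m + 1)
  let W := 𝔤.extPow n
  let f : P →ₗ[K] 𝔤.Env := 𝔤.toEnv.toLinearMap ∘ₗ P.subtype
  obtain ⟨c', rfl⟩ : ∃ c' : P ⊗[K] W, TensorProduct.map P.subtype W.subtype c' = c := by
    suffices H : 𝔤.tensorChainLE (m + 1) n ≤
      LinearMap.range (TensorProduct.map P.subtype W.subtype) from H hc
    rw [tensorChainLE, Submodule.span_le]
    rintro _ ⟨l, hl, w, hw, rfl⟩
    exact ⟨⟨_, 𝔤.word_mem_tensorLE hl⟩ ⊗ₜ ⟨w, hw⟩, rfl⟩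
  have h1 : LinearMap.lTensor 𝔤.Env W.subtype (LinearMap.rTensor W f c') = 0 := by
    rw [← h0]
    have : LinearMap.lTensor 𝔤.Env W.subtype ∘ₗ LinearMap.rTensor W f =
          𝔤.proj ∘ₗ TensorProduct.map P.subtype W.subtype := TensorProduct.ext' fun _ _ => rfl
    exact LinearMap.congr_fun this c'
  have h2 := Module.Flat.lTensor_preserves_injective_linearMap (M := 𝔤.Env) W.subtype
    W.injective_subtype (h1.trans (map_zero _).symm)
  -- Along a basis of the exterior power, vanishing of the projection becomes vanishing of each
  -- coefficient in `U(L)`.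
  let b := Module.Basis.ofVectorSpace K W
  obtain ⟨p, rfl⟩ := TensorProduct.eq_repr_basis_right b c'
  have h3 : (p.mapRange f (map_zero f)).sum (fun i u => u ⊗ₜ[K] b i) = 0 := by
    rw [← h2, Finsupp.sum_mapRange_index (by simp), Finsupp.sum, Finsupp.sum, map_sum]
    rfl
  have h4 := TensorProduct.sum_tmul_basis_right_eq_zero b _ h3
  rw [Finsupp.sum, map_sum, map_sum]
  refine sum_mem fun i _ => ?_
  have h5 : f (p i) = 0 := DFunLike.congr_fun h4 i
  exact 𝔤.homotopy_rel_mem (𝔤.mem_relLE_of_toEnv_eq_zero (p i).2 h5) (b i).2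

/-! ### Exactness -/

/-- The augmentation on `U(L) ⊗ ⋀ L`. -/
noncomputable def totalAug : 𝔤.Env ⊗[K] 𝔤.Ext →ₗ[K] K :=
  LinearMap.mul' K K ∘ₗ TensorProduct.map 𝔤.counit.toLinearMap 𝔤.extCounit.toLinearMap

@[simp] theorem totalAug_tmul (u : 𝔤.Env) (w : 𝔤.Ext) :
    𝔤.totalAug (u ⊗ₜ w) = 𝔤.counit u * 𝔤.extCounit w := rfl

theorem totalAug_smul (u : 𝔤.Env) (c : 𝔤.Env ⊗[K] 𝔤.Ext) :
    𝔤.totalAug (u • c) = 𝔤.counit u * 𝔤.totalAug c := by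
  induction c using TensorProduct.induction_on with
  | zero => simp
  | tmul b w => simp [TensorProduct.smul_tmul', mul_assoc]
  | add c d hc hd => simp [smul_add, hc, hd, mul_add]

@[simp] theorem counit_envι (x : L) : 𝔤.counit (𝔤.envι x) = 0 := by
  have : 𝔤.counit (𝔤.envι x) = TensorAlgebra.lift K (0 : L →ₗ[K] K) (TensorAlgebra.ι K x) :=
    RingQuot.liftAlgHom_mkAlgHom_apply K _ _ _
  simpa using this

@[simp] theorem extCounit_extι (x : L) : 𝔤.extCounit (𝔤.extι x) = 0 := by
  have : 𝔤.extCounit (𝔤.extι x) = TensorAlgebra.lift K (0 : L →ₗ[K] K) (TensorAlgebra.ι K x) :=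
    RingQuot.liftAlgHom_mkAlgHom_apply K _ _ _
  simpa using this

theorem extCounit_ad {g : G} {x : L} (hx : x ∈ 𝔤.gr g) (w : 𝔤.Ext) :
    𝔤.extCounit (𝔤.ad x w) = 0 := by
  induction w using 𝔤.ext_induction
  case h1 => simp
  case hadd s t hs ht => simp [hs, ht]
  case hsmul c t ht => simp [ht]
  case hmul h a ha t ht => simp [𝔤.ad_mul hx]

theorem totalAug_envWedge {g : G} {x : L} (hx : x ∈ 𝔤.gr g) (c : 𝔤.Env ⊗[K] 𝔤.Ext) :
    𝔤.totalAug (𝔤.envWedge x c) = 0 := by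
  induction c using TensorProduct.induction_on with
  | zero => simp
  | tmul b w => simp [𝔤.envWedge_tmul hx]
  | add c d hc hd => simp [hc, hd]

theorem totalAug_envD (c : 𝔤.Env ⊗[K] 𝔤.Ext) : 𝔤.totalAug (𝔤.envD c) = 0 := by
  have h : ∀ w, 𝔤.totalAug (𝔤.envDelta w) = 0 := by
    intro w
    induction w using 𝔤.ext_induction
    case h1 => simp
    case hadd s t hs ht => simp [hs, ht]
    case hsmul c t ht => simp [ht]
    case hmul h a ha t ht =>
      simp [𝔤.envDelta_mul ha, 𝔤.totalAug_envWedge ha, 𝔤.extCounit_ad ha]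
  induction c using TensorProduct.induction_on with
  | zero => simp
  | tmul b w => rw [envD_tmul, totalAug_smul, h, mul_zero]
  | add c d hc hd => simp [hc, hd]

theorem exists_envD_eq [CharZero K] {m n : ℕ} {z : 𝔤.Env ⊗[K] 𝔤.Ext} (hz : z ∈ 𝔤.chainLT m n)
    (hd : 𝔤.envD z = 0) (haug : n = 0 → 𝔤.totalAug z = 0) :
    ∃ k, ∃ y ∈ 𝔤.chainLT k (n + 1), 𝔤.envD y = z := by
  induction m generalizing z with
  | zero =>
    have : z = 0 := by simpa [chainLT] using hz
    exact ⟨0, 0, zero_mem _, by rw [this, map_zero]⟩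
  | succ m ih =>
    -- Weight zero is the only weight that cannot be inverted. There `z` is a multiple of `1 ⊗ 1`,
    -- and the augmentation forces it to vanish.
    rcases Nat.eq_zero_or_pos (m + n) with h0 | hpos
    · obtain ⟨rfl, rfl⟩ : m = 0 ∧ n = 0 := by omega
      have hz' : 𝔤.chainLT (0 + 1) 0 ≤ Submodule.span K {(1 : 𝔤.Env) ⊗ₜ[K] (1 : 𝔤.Ext)} := by
        rw [chainLT, Submodule.span_le]
        rintro _ ⟨l, hl, w, hw, rfl⟩
        obtain rfl : l = [] := by simpa using hl
        rw [extPow, pow_zero, Submodule.mem_one] at hw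
        obtain ⟨c, rfl⟩ := hw
        rw [Algebra.algebraMap_eq_smul_one, TensorProduct.tmul_smul]
        exact Submodule.smul_mem _ _ (Submodule.subset_span (by simp))
      obtain ⟨c, rfl⟩ := Submodule.mem_span_singleton.1 (hz' hz)
      have hc : c = 0 := by simpa using haug rfl
      exact ⟨0, 0, zero_mem _, by simp [hc]⟩
    · obtain ⟨t, ht, rfl⟩ := 𝔤.exists_proj_eq hz
      have hlap := 𝔤.laplacian_sub_mem ht
      have hH := 𝔤.homotopy_mem ht
      have hHD : 𝔤.homotopy (𝔤.tensorD t) ∈ 𝔤.chainLT m n := by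
        rcases n with _ | n
        · rw [𝔤.tensorD_eq_zero ht, map_zero]
          exact zero_mem _
        · exact 𝔤.homotopy_mem_of_proj_eq_zero (𝔤.tensorD_mem ht) (by rw [proj_tensorD, hd])
      have hne : ((m + n : ℕ) : K) ≠ 0 := Nat.cast_ne_zero.2 hpos.ne'
      set a : K := ((m + n : ℕ) : K)
      -- As `H (D' t)` is of lower filtration, `D (H t)` agrees with `a z` up to lower filtration,
      -- so subtracting this boundary lowers the filtration of the cycle.
      have hz' : 𝔤.proj t - 𝔤.envD (a⁻¹ • 𝔤.homotopy t) ∈ 𝔤.chainLT m n := by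
        have := Submodule.smul_mem _ a⁻¹ (sub_mem hHD hlap)
        convert this using 1
        rw [laplacian_apply, envD_smul', smul_sub, smul_sub, smul_add, smul_smul,
          inv_mul_cancel₀ hne]
        module
      obtain ⟨k, y, hy, hyz⟩ := ih hz' (by rw [map_sub, hd, envD_envD, sub_zero])
        (fun hn => by rw [map_sub, haug hn, totalAug_envD, sub_zero])
      refine ⟨max k m, y + a⁻¹ • 𝔤.homotopy t, add_mem (𝔤.chainLT_mono (le_max_left _ _) hy)
        (Submodule.smul_mem _ _ (𝔤.chainLT_mono (le_max_right _ _) hH)), ?_⟩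
      rw [map_add, hyz, sub_add_cancel]

end ColorLieAlgebra

/-- A family of submodules that spans `M` is a grading if there is a coaction for which its members
are homogeneous. -/
theorem isInternal_of_coaction {G K M B : Type*} [AddCommGroup G] [DecidableEq G] [Field K]
    [AddCommGroup M] [Module K M] [Ring B] [Algebra K B] {ℳ : G → Submodule K M}
    (hspan : ⨆ g, ℳ g = ⊤) (j : M →ₗ[K] B) (hj : Function.Injective j)
    (ρ : M →ₗ[K] AddMonoidAlgebra B G)
    (hρ : ∀ g, ∀ x ∈ ℳ g, ρ x = AddMonoidAlgebra.single g (j x)) : DirectSum.IsInternal ℳ := by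
  -- The coefficient of `ρ` at `g` reads off the component of degree `g`, which makes decompositions
  -- unique.
  have key : ∀ (x : DirectSum G fun g => ℳ g) (g : G),
      (ρ (DirectSum.coeAddMonoidHom ℳ x)).coeff g = j (x g) := by
    intro x g
    induction x using DirectSum.induction_on with
    | zero => simp
    | of i x =>
      rw [DirectSum.coeAddMonoidHom_of, hρ i x x.2, AddMonoidAlgebra.coeff_single,
        Finsupp.single_apply, DirectSum.coe_of_apply]
      split_ifs <;> simp
    | add x y hx hy => simp [hx, hy]
  constructor
  · intro x y hxy
    refine DFinsupp.ext fun g => Subtype.ext (hj ?_)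
    rw [← key, ← key, hxy]
  · intro m
    have hm : m ∈ ⨆ g, ℳ g := by rw [hspan]; trivial
    induction hm using Submodule.iSup_induction' with
    | mem g x hx => exact ⟨DirectSum.of (fun g => ℳ g) g ⟨x, hx⟩, by simp⟩
    | zero => exact ⟨0, map_zero _⟩
    | add x y _ _ hx hy =>
      obtain ⟨a, rfl⟩ := hx
      obtain ⟨b, rfl⟩ := hy
      exact ⟨a + b, map_add _ _ _⟩

namespace ColorLieAlgebra

variable {G K L : Type*} [AddCommGroup G] [DecidableEq G] [Field K]
  {ε : SkewBicharacter G K} [AddCommGroup L] [Module K L] (𝔤 : ColorLieAlgebra ε L)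

/-! ### The grading of `U(L)` -/

theorem one_mem_envGr : (1 : 𝔤.Env) ∈ 𝔤.envGr 0 :=
  Submodule.subset_span ⟨0, Fin.elim0, Fin.elim0, fun i => i.elim0, by simp, by simp⟩

theorem envι_mul_mem_envGr {g h : G} {x : L} (hx : x ∈ 𝔤.gr g) {u : 𝔤.Env} (hu : u ∈ 𝔤.envGr h) :
    𝔤.envι x * u ∈ 𝔤.envGr (g + h) := by
  refine (Submodule.span_le (p := (𝔤.envGr (g + h)).comap
    (LinearMap.mulLeft K (𝔤.envι x)))).2 ?_ hu
  rintro _ ⟨n, y, γ, hy, rfl, rfl⟩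
  refine Submodule.subset_span ⟨n + 1, Fin.cons x y, Fin.cons g γ, ?_, ?_, ?_⟩
  · exact fun i => Fin.cases hx hy i
  · simp [Fin.sum_univ_succ]
  · simp [List.ofFn_succ]

theorem envGr_induction {P : (g : G) → 𝔤.Env → Prop} (h1 : P 0 1)
    (hadd : ∀ g u v, P g u → P g v → P g (u + v)) (hsmul : ∀ g (c : K) u, P g u → P g (c • u))
    (hzero : ∀ g, P g 0)
    (hmul : ∀ (g h : G), ∀ x ∈ 𝔤.gr g, ∀ u ∈ 𝔤.envGr h, P h u → P (g + h) (𝔤.envι x * u))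
    {g : G} {u : 𝔤.Env} (hu : u ∈ 𝔤.envGr g) : P g u := by
  induction hu using Submodule.span_induction with
  | mem u hu =>
    obtain ⟨n, y, γ, hy, rfl, rfl⟩ := hu
    induction n with
    | zero => simpa using h1
    | succ n ih =>
      rw [List.ofFn_succ, List.prod_cons, Fin.sum_univ_succ]
      exact hmul _ _ _ (hy 0) _
        (Submodule.subset_span ⟨n, _, _, fun i => hy i.succ, rfl, rfl⟩) (ih _ _ fun i => hy i.succ)
  | zero => exact hzero g
  | add u v _ _ hu hv => exact hadd _ _ _ hu hv
  | smul c u _ hu => exact hsmul _ _ _ hu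

theorem mul_mem_envGr {g h : G} {u v : 𝔤.Env} (hu : u ∈ 𝔤.envGr g) (hv : v ∈ 𝔤.envGr h) :
    u * v ∈ 𝔤.envGr (g + h) := by
  refine 𝔤.envGr_induction (P := fun g u => u * v ∈ 𝔤.envGr (g + h)) ?_ ?_ ?_ ?_ ?_ hu
  · simpa using hv
  · intro g u u' hu hu'
    rw [add_mul]
    exact add_mem hu hu'
  · intro g c u hu
    rw [smul_mul_assoc]
    exact Submodule.smul_mem _ _ hu
  · intro g
    rw [zero_mul]
    exact zero_mem _
  · intro g k x hx u _ hu
    rw [mul_assoc, add_assoc]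
    exact 𝔤.envι_mul_mem_envGr hx hu

theorem envι_mem_envGr {g : G} {x : L} (hx : x ∈ 𝔤.gr g) : 𝔤.envι x ∈ 𝔤.envGr g := by
  simpa using 𝔤.envι_mul_mem_envGr hx 𝔤.one_mem_envGr

theorem iSup_envGr : ⨆ g, 𝔤.envGr g = ⊤ := by
  rw [eq_top_iff]
  rintro u -
  induction u using 𝔤.env_induction
  case h1 => exact Submodule.mem_iSup_of_mem 0 𝔤.one_mem_envGr
  case hadd s t hs ht => exact add_mem hs ht
  case hsmul c t ht => exact Submodule.smul_mem _ _ ht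
  case hmul g a ha t ht =>
    induction ht using Submodule.iSup_induction' with
    | mem h x hx => exact Submodule.mem_iSup_of_mem (g + h) (𝔤.envι_mul_mem_envGr ha hx)
    | zero => simp
    | add x y _ _ hx hy => rw [mul_add]; exact add_mem hx hy

section Coaction

variable {B : Type*} [Ring B] [Algebra K B]

/-- The linear map that sends `x` of degree `g` to `g ⊗ f x`. -/
noncomputable def coactLin (f : L →ₗ[K] B) : L →ₗ[K] AddMonoidAlgebra B G :=
  𝔤.glue fun g => AddMonoidAlgebra.lsingle g ∘ₗ f

theorem coactLin_apply (f : L →ₗ[K] B) {g : G} {x : L} (hx : x ∈ 𝔤.gr g) :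
    𝔤.coactLin f x = AddMonoidAlgebra.single g (f x) := by
  simp [coactLin, 𝔤.glue_apply _ hx]

/-- The coaction on `U(L)` that defines its grading. -/
noncomputable def envCoact (φ : 𝔤.Env →ₐ[K] B) : 𝔤.Env →ₐ[K] AddMonoidAlgebra B G :=
  𝔤.envLift (𝔤.coactLin (φ.toLinearMap ∘ₗ 𝔤.envι)) fun g h a b ha hb => by
    rw [𝔤.coactLin_apply _ ha, 𝔤.coactLin_apply _ hb, 𝔤.coactLin_apply _ (𝔤.bracket_mem ha hb)]
    simp only [LinearMap.comp_apply, AlgHom.toLinearMap_apply, AddMonoidAlgebra.single_mul_single,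
      ← map_mul, 𝔤.envι_mul ha hb, map_add, map_smul, AddMonoidAlgebra.single_add,
      AddMonoidAlgebra.smul_single, add_comm h g]

theorem envCoact_apply (φ : 𝔤.Env →ₐ[K] B) {g : G} {u : 𝔤.Env} (hu : u ∈ 𝔤.envGr g) :
    𝔤.envCoact φ u = AddMonoidAlgebra.single g (φ u) := by
  refine 𝔤.envGr_induction
    (P := fun g u => 𝔤.envCoact φ u = AddMonoidAlgebra.single g (φ u)) ?_ ?_ ?_ ?_ ?_ hu
  · simp [AddMonoidAlgebra.one_def]
  · intro g u v hu hv
    simp [hu, hv]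
  · intro g c u hu
    simp [hu]
  · simp
  · intro g h x hx u _ hu
    rw [map_mul, hu, envCoact, envLift_envι, 𝔤.coactLin_apply _ hx]
    simp

/-- The coaction on the exterior algebra that defines its grading. -/
noncomputable def extCoact (φ : 𝔤.Ext →ₐ[K] B) : 𝔤.Ext →ₐ[K] AddMonoidAlgebra B G :=
  𝔤.extLift (𝔤.coactLin (φ.toLinearMap ∘ₗ 𝔤.extι)) fun g h a b ha hb => by
    rw [𝔤.coactLin_apply _ ha, 𝔤.coactLin_apply _ hb]
    simp only [LinearMap.comp_apply, AlgHom.toLinearMap_apply, AddMonoidAlgebra.single_mul_single,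
      ← map_mul, 𝔤.extι_mul ha hb, map_neg, map_smul, AddMonoidAlgebra.single_neg,
      AddMonoidAlgebra.smul_single, add_comm h g]

end Coaction

theorem isInternal_envGr : DirectSum.IsInternal 𝔤.envGr :=
  isInternal_of_coaction 𝔤.iSup_envGr LinearMap.id Function.injective_id
    (𝔤.envCoact (AlgHom.id K 𝔤.Env)).toLinearMap fun _ _ hx => 𝔤.envCoact_apply _ hx

theorem isGradedAlg_envGr : IsGradedAlg 𝔤.envGr where
  isInternal := 𝔤.isInternal_envGr
  gradedMonoid :=
    { one_mem := 𝔤.one_mem_envGr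
      mul_mem := fun _ _ _ _ hu hv => 𝔤.mul_mem_envGr hu hv }

/-! ### The grading of the exterior powers -/

/-- The product `x₁ ∧ ⋯ ∧ xₙ` in the exterior algebra. -/
noncomputable def extProd {n : ℕ} (x : Fin n → L) : 𝔤.Ext := (List.ofFn fun i => 𝔤.extι (x i)).prod

theorem coe_wedge {n : ℕ} (x : Fin n → L) : (𝔤.wedge x : 𝔤.Ext) = 𝔤.extProd x := rfl

theorem extProd_succ {n : ℕ} (x : Fin (n + 1) → L) :
    𝔤.extProd x = 𝔤.extι (x 0) * 𝔤.extProd fun i => x i.succ := by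
  simp [extProd, List.ofFn_succ]

@[simp] theorem extProd_zero (x : Fin 0 → L) : 𝔤.extProd x = 1 := by simp [extProd]

theorem extProd_cons {n : ℕ} (a : L) (x : Fin n → L) :
    𝔤.extProd (Fin.cons a x : Fin (n + 1) → L) = 𝔤.extι a * 𝔤.extProd x := by
  simp [extProd_succ]

theorem wedge_mem_extPowGr {n : ℕ} {x : Fin n → L} {γ : Fin n → G} (hx : ∀ i, x i ∈ 𝔤.gr (γ i))
    {g : G} (hg : ∑ i, γ i = g) : 𝔤.wedge x ∈ 𝔤.extPowGr n g :=
  Submodule.subset_span ⟨x, γ, hx, hg, rfl⟩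

theorem extCoact_apply {B : Type*} [Ring B] [Algebra K B] (φ : 𝔤.Ext →ₐ[K] B) {n : ℕ} {g : G}
    {w : 𝔤.extPow n} (hw : w ∈ 𝔤.extPowGr n g) :
    𝔤.extCoact φ w = AddMonoidAlgebra.single g (φ w) := by
  induction hw using Submodule.span_induction with
  | mem w hw =>
    obtain ⟨x, γ, hx, rfl, rfl⟩ := hw
    rw [coe_wedge]
    induction n with
    | zero => simp [AddMonoidAlgebra.one_def]
    | succ n ih =>
      have hι : 𝔤.extCoact φ (𝔤.extι (x 0)) =
          AddMonoidAlgebra.single (γ 0) (φ (𝔤.extι (x 0))) := by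
        rw [extCoact, extLift_extι, 𝔤.coactLin_apply _ (hx 0)]
        rfl
      rw [extProd_succ, map_mul, ih (w := 0) _ _ fun i => hx i.succ, hι, Fin.sum_univ_succ,
        AddMonoidAlgebra.single_mul_single, map_mul]
  | zero => simp
  | add u v _ _ hu hv => simp [hu, hv]
  | smul c u _ hu => simp [hu]

theorem iSup_extPowGr (n : ℕ) : ⨆ g, 𝔤.extPowGr n g = ⊤ := by
  have key : ∀ {n : ℕ} {w : 𝔤.Ext}, w ∈ 𝔤.extPow n →
      w ∈ (⨆ g, 𝔤.extPowGr n g).map (𝔤.extPow n).subtype := by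
    intro n w hw
    refine 𝔤.extPow_induction
      (P := fun n w => w ∈ (⨆ g, 𝔤.extPowGr n g).map (𝔤.extPow n).subtype) ?_ ?_ ?_ ?_ hw
    · exact ⟨𝔤.wedge Fin.elim0, Submodule.mem_iSup_of_mem 0
        (𝔤.wedge_mem_extPowGr (γ := Fin.elim0) (fun i => i.elim0) (by simp)), by
          simp [coe_wedge]⟩
    · exact fun n v w hv hw => add_mem hv hw
    · exact fun n c w hw => Submodule.smul_mem _ _ hw
    · rintro n g a ha _ hm ⟨w, hw, rfl⟩
      clear hm
      rw [SetLike.mem_coe] at hw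
      induction hw using Submodule.iSup_induction' with
      | mem h w hw =>
        induction hw using Submodule.span_induction with
        | mem w hw =>
          obtain ⟨x, γ, hx, rfl, rfl⟩ := hw
          refine ⟨𝔤.wedge (Fin.cons a x), Submodule.mem_iSup_of_mem (g + ∑ i, γ i)
            (𝔤.wedge_mem_extPowGr (γ := Fin.cons g γ) ?_ ?_), ?_⟩
          · exact fun i => Fin.cases ha hx i
          · simp [Fin.sum_univ_succ]
          · simp [coe_wedge, extProd_cons]
        | zero => simp
        | add u v _ _ hu hv => rw [map_add, mul_add]; exact add_mem hu hv
        | smul c u _ hu => rw [map_smul, mul_smul_comm]; exact Submodule.smul_mem _ _ hu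
      | zero => simp
      | add u v _ _ hu hv => rw [map_add, mul_add]; exact add_mem hu hv
  rw [eq_top_iff]
  rintro w -
  obtain ⟨v, hv, hvw⟩ := key w.2
  rwa [← Subtype.ext hvw]

theorem isInternal_extPowGr (n : ℕ) : DirectSum.IsInternal (𝔤.extPowGr n) :=
  isInternal_of_coaction (𝔤.iSup_extPowGr n) (𝔤.extPow n).subtype (Submodule.injective_subtype _)
    ((𝔤.extCoact (AlgHom.id K 𝔤.Ext)).toLinearMap ∘ₗ (𝔤.extPow n).subtype)
    fun _ _ hx => 𝔤.extCoact_apply _ hx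

/-! ### The complex -/

/-- The inclusion of `U(L) ⊗ ⋀ⁿ L` into `U(L) ⊗ ⋀ L`. -/
noncomputable def incl (n : ℕ) : 𝔤.Koszul n →ₗ[𝔤.Env] 𝔤.Env ⊗[K] 𝔤.Ext :=
  LinearMap.baseChange 𝔤.Env (𝔤.extPow n).subtype

@[simp] theorem incl_tmul {n : ℕ} (u : 𝔤.Env) (w : 𝔤.extPow n) :
    𝔤.incl n (u ⊗ₜ w) = u ⊗ₜ (w : 𝔤.Ext) := rfl

theorem incl_injective (n : ℕ) : Function.Injective (𝔤.incl n) :=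
  Module.Flat.lTensor_preserves_injective_linearMap (M := 𝔤.Env) (𝔤.extPow n).subtype
    (Submodule.injective_subtype _)

theorem koszul_induction {n : ℕ} {P : 𝔤.Koszul n → Prop} (hzero : P 0)
    (hadd : ∀ c d, P c → P d → P (c + d))
    (htmul : ∀ (g h : G), ∀ u ∈ 𝔤.envGr g, ∀ v ∈ 𝔤.extPowGr n h, P (u ⊗ₜ v))
    (c : 𝔤.Koszul n) : P c := by
  induction c using TensorProduct.induction_on with
  | zero => exact hzero
  | tmul u v =>
    have hu : u ∈ ⨆ g, 𝔤.envGr g := by rw [iSup_envGr]; trivial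
    have hv : v ∈ ⨆ g, 𝔤.extPowGr n g := by rw [iSup_extPowGr]; trivial
    induction hu using Submodule.iSup_induction' with
    | mem g u hu =>
      induction hv using Submodule.iSup_induction' with
      | mem h v hv => exact htmul g h u hu v hv
      | zero => rwa [TensorProduct.tmul_zero]
      | add v w _ _ hv hw => rw [TensorProduct.tmul_add]; exact hadd _ _ hv hw
    | zero => rwa [TensorProduct.zero_tmul]
    | add v w _ _ hv hw => rw [TensorProduct.add_tmul]; exact hadd _ _ hv hw
  | add c d hc hd => exact hadd _ _ hc hd

theorem tmul_mem_koszulGr {n : ℕ} {g h k : G} {u : 𝔤.Env} (hu : u ∈ 𝔤.envGr g) {v : 𝔤.extPow n}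
    (hv : v ∈ 𝔤.extPowGr n h) (hk : g + h = k) : u ⊗ₜ v ∈ 𝔤.koszulGr n k :=
  Submodule.subset_span ⟨g, h, hk, u, hu, v, hv, rfl⟩

theorem iSup_koszulGr (n : ℕ) : ⨆ g, 𝔤.koszulGr n g = ⊤ := by
  rw [eq_top_iff]
  rintro c -
  induction c using 𝔤.koszul_induction
  case hzero => exact zero_mem _
  case hadd c d hc hd => exact add_mem hc hd
  case htmul g h u hu v hv =>
    exact Submodule.mem_iSup_of_mem (g + h) (𝔤.tmul_mem_koszulGr hu hv rfl)

theorem isInternal_koszulGr (n : ℕ) : DirectSum.IsInternal (𝔤.koszulGr n) := by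
  -- Both coactions take values in the group algebra over `U(L) ⊗ ⋀ L`, so they can be multiplied;
  -- the product adds the degrees of the two factors.
  let e := (𝔤.envCoact (Algebra.TensorProduct.includeLeft : 𝔤.Env →ₐ[K] 𝔤.Env ⊗[K] 𝔤.Ext))
  let f := (𝔤.extCoact (Algebra.TensorProduct.includeRight : 𝔤.Ext →ₐ[K] 𝔤.Env ⊗[K] 𝔤.Ext))
  refine isInternal_of_coaction (𝔤.iSup_koszulGr n) ((𝔤.incl n).restrictScalars K)
    (𝔤.incl_injective n)
    (TensorProduct.lift ((LinearMap.mul K (AddMonoidAlgebra (𝔤.Env ⊗[K] 𝔤.Ext) G)).compl₁₂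
      e.toLinearMap (f.toLinearMap ∘ₗ (𝔤.extPow n).subtype))) ?_
  intro g c hc
  induction hc using Submodule.span_induction with
  | mem c hc =>
    obtain ⟨h, k, rfl, u, hu, v, hv, rfl⟩ := hc
    have hu' : e u = _ := 𝔤.envCoact_apply _ hu
    have hv' : f v = _ := 𝔤.extCoact_apply _ hv
    simp [hu', hv']
  | zero => simp
  | add u v _ _ hu hv => rw [map_add, hu, hv, map_add, AddMonoidAlgebra.single_add]
  | smul c u _ hu => rw [map_smul, hu, map_smul, AddMonoidAlgebra.smul_single]

theorem isGradedMod_koszulGr (n : ℕ) : IsGradedMod 𝔤.envGr (𝔤.koszulGr n) where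
  isInternal := 𝔤.isInternal_koszulGr n
  gradedSMul := ⟨fun g h u c hu hc => by
    refine (Submodule.span_le (p := (𝔤.koszulGr n (g +ᵥ h)).comap
      (Algebra.lsmul K K (𝔤.Koszul n) u))).2 ?_ hc
    rintro _ ⟨h, k, rfl, v, hv, w, hw, rfl⟩
    exact 𝔤.tmul_mem_koszulGr (𝔤.mul_mem_envGr hu hv) hw (by rw [vadd_eq_add, add_assoc])⟩

theorem isGradedFree_koszulGr (n : ℕ) : IsGradedFree 𝔤.Env (𝔤.koszulGr n) := by
  let b := (𝔤.isInternal_extPowGr n).collectedBasis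
    fun g => Module.Basis.ofVectorSpace K (𝔤.extPowGr n g)
  let c := Algebra.TensorProduct.basis 𝔤.Env b
  refine ⟨Set.range c, c.linearIndependent.linearIndepOn_id, c.span_eq, ?_⟩
  rintro _ ⟨i, rfl⟩
  refine ⟨i.1, ?_⟩
  rw [Algebra.TensorProduct.basis_apply]
  exact 𝔤.tmul_mem_koszulGr 𝔤.one_mem_envGr
    ((𝔤.isInternal_extPowGr n).collectedBasis_mem _ i) (zero_add _)

/-! ### The grading of the trivial module. -/

theorem counit_eq_zero {g : G} (hg : g ≠ 0) {u : 𝔤.Env} (hu : u ∈ 𝔤.envGr g) :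
    𝔤.counit u = 0 := by
  refine 𝔤.envGr_induction (P := fun g u => g ≠ 0 → 𝔤.counit u = 0) ?_ ?_ ?_ ?_ ?_ hu hg
  · exact fun h => absurd rfl h
  · exact fun g u v hu hv h => by rw [map_add, hu h, hv h, add_zero]
  · exact fun g c u hu h => by rw [map_smul, hu h, smul_zero]
  · exact fun g _ => map_zero _
  · exact fun g h x _ u _ _ _ => by rw [map_mul, counit_envι, zero_mul]

theorem isGradedMod_trivGr : IsGradedMod 𝔤.envGr 𝔤.trivGr where
  isInternal := by
    refine isInternal_of_coaction (B := K) ?_ (LinearMap.id : K →ₗ[K] K) Function.injective_id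
      (AddMonoidAlgebra.lsingle (R := K) (S := K) 0) ?_
    · rw [eq_top_iff]
      exact le_iSup_of_le 0 (by rw [trivGr, if_pos rfl])
    · intro g x hx
      rcases eq_or_ne g 0 with rfl | hg
      · rfl
      · rw [trivGr, if_neg hg, Submodule.mem_bot] at hx
        subst hx
        erw [map_zero, map_zero, AddMonoidAlgebra.single_zero]
  gradedSMul := ⟨fun g h u t hu ht => by
    rcases eq_or_ne h 0 with rfl | hh
    · rcases eq_or_ne g 0 with rfl | hg
      · rw [trivGr, vadd_eq_add, zero_add, if_pos rfl]
        trivial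
      · rw [triv_smul_def, 𝔤.counit_eq_zero hg hu, zero_smul]
        exact zero_mem _
    · rw [trivGr, if_neg hh, Submodule.mem_bot] at ht
      rw [ht, smul_zero]
      exact zero_mem _⟩

/-! ### Differential, exactness and augmentation on the components. -/

theorem chainLT_le_range (m n : ℕ) :
    𝔤.chainLT m n ≤ (LinearMap.range (𝔤.incl n)).restrictScalars K := by
  rw [chainLT, Submodule.span_le]
  rintro _ ⟨l, hl, w, hw, rfl⟩
  exact ⟨𝔤.toEnv (𝔤.word l) ⊗ₜ ⟨w, hw⟩, rfl⟩

theorem incl_mem_chainLT {n : ℕ} (c : 𝔤.Koszul n) : ∃ m, 𝔤.incl n c ∈ 𝔤.chainLT m n := by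
  induction c using TensorProduct.induction_on with
  | zero => exact ⟨0, by simp⟩
  | tmul u v =>
    obtain ⟨t, rfl⟩ := 𝔤.toEnv_surjective u
    obtain ⟨m, hm⟩ := 𝔤.exists_mem_tensorLE t
    exact ⟨m + 1, 𝔤.tmul_mem_chainLT hm v.2⟩
  | add c d hc hd =>
    obtain ⟨m, hm⟩ := hc
    obtain ⟨m', hm'⟩ := hd
    exact ⟨max m m', by
      rw [map_add]
      exact add_mem (𝔤.chainLT_mono (le_max_left _ _) hm)
        (𝔤.chainLT_mono (le_max_right _ _) hm')⟩

/-- The differential `U(L) ⊗ ⋀ⁿ⁺¹ L → U(L) ⊗ ⋀ⁿ L`. -/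
noncomputable def koszulD (n : ℕ) : 𝔤.Koszul (n + 1) →ₗ[𝔤.Env] 𝔤.Koszul n :=
  -- A linear retraction onto the exterior power restricts the codomain of `envD`. Its choice is
  -- immaterial, since the values already lie in the image of `incl` (`envD_incl_mem_range`).
  LinearMap.baseChange 𝔤.Env (LinearMap.exists_leftInverse_of_injective (𝔤.extPow n).subtype
    (Submodule.ker_subtype _)).choose ∘ₗ 𝔤.envD ∘ₗ 𝔤.incl (n + 1)

theorem envD_incl_mem_range {n : ℕ} (c : 𝔤.Koszul (n + 1)) :
    𝔤.envD (𝔤.incl (n + 1) c) ∈ LinearMap.range (𝔤.incl n) := by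
  induction c using TensorProduct.induction_on with
  | zero => simp
  | tmul u w =>
    rw [incl_tmul, envD_tmul]
    exact Submodule.smul_mem _ _
      (𝔤.chainLT_le_range 2 n (𝔤.proj_mem_chainLT (𝔤.tensorDelta_mem w.2).1))
  | add c d hc hd => rw [map_add, map_add]; exact add_mem hc hd

theorem incl_koszulD {n : ℕ} (c : 𝔤.Koszul (n + 1)) :
    𝔤.incl n (𝔤.koszulD n c) = 𝔤.envD (𝔤.incl (n + 1) c) := by
  obtain ⟨d, hd⟩ := 𝔤.envD_incl_mem_range c
  have h := (LinearMap.exists_leftInverse_of_injective (𝔤.extPow n).subtype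
    (Submodule.ker_subtype _)).choose_spec
  have h' := LinearMap.baseChange_comp (A := 𝔤.Env) (𝔤.extPow n).subtype
    (LinearMap.exists_leftInverse_of_injective (𝔤.extPow n).subtype
      (Submodule.ker_subtype _)).choose
  rw [h, LinearMap.baseChange_id] at h'
  rw [koszulD, LinearMap.comp_apply, LinearMap.comp_apply, ← hd]
  exact congrArg (𝔤.incl n) (LinearMap.congr_fun h' d).symm

theorem augmentation_eq (c : 𝔤.Koszul 0) : 𝔤.augmentation c = 𝔤.totalAug (𝔤.incl 0 c) := by
  induction c using TensorProduct.induction_on with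
  | zero => simp; rfl
  | tmul u w => rfl
  | add c d hc hd => rw [map_add, hc, hd, map_add, map_add]; rfl

theorem exact_koszulD [CharZero K] (n : ℕ) : Function.Exact (𝔤.koszulD (n + 1)) (𝔤.koszulD n) := by
  intro c
  constructor
  · intro hc
    obtain ⟨m, hm⟩ := 𝔤.incl_mem_chainLT c
    obtain ⟨k, y, hy, hyc⟩ := 𝔤.exists_envD_eq hm
      (by rw [← incl_koszulD, hc, map_zero]) (fun h => absurd h (Nat.succ_ne_zero n))
    obtain ⟨d, rfl⟩ := 𝔤.chainLT_le_range _ _ hy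
    exact ⟨d, 𝔤.incl_injective _ (by rw [incl_koszulD, hyc])⟩
  · rintro ⟨d, rfl⟩
    exact 𝔤.incl_injective _ (by rw [incl_koszulD, incl_koszulD, envD_envD, map_zero])

theorem exact_augmentation [CharZero K] : Function.Exact (𝔤.koszulD 0) 𝔤.augmentation := by
  intro c
  constructor
  · intro hc
    rw [augmentation_eq] at hc
    obtain ⟨m, hm⟩ := 𝔤.incl_mem_chainLT c
    have h0 : 𝔤.envD (𝔤.incl 0 c) = 0 := by
      rcases m with _ | m
      · have : 𝔤.incl 0 c = 0 := by simpa [chainLT] using hm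
        rw [this, map_zero]
      · obtain ⟨t, ht, h⟩ := 𝔤.exists_proj_eq hm
        rw [← h, ← proj_tensorD, 𝔤.tensorD_eq_zero ht, map_zero]
    obtain ⟨k, y, hy, hyc⟩ := 𝔤.exists_envD_eq hm h0 fun _ => hc
    obtain ⟨d, rfl⟩ := 𝔤.chainLT_le_range _ _ hy
    exact ⟨d, 𝔤.incl_injective _ (by rw [incl_koszulD, hyc])⟩
  · rintro ⟨d, rfl⟩
    rw [augmentation_eq, incl_koszulD, totalAug_envD]
    rfl

theorem augmentation_surjective : Function.Surjective 𝔤.augmentation := by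
  intro t
  let t' : K := t
  refine ⟨algebraMap K 𝔤.Env t' ⊗ₜ 𝔤.wedge Fin.elim0, ?_⟩
  rw [augmentation_eq, incl_tmul, totalAug_tmul, coe_wedge, extProd_zero, map_one, mul_one,
    AlgHom.commutes]
  rfl

theorem augmentation_mem {g : G} {c : 𝔤.Koszul 0} (hc : c ∈ 𝔤.koszulGr 0 g) :
    𝔤.augmentation c ∈ 𝔤.trivGr g := by
  rcases eq_or_ne g 0 with rfl | hg
  · rw [trivGr, if_pos rfl]
    trivial
  · have : 𝔤.augmentation c = 0 := by
      refine (Submodule.span_le (p := LinearMap.ker (𝔤.augmentation.restrictScalars K))).2 ?_ hc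
      rintro _ ⟨h, k, rfl, u, hu, v, hv, rfl⟩
      change 𝔤.augmentation (u ⊗ₜ v) = 0
      rw [augmentation_eq, incl_tmul, totalAug_tmul]
      -- If `u` has degree zero, `v` has nonzero degree, which is impossible in the zeroth exterior
      -- power; otherwise the counit kills `u`.
      rcases eq_or_ne h 0 with rfl | hh
      · have hv0 : v = 0 := by
          rw [zero_add] at hg
          have hbot : 𝔤.extPowGr 0 k = ⊥ := by
            rw [extPowGr, Submodule.span_eq_bot]
            rintro _ ⟨x, γ, _, rfl, _⟩
            simp at hg
          rwa [hbot, Submodule.mem_bot] at hv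
        rw [hv0]
        simp
        rfl
      · rw [𝔤.counit_eq_zero hh hu, zero_mul]
        rfl
    rw [this]
    exact zero_mem _

end ColorLieAlgebra

namespace ColorLieAlgebra

/-! ### Recursion for the sign factors. -/

@[simp] theorem sgnFactor_zero {G K : Type*} [AddCommGroup G] [Field K]
    (ε : SkewBicharacter G K) {n : ℕ} (γ : Fin (n + 1) → G) : sgnFactor ε γ 0 = 1 := by
  simp [sgnFactor]

theorem sgnFactor_succ {G K : Type*} [AddCommGroup G] [Field K]
    (ε : SkewBicharacter G K) {n : ℕ} (γ : Fin (n + 1) → G) (i : Fin n) :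
    sgnFactor ε γ i.succ =
      (ε (γ 0) (γ i.succ) : K) * sgnFactor ε (fun k => γ k.succ) i := by
  simp [sgnFactor, Finset.prod_filter, Fin.prod_univ_succ]

variable {G K L : Type*} [AddCommGroup G] [DecidableEq G] [Field K]
  {ε : SkewBicharacter G K} [AddCommGroup L] [Module K L] (𝔤 : ColorLieAlgebra ε L)

/-! ### The explicit formula for the differential -/

/-- The twisted product rule puts a bracket in place `j`, and moving it to the front past `x₀, …`
gives the sign. The factor `ε(|a|,|x₀|)` of the twist cancels against the exchange of `x₀` with the
`a` in the bracket. -/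
theorem ad_extProd {g : G} {a : L} (ha : a ∈ 𝔤.gr g) {n : ℕ} (x : Fin (n + 1) → L)
    (γ : Fin (n + 1) → G) (hx : ∀ i, x i ∈ 𝔤.gr (γ i)) :
    𝔤.ad a (𝔤.extProd x) = ∑ j : Fin (n + 1), ((-1 : K) ^ (j : ℕ) * sgnFactor ε γ j) •
      (𝔤.extι (𝔤.bracket a (x j)) * 𝔤.extProd fun k => x (j.succAbove k)) := by
  induction n with
  | zero =>
    rw [extProd_succ, 𝔤.ad_mul ha]
    simp
  | succ n ih =>
    rw [extProd_succ, 𝔤.ad_mul ha, ih _ _ fun i => hx i.succ,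
      Fin.sum_univ_succ (n := n + 1), 𝔤.twist_apply _ (hx 0), Finset.mul_sum]
    congr 1
    · simp
    · refine Finset.sum_congr rfl fun j _ => ?_
      have h1 := 𝔤.extι_mul (hx 0) (𝔤.bracket_mem ha (hx j.succ))
      have h2 := ε.coe_mul_swap g (γ 0)
      rw [ε.coe_add_right] at h1
      rw [𝔤.extProd_succ (fun k => x (j.succ.succAbove k)), sgnFactor_succ, map_smul,
        smul_mul_assoc, mul_smul_comm, ← mul_assoc, h1]
      simp only [Fin.succ_succAbove_zero, Fin.succ_succAbove_succ, neg_mul, smul_mul_assoc,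
        mul_assoc, Fin.val_succ, pow_succ]
      linear_combination (norm := module)
        ((-1 : K) ^ (j : ℕ) * sgnFactor ε (fun k => γ k.succ) j * (ε (γ 0) (γ j.succ) : K)) •
          (-h2) • (𝔤.extι (𝔤.bracket a (x j.succ)) *
            (𝔤.extι (x 0) * 𝔤.extProd fun k => x (j.succAbove k).succ))

theorem incl_mulPart_succ {n : ℕ} (x : Fin (n + 2) → L) (γ : Fin (n + 2) → G)
    (hx : ∀ i, x i ∈ 𝔤.gr (γ i)) :
    𝔤.incl (n + 1) (𝔤.mulPart γ 1 x) = 𝔤.envι (x 0) ⊗ₜ (𝔤.extProd fun k => x k.succ) -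
      𝔤.envWedge (x 0) (𝔤.incl n (𝔤.mulPart (fun k => γ k.succ) 1 fun k => x k.succ)) := by
  have hs : ∀ (m : ℕ) (c : K) (y : 𝔤.Koszul m), 𝔤.incl m (c • y) = c • 𝔤.incl m y :=
    fun m c y => ((𝔤.incl m).restrictScalars K).map_smul c y
  rw [mulPart, mulPart, Fin.sum_univ_succ, map_add, map_sum, map_sum, map_sum, sub_eq_add_neg,
    ← Finset.sum_neg_distrib]
  congr 1
  · simp [coe_wedge]
  · refine Finset.sum_congr rfl fun j _ => ?_
    rw [hs, hs, map_smul, incl_tmul, incl_tmul, 𝔤.envWedge_tmul (hx 0), coe_wedge, coe_wedge,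
      extProd_succ, one_mul, 𝔤.envTwist_envι _ (hx j.succ), sgnFactor_succ]
    simp only [Fin.succ_succAbove_zero, Fin.succ_succAbove_succ, Fin.val_succ, pow_succ,
      ← TensorProduct.smul_tmul']
    module

/-- Pairs containing the first index assemble to the `ad` term of the recursion for `envDelta`. In
the other pairs `x₀` is moved past the bracket, which accounts for the minus sign and for the
factors by which `εᵢ` and `εⱼ` grow. -/
theorem bracketPart_succ {n : ℕ} (x : Fin (n + 2) → L) (γ : Fin (n + 2) → G)
    (hx : ∀ i, x i ∈ 𝔤.gr (γ i)) :
    𝔤.incl (n + 1) (𝔤.bracketPart γ 1 x) = -(1 ⊗ₜ 𝔤.ad (x 0) (𝔤.extProd fun k => x k.succ)) -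
      𝔤.envWedge (x 0) (𝔤.incl n (𝔤.bracketPart (fun k => γ k.succ) 1 fun k => x k.succ)) := by
  have hs : ∀ (m : ℕ) (c : K) (y : 𝔤.Koszul m), 𝔤.incl m (c • y) = c • 𝔤.incl m y :=
    fun m c y => ((𝔤.incl m).restrictScalars K).map_smul c y
  -- For the pair of indices `0` and `j + 1`, the factor `ε(|x_{j+1}|,|x₀|)` in the formula cancels
  -- the first factor of `ε_{j+1}`.
  have hfirst : ∀ j : Fin (n + 1), 𝔤.incl (n + 1)
      (((-1 : K) ^ (((0 : Fin (n + 1)) : ℕ) + (j.succ : ℕ)) *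
        sgnFactor ε γ (0 : Fin (n + 1)).castSucc * sgnFactor ε γ j.succ *
          (ε (γ j.succ) (γ (0 : Fin (n + 1)).castSucc) : K)) •
        ((1 : 𝔤.Env) ⊗ₜ[K] 𝔤.wedge (Fin.cons
          (𝔤.bracket (x (0 : Fin (n + 1)).castSucc) (x j.succ))
            (fun k : Fin n => x (j.succ.succAbove ((0 : Fin (n + 1)).succAbove k))) :
              Fin (n + 1) → L))) =
      -((1 : 𝔤.Env) ⊗ₜ[K] (((-1 : K) ^ (j : ℕ) * sgnFactor ε (fun k => γ k.succ) j) •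
        (𝔤.extι (𝔤.bracket (x 0) (x j.succ)) *
          𝔤.extProd fun k => x (j.succAbove k).succ))) := by
    intro j
    have h1 := ε.coe_mul_swap (γ 0) (γ j.succ)
    rw [hs, incl_tmul, coe_wedge, extProd_cons, TensorProduct.tmul_smul]
    simp only [Fin.castSucc_zero, Fin.zero_succAbove, Fin.succ_succAbove_succ, sgnFactor_zero,
      sgnFactor_succ, Fin.val_succ, Fin.val_zero, zero_add, pow_succ]
    linear_combination (norm := module)
      ((-1 : K) ^ (j : ℕ) * sgnFactor ε (fun k => γ k.succ) j) • (-h1) •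
        ((1 : 𝔤.Env) ⊗ₜ[K] (𝔤.extι (𝔤.bracket (x 0) (x j.succ)) *
          𝔤.extProd fun k => x (j.succAbove k).succ))
  rw [𝔤.ad_extProd (hx 0) _ _ fun i => hx i.succ, TensorProduct.tmul_sum, ← Finset.sum_neg_distrib,
    bracketPart, Fin.sum_univ_succ]
  simp only [Fin.not_lt_zero, if_false, Finset.sum_const_zero, zero_add]
  rw [map_sum]
  rcases n with _ | n
  · simp only [bracketPart, map_zero, sub_zero]
    refine Finset.sum_congr rfl fun j _ => ?_
    rw [← hfirst, Fin.sum_univ_succ]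
    simp
  · rw [bracketPart, map_sum, map_sum, ← Finset.sum_sub_distrib]
    refine Finset.sum_congr rfl fun j _ => ?_
    rw [← hfirst, Fin.sum_univ_succ, if_pos (by simp), map_add, sub_eq_add_neg]
    congr 1
    rw [map_sum, map_sum, map_sum, ← Finset.sum_neg_distrib]
    refine Finset.sum_congr rfl fun i _ => ?_
    have hlt : i.succ.castSucc < j.succ ↔ i.castSucc < j := by
      rw [← Fin.succ_castSucc, Fin.succ_lt_succ_iff]
    by_cases hij : i.castSucc < j
    · rw [if_pos (hlt.2 hij), if_pos hij, hs, hs, map_smul, incl_tmul, incl_tmul,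
        𝔤.envWedge_tmul (hx 0), map_one, coe_wedge, coe_wedge, extProd_cons, extProd_cons,
        extProd_succ, ← Fin.succ_castSucc, sgnFactor_succ, sgnFactor_succ]
      have h1 : ∀ w, 𝔤.extι (x 0) *
          (𝔤.extι (𝔤.bracket (x i.castSucc.succ) (x j.succ)) * w) =
          -(((ε (γ 0) (γ i.castSucc.succ) : K) * (ε (γ 0) (γ j.succ) : K)) •
            (𝔤.extι (𝔤.bracket (x i.castSucc.succ) (x j.succ)) * (𝔤.extι (x 0) * w))) := by
        intro w
        rw [← mul_assoc, 𝔤.extι_mul (hx 0) (𝔤.bracket_mem (hx i.castSucc.succ) (hx j.succ)),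
          ε.coe_add_right, neg_mul, smul_mul_assoc, mul_assoc]
      rw [h1]
      simp only [Fin.succ_succAbove_zero, Fin.succ_succAbove_succ, Fin.val_succ, pow_succ,
        TensorProduct.tmul_neg, TensorProduct.tmul_smul, pow_add]
      module
    · rw [if_neg (fun h => hij (hlt.1 h)), if_neg hij]
      simp

theorem envDelta_extProd {n : ℕ} (x : Fin (n + 1) → L) (γ : Fin (n + 1) → G)
    (hx : ∀ i, x i ∈ 𝔤.gr (γ i)) :
    𝔤.envDelta (𝔤.extProd x) = 𝔤.incl n (𝔤.mulPart γ 1 x + 𝔤.bracketPart γ 1 x) := by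
  induction n with
  | zero =>
    rw [extProd_succ, 𝔤.envDelta_mul (hx 0)]
    simp [mulPart, bracketPart, coe_wedge]
  | succ n ih =>
    rw [extProd_succ, 𝔤.envDelta_mul (hx 0), ih _ _ fun i => hx i.succ, map_add, map_add, map_add,
      𝔤.incl_mulPart_succ x γ hx, 𝔤.bracketPart_succ x γ hx]
    abel

theorem mulPart_eq_smul {n : ℕ} (γ : Fin (n + 1) → G) (u : 𝔤.Env) (x : Fin (n + 1) → L) :
    𝔤.mulPart γ u x = u • 𝔤.mulPart γ 1 x := by
  simp only [mulPart, Finset.smul_sum, one_mul]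
  refine Finset.sum_congr rfl fun i _ => ?_
  rw [smul_comm u, TensorProduct.smul_tmul' u, smul_eq_mul]

theorem bracketPart_eq_smul {n : ℕ} (γ : Fin (n + 1) → G) (u : 𝔤.Env) (x : Fin (n + 1) → L) :
    𝔤.bracketPart γ u x = u • 𝔤.bracketPart γ 1 x := by
  rcases n with _ | n
  · simp [bracketPart]
  · simp only [bracketPart, Finset.smul_sum]
    refine Finset.sum_congr rfl fun j _ => Finset.sum_congr rfl fun i _ => ?_
    split_ifs
    · rw [smul_comm u, TensorProduct.smul_tmul' u, smul_eq_mul, mul_one]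
    · rw [smul_zero]

theorem isDifferential_koszulD : 𝔤.IsDifferential 𝔤.koszulD := by
  intro n u x γ hx
  apply 𝔤.incl_injective
  rw [incl_koszulD, incl_tmul, envD_tmul, coe_wedge, 𝔤.envDelta_extProd x γ hx, ← map_smul,
    smul_add, ← mulPart_eq_smul, ← bracketPart_eq_smul]

/-! ### Degrees, uniqueness and assembly of the resolution. -/

theorem mulPart_mem {n : ℕ} {γ : Fin (n + 1) → G} {h : G} {u : 𝔤.Env} (hu : u ∈ 𝔤.envGr h)
    {x : Fin (n + 1) → L} (hx : ∀ i, x i ∈ 𝔤.gr (γ i)) :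
    𝔤.mulPart γ u x ∈ 𝔤.koszulGr n (h + ∑ i, γ i) := by
  refine sum_mem fun i _ => Submodule.smul_mem _ _ (𝔤.tmul_mem_koszulGr
    (𝔤.mul_mem_envGr hu (𝔤.envι_mem_envGr (hx i)))
    (𝔤.wedge_mem_extPowGr (fun k => hx (i.succAbove k)) rfl) ?_)
  rw [Fin.sum_univ_succAbove γ i, add_assoc]

theorem bracketPart_mem {n : ℕ} {γ : Fin (n + 1) → G} {h : G} {u : 𝔤.Env} (hu : u ∈ 𝔤.envGr h)
    {x : Fin (n + 1) → L} (hx : ∀ i, x i ∈ 𝔤.gr (γ i)) :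
    𝔤.bracketPart γ u x ∈ 𝔤.koszulGr n (h + ∑ i, γ i) := by
  rcases n with _ | n
  · exact zero_mem _
  · refine sum_mem fun j _ => sum_mem fun i _ => ?_
    split_ifs with hij
    · refine Submodule.smul_mem _ _ (𝔤.tmul_mem_koszulGr hu
        (𝔤.wedge_mem_extPowGr (γ := Fin.cons (γ i.castSucc + γ j)
          fun k : Fin n => γ (j.succAbove (i.succAbove k))) ?_ rfl) ?_)
      · exact fun k => Fin.cases (𝔤.bracket_mem (hx _) (hx _)) (fun k => hx _) k
      · rw [Fin.sum_univ_succAbove γ j, Fin.sum_univ_succAbove (fun k => γ (j.succAbove k)) i,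
          Fin.succAbove_of_castSucc_lt _ _ hij, Fin.sum_univ_succ]
        simp only [Fin.cons_zero, Fin.cons_succ]
        abel
    · exact zero_mem _

theorem koszulD_mem {n : ℕ} {g : G} {c : 𝔤.Koszul (n + 1)} (hc : c ∈ 𝔤.koszulGr (n + 1) g) :
    𝔤.koszulD n c ∈ 𝔤.koszulGr n g := by
  refine (Submodule.span_le (p := (𝔤.koszulGr n g).comap
    ((𝔤.koszulD n).restrictScalars K))).2 ?_ hc
  rintro _ ⟨h, k, rfl, u, hu, v, hv, rfl⟩
  refine (Submodule.span_le (p := (𝔤.koszulGr n (h + k)).comap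
    ((𝔤.koszulD n).restrictScalars K ∘ₗ TensorProduct.mk K _ _ u))).2 ?_ hv
  rintro _ ⟨x, γ, hx, rfl, rfl⟩
  change 𝔤.koszulD n (u ⊗ₜ 𝔤.wedge x) ∈ 𝔤.koszulGr n (h + ∑ i, γ i)
  rw [𝔤.isDifferential_koszulD n u x γ hx]
  exact add_mem (𝔤.mulPart_mem hu hx) (𝔤.bracketPart_mem hu hx)

theorem IsDifferential.unique {d d' : ∀ n, 𝔤.Koszul (n + 1) →ₗ[𝔤.Env] 𝔤.Koszul n}
    (hd : 𝔤.IsDifferential d) (hd' : 𝔤.IsDifferential d') : d' = d := by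
  funext n
  refine LinearMap.ext fun c => ?_
  induction c using 𝔤.koszul_induction
  case hzero => rw [map_zero, map_zero]
  case hadd c c' hc hc' => rw [map_add, map_add, hc, hc']
  case htmul g h u hu v hv =>
    refine (Submodule.span_le (p := LinearMap.eqLocus
      ((d' n).restrictScalars K ∘ₗ TensorProduct.mk K _ _ u)
      ((d n).restrictScalars K ∘ₗ TensorProduct.mk K _ _ u))).2 ?_ hv
    rintro _ ⟨x, γ, hx, rfl, rfl⟩
    exact (hd' n u x γ hx).trans (hd n u x γ hx).symm

theorem isGradedFreeResolution_koszulD [CharZero K] :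
    IsGradedFreeResolution 𝔤.envGr 𝔤.trivGr 𝔤.koszulGr 𝔤.koszulD 𝔤.augmentation where
  gradedAlg := 𝔤.isGradedAlg_envGr
  gradedMod := 𝔤.isGradedMod_trivGr
  gradedMod_complex := 𝔤.isGradedMod_koszulGr
  gradedFree := 𝔤.isGradedFree_koszulGr
  d_mem := fun _ _ _ hc => 𝔤.koszulD_mem hc
  η_mem := fun _ _ hc => 𝔤.augmentation_mem hc
  exact_d := 𝔤.exact_koszulD
  exact_η := 𝔤.exact_augmentation
  surjective_η := 𝔤.augmentation_surjective

end ColorLieAlgebra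

/-- The color Chevalley–Eilenberg differentials exist, are determined by their formula, and make
`C n = U(L) ⊗ ⋀ⁿ L` a `G`-graded free `U(L)`-resolution of the trivial module `K`. -/
theorem theorem3 {G K L : Type*} [AddCommGroup G] [DecidableEq G] [Field K] [CharZero K]
    (ε : SkewBicharacter G K) [AddCommGroup L] [Module K L] (𝔤 : ColorLieAlgebra ε L) :
    ∃ d : ∀ n, 𝔤.Koszul (n + 1) →ₗ[𝔤.Env] 𝔤.Koszul n,
      𝔤.IsDifferential d ∧ (∀ d', 𝔤.IsDifferential d' → d' = d) ∧
      IsGradedFreeResolution 𝔤.envGr 𝔤.trivGr 𝔤.koszulGr d 𝔤.augmentation :=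
  ⟨𝔤.koszulD, 𝔤.isDifferential_koszulD, fun _ hd' => 𝔤.isDifferential_koszulD.unique 𝔤 hd',
    𝔤.isGradedFreeResolution_koszulD⟩
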